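/- For every $n\ge 1$ there is a nondecreasing function $C_n:\mathbb R\to\mathbb R$ with the following property. Let $(N^{n+1},\bar g)$ be a smooth Riemannian manifold of constant sectional curvature $K\in\mathbb R$ (complete or not), let $M$ be a smooth $n$-dimensional manifold, let $T\in(0,\infty]$, and let $F:M\times(0,T)\to N$ be a smooth convex solution of the inverse mean curvature flow. This means: $F$ is smooth, each $F(\cdot,t)$ is an immersion (possibly incomplete) with unit normal field $\nu(\cdot,t)$, the second fundamental form $h_{ij}=\langle\bar\nabla_i\partial_jF,-\nu\rangle$ with respect to $-\nu$ is nonnegative definite, its trace $H=g^{ij}h_{ij}$ with respect to the induced metric $g(t)=F(\cdot,t)^*\bar g$ is positive, and $\partial_tF=H^{-1}\nu$. Let $\lambda_1$ be the lowest eigenvalue of $h^i_j=g^{ik}h_{kj}$. Then there are a time-dependent vector field $V$ and a scalar function $W$ on $M\times(0,T)$ (no continuity is claimed) with $$|V|\le C_n(|\nabla H|),\qquad |W|\le C_n(|\nabla H|)\qquad\text{at each point of }M\times(0,T),$$ such that $u:=\lambda_1/H$ is a viscosity supersolution on $M\times(0,T)$ of $$\frac{\partial u}{\partial t}-\frac1{H^2}\Delta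 u+\frac1{H^3}\langle V,\nabla u\rangle+\frac{W}{H^4}\,u\ \ge\ 0 ,$$ where the norms, $\langle\cdot,\cdot\rangle$, $\nabla$ and $\Delta$ at time $t$ are those of $g(t)$. That is, $u$ is lower semicontinuous, and whenever a function $\varphi$ of space and time that is $C^2$ near $(p,t)\in M\times(0,T)$ satisfies $\varphi(p,t)=u(p,t)$ and $\varphi(q,s)\le u(q,s)$ for all $(q,s)$ near $(p,t)$ with $s\le t$, then at $(p,t)$ $$\frac{\partial \varphi}{\partial t}-\frac1{H^2}\Delta \varphi+\frac1{H^3}\langle V,\nabla \varphi\rangle+\frac{W}{H^4}\,\varphi\ \ge\ 0 .$$ -/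

import Mathlib

open scoped Manifold ContDiff Topology

/- Every model space is a charted space over itself; this makes that standard instance the first
choice of instance search (a definitionally equal copy of it is found otherwise). -/
attribute [local instance 2000] chartedSpaceSelf

noncomputable section

namespace IMCF

/-! ### Coordinate calculus on open subsets of `ℝ^m` -/

/-- The partial derivative `∂_i f` at `z`. -/
def pderiv {m : ℕ} (i : Fin m) (f : EuclideanSpace ℝ (Fin m) → ℝ)
    (z : EuclideanSpace ℝ (Fin m)) : ℝ :=
  fderiv ℝ f z (EuclideanSpace.single i 1)

/-- The Christoffel symbols
`Γ^k_{ij} = 1/2 g^{kl} (∂_i g_{lj} + ∂_j g_{li} - ∂_l g_{ij})` of the metric `g_{ij} = G`. -/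
def christoffel {m : ℕ} (G : EuclideanSpace ℝ (Fin m) → Matrix (Fin m) (Fin m) ℝ)
    (z : EuclideanSpace ℝ (Fin m)) (k i j : Fin m) : ℝ :=
  (1 / 2) * ∑ l, (G z)⁻¹ k l *
    (pderiv i (fun y => G y l j) z + pderiv j (fun y => G y l i) z
      - pderiv l (fun y => G y i j) z)

/-- The curvature tensor `R^a_{bcd}`, with `R(∂_c, ∂_d) ∂_b = R^a_{bcd} ∂_a` and
`R(X, Y) Z = ∇_X ∇_Y Z - ∇_Y ∇_X Z - ∇_{[X, Y]} Z`. -/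
def riemann {m : ℕ} (G : EuclideanSpace ℝ (Fin m) → Matrix (Fin m) (Fin m) ℝ)
    (z : EuclideanSpace ℝ (Fin m)) (a b c d : Fin m) : ℝ :=
  pderiv c (fun y => christoffel G y a d b) z - pderiv d (fun y => christoffel G y a c b) z
    + ∑ e, (christoffel G z a c e * christoffel G z e d b
      - christoffel G z a d e * christoffel G z e c b)

/-- The sectional curvature `⟨R(v, w) w, v⟩ / (|v|² |w|² - ⟨v, w⟩²)` of the plane spanned by
`v = v^i ∂_i` and `w = w^i ∂_i`. -/
def sectionalCurvature {m : ℕ} (G : EuclideanSpace ℝ (Fin m) → Matrix (Fin m) (Fin m) ℝ)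
    (z : EuclideanSpace ℝ (Fin m)) (v w : Fin m → ℝ) : ℝ :=
  (∑ e, ∑ a, ∑ b, ∑ c, ∑ d, G z e a * riemann G z a b c d * v e * w b * v c * w d) /
    ((v ⬝ᵥ (G z).mulVec v) * (w ⬝ᵥ (G z).mulVec w) - (v ⬝ᵥ (G z).mulVec w) ^ 2)

/-! ### Manifolds with a field of bilinear forms -/

section Manifold

variable {m : ℕ} {X : Type*} [TopologicalSpace X] [ChartedSpace (EuclideanSpace ℝ (Fin m)) X]

/-- The coordinate vector field `∂_i` of the chart around `x₀`, at the point with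
coordinates `z`. -/
def coordVec (x₀ : X) (z : EuclideanSpace ℝ (Fin m)) (i : Fin m) :
    TangentSpace (𝓡 m) ((extChartAt (𝓡 m) x₀).symm z) :=
  mfderiv (𝓡 m) (𝓡 m) (extChartAt (𝓡 m) x₀).symm z
    (EuclideanSpace.single i 1 : EuclideanSpace ℝ (Fin m))

/-- The coefficients `b(∂_i, ∂_j)` of a field of bilinear forms `b` in the chart around `x₀`. -/
def coeff (b : ∀ x : X, TangentSpace (𝓡 m) x → TangentSpace (𝓡 m) x → ℝ) (x₀ : X)
    (z : EuclideanSpace ℝ (Fin m)) : Matrix (Fin m) (Fin m) ℝ :=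
  Matrix.of fun i j => b _ (coordVec x₀ z i) (coordVec x₀ z j)

/-- All sectional curvatures of the metric `b` are equal to `K`. -/
def HasConstantSectionalCurvature
    (b : ∀ x : X, TangentSpace (𝓡 m) x → TangentSpace (𝓡 m) x → ℝ) (K : ℝ) : Prop :=
  ∀ x₀ : X, ∀ z ∈ (extChartAt (𝓡 m) x₀).target, ∀ v w : Fin m → ℝ,
    LinearIndependent ℝ ![v, w] → sectionalCurvature (coeff b x₀) z v w = K

/-- The gradient `∇φ = g^{ij} ∂_j φ ∂_i` at `p` with respect to the metric `b`. -/
def gradient (b : ∀ x : X, TangentSpace (𝓡 m) x → TangentSpace (𝓡 m) x → ℝ)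
    (φ : X → ℝ) (p : X) : TangentSpace (𝓡 m) p :=
  let z : EuclideanSpace ℝ (Fin m) := extChartAt (𝓡 m) p p
  let G := coeff b p z
  let φc : EuclideanSpace ℝ (Fin m) → ℝ := fun y => φ ((extChartAt (𝓡 m) p).symm y)
  let e : Fin m → EuclideanSpace ℝ (Fin m) := fun i => coordVec p z i
  (∑ i, (∑ j, G⁻¹ i j * pderiv j φc z) • e i : EuclideanSpace ℝ (Fin m))

/-- The Laplacian `Δφ = g^{ij} (∂_i ∂_j φ - Γ^k_{ij} ∂_k φ)` at `p` with respect to the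
metric `b`. -/
def laplacian (b : ∀ x : X, TangentSpace (𝓡 m) x → TangentSpace (𝓡 m) x → ℝ)
    (φ : X → ℝ) (p : X) : ℝ :=
  let z : EuclideanSpace ℝ (Fin m) := extChartAt (𝓡 m) p p
  let G := coeff b p
  let φc : EuclideanSpace ℝ (Fin m) → ℝ := fun y => φ ((extChartAt (𝓡 m) p).symm y)
  ∑ i, ∑ j, (G z)⁻¹ i j *
    (pderiv i (pderiv j φc) z - ∑ k, christoffel G z k i j * pderiv k φc z)

/-- The norm of a tangent vector with respect to the metric `b`. -/
def tnorm (b : ∀ x : X, TangentSpace (𝓡 m) x → TangentSpace (𝓡 m) x → ℝ) (p : X)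
    (v : TangentSpace (𝓡 m) p) : ℝ :=
  Real.sqrt (b p v v)

/-- `u` is a viscosity supersolution on `X × J` of
`u_t - a Δ u + ⟨B, ∇ u⟩ + c u ≥ 0`, where `Δ`, `∇` and `⟨ , ⟩` at time `t` are those of the
metric `b t`: it is lower semicontinuous, and whenever a `C²` function `φ` of space and time
touches `u` from below at `(p, t)`, then `φ` satisfies the inequality at `(p, t)`. Touching is
parabolic: `φ ≤ u` is asked only near `(p, t)` and up to time `t`. -/
def IsViscositySupersolution (J : Set ℝ)
    (b : ℝ → ∀ x : X, TangentSpace (𝓡 m) x → TangentSpace (𝓡 m) x → ℝ)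
    (a : X → ℝ → ℝ) (B : ∀ x : X, ℝ → TangentSpace (𝓡 m) x) (c : X → ℝ → ℝ)
    (u : X → ℝ → ℝ) : Prop :=
  LowerSemicontinuousOn (fun z : X × ℝ => u z.1 z.2) (Set.univ ×ˢ J) ∧
  ∀ p : X, ∀ t ∈ J, ∀ φ : X → ℝ → ℝ,
    ContMDiffAt ((𝓡 m).prod 𝓘(ℝ, ℝ)) 𝓘(ℝ, ℝ) 2 (fun z : X × ℝ => φ z.1 z.2) (p, t) →
    φ p t = u p t →
    (∀ᶠ z in 𝓝[Set.univ ×ˢ Set.Iic t] ((p, t) : X × ℝ), φ z.1 z.2 ≤ u z.1 z.2) →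
    0 ≤ deriv (fun s => φ p s) t - a p t * laplacian (b t) (fun q => φ q t) p
      + b t p (B p t) (gradient (b t) (fun q => φ q t) p) + c p t * φ p t

end Manifold

/-! ### Hypersurfaces and the inverse mean curvature flow -/

section Flow

variable {n : ℕ}
  {M : Type*} [TopologicalSpace M] [ChartedSpace (EuclideanSpace ℝ (Fin n)) M]
  {N : Type*} [TopologicalSpace N] [ChartedSpace (EuclideanSpace ℝ (Fin (n + 1))) N]
  [IsManifold (𝓡 (n + 1)) ∞ N]

/-- Smooth Riemannian metrics on a manifold of dimension `m`. -/
abbrev SmoothMetric (m : ℕ) (X : Type*) [TopologicalSpace X]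
    [ChartedSpace (EuclideanSpace ℝ (Fin m)) X] [IsManifold (𝓡 m) ∞ X] :=
  haveI : IsManifold (𝓡 m) 1 X := IsManifold.of_le (n := ∞) (by simp)
  Bundle.ContMDiffRiemannianMetric (𝓡 m) ∞ (EuclideanSpace ℝ (Fin m))
    (fun x : X => TangentSpace (𝓡 m) x)

/-- A Riemannian metric as a field of bilinear forms. -/
def form (g : SmoothMetric (n + 1) N) (y : N) (v w : TangentSpace (𝓡 (n + 1)) y) : ℝ :=
  g.inner y v w

/-- The differential of `F(·, t)` at `p`. -/
def dF (F : M → ℝ → N) (t : ℝ) (p : M) (v : TangentSpace (𝓡 n) p) :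
    TangentSpace (𝓡 (n + 1)) (F p t) :=
  mfderiv (𝓡 n) (𝓡 (n + 1)) (fun q => F q t) p v

/-- The velocity `∂F/∂t (p, t)`. -/
def velocity (F : M → ℝ → N) (p : M) (t : ℝ) : TangentSpace (𝓡 (n + 1)) (F p t) :=
  mfderiv 𝓘(ℝ, ℝ) (𝓡 (n + 1)) (fun s => F p s) t (1 : ℝ)

/-- The induced metric `g(t)`, the pullback of the ambient metric under `F(·, t)`. -/
def inducedMetric (g : SmoothMetric (n + 1) N) (F : M → ℝ → N) (t : ℝ) (p : M)
    (v w : TangentSpace (𝓡 n) p) : ℝ :=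
  form g (F p t) (dF F t p v) (dF F t p w)

/-- The ambient covariant derivative `∇̄_{∂_i} (∂_j F)` at `(p, t)`: in coordinates `x` of `M`
and `y` of `N` its components are `∂_i ∂_j F^a + Γ̄^a_{bc} ∂_i F^b ∂_j F^c`. -/
def ambientHessian (g : SmoothMetric (n + 1) N) (F : M → ℝ → N) (p : M) (t : ℝ)
    (i j : Fin n) : TangentSpace (𝓡 (n + 1)) (F p t) :=
  let x : EuclideanSpace ℝ (Fin n) := extChartAt (𝓡 n) p p
  let y : EuclideanSpace ℝ (Fin (n + 1)) := extChartAt (𝓡 (n + 1)) (F p t) (F p t)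
  let f : Fin (n + 1) → EuclideanSpace ℝ (Fin n) → ℝ := fun a x' =>
    (extChartAt (𝓡 (n + 1)) (F p t) (F ((extChartAt (𝓡 n) p).symm x') t) :
      EuclideanSpace ℝ (Fin (n + 1))) a
  let e : Fin (n + 1) → EuclideanSpace ℝ (Fin (n + 1)) := fun a => coordVec (F p t) y a
  (∑ a, (pderiv i (pderiv j (f a)) x
      + ∑ b, ∑ c, christoffel (coeff (form g) (F p t)) y a b c
          * pderiv i (f b) x * pderiv j (f c) x) • e a :
    EuclideanSpace ℝ (Fin (n + 1)))

/-- The second fundamental form with respect to `-ν`: `h_{ij} = ⟨∇̄_{∂_i} (∂_j F), -ν⟩`. -/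
def secondFF (g : SmoothMetric (n + 1) N) (F : M → ℝ → N)
    (ν : ∀ (p : M) (t : ℝ), TangentSpace (𝓡 (n + 1)) (F p t)) (p : M) (t : ℝ) :
    Matrix (Fin n) (Fin n) ℝ :=
  Matrix.of fun i j => form g (F p t) (ambientHessian g F p t i j) (-ν p t)

/-- The matrix `h^i_j = g^{ik} h_{kj}`. -/
def shape (g : SmoothMetric (n + 1) N) (F : M → ℝ → N)
    (ν : ∀ (p : M) (t : ℝ), TangentSpace (𝓡 (n + 1)) (F p t)) (p : M) (t : ℝ) :
    Matrix (Fin n) (Fin n) ℝ :=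
  (coeff (inducedMetric g F t) p (extChartAt (𝓡 n) p p))⁻¹ * secondFF g F ν p t

/-- The mean curvature `H`, the trace of `h^i_j`. -/
def meanCurvature (g : SmoothMetric (n + 1) N) (F : M → ℝ → N)
    (ν : ∀ (p : M) (t : ℝ), TangentSpace (𝓡 (n + 1)) (F p t)) (p : M) (t : ℝ) : ℝ :=
  (shape g F ν p t).trace

/-- The lowest eigenvalue `λ₁` of `h^i_j`. -/
def lowestCurvature (g : SmoothMetric (n + 1) N) (F : M → ℝ → N)
    (ν : ∀ (p : M) (t : ℝ), TangentSpace (𝓡 (n + 1)) (F p t)) (p : M) (t : ℝ) : ℝ :=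
  sInf {l : ℝ | Module.End.HasEigenvalue (Matrix.toLin' (shape g F ν p t)) l}

/-- `F : M × J → (N, g)` is a smooth solution of the inverse mean curvature flow
`∂F/∂t = H⁻¹ ν`: every `F(·, t)` is an immersion with unit normal field `ν(·, t)`, and
the mean curvature `H` with respect to `-ν` is positive, so that `ν` points opposite to the
mean curvature vector `-H ν`. -/
structure IsSmoothIMCF (g : SmoothMetric (n + 1) N) (J : Set ℝ) (F : M → ℝ → N)
    (ν : ∀ (p : M) (t : ℝ), TangentSpace (𝓡 (n + 1)) (F p t)) : Prop where
  smooth : ContMDiffOn ((𝓡 n).prod 𝓘(ℝ, ℝ)) (𝓡 (n + 1)) ∞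
    (fun z : M × ℝ => F z.1 z.2) (Set.univ ×ˢ J)
  immersion : ∀ p : M, ∀ t ∈ J, Function.Injective (dF (n := n) F t p)
  normal : ∀ p : M, ∀ t ∈ J, ∀ v : TangentSpace (𝓡 n) p,
    form g (F p t) (ν p t) (dF (n := n) F t p v) = 0
  unit : ∀ p : M, ∀ t ∈ J, form g (F p t) (ν p t) (ν p t) = 1
  meanConvex : ∀ p : M, ∀ t ∈ J, 0 < meanCurvature g F ν p t
  flow : ∀ p : M, ∀ t ∈ J, velocity (n := n) F p t = (meanCurvature g F ν p t)⁻¹ • ν p t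

/-- The solution is convex: `h_{ij}` is nonnegative definite everywhere. -/
def IsConvexFlow (g : SmoothMetric (n + 1) N) (J : Set ℝ) (F : M → ℝ → N)
    (ν : ∀ (p : M) (t : ℝ), TangentSpace (𝓡 (n + 1)) (F p t)) : Prop :=
  ∀ p : M, ∀ t ∈ J, ∀ v : Fin n → ℝ, 0 ≤ v ⬝ᵥ (secondFF g F ν p t).mulVec v

/-- The time interval `(0, T)`, where `T` may be `∞`. -/
def timeInterval (T : EReal) : Set ℝ := {t : ℝ | 0 < t ∧ (t : EReal) < T}

end Flow

end IMCF

end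

noncomputable section
namespace IMCF

/-! ### Second order jets of functions of one variable -/

/-! Let `φ` touch `u = λ₁/H` from below at a point. Since `λ₁` is the minimum of the Rayleigh
quotient of `h` against `g`, touching means `φ H g(ζ,ζ) ≤ h(ζ,ζ)` for every vector `ζ`, at all
nearby points and times not later than the given one, with equality at the point itself for `ζ =
e_i`, a principal direction of `λ₁`. So `λ₁`, which need not be differentiable, is never
differentiated: everything follows from differentiating this inequality between twice differentiable
quantities.

In space, insert `ζ = e_i + c r e_k` along the line `x + r e_k`, where `c` is a free number. The
second derivative at `r = 0` is nonnegative; sum over `k`. By Codazzi (`IsAdapted.codazzi`) the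
cross terms become `4c ∇_i H`, and by Simons' identity (`IsAdapted.simons_aux`) `Δh_ii` becomes
`∇_i∇_i H` plus cubic curvature terms and `K(nλ₁ - H)`. In time only the past is available, so the
derivative has a sign. It is computed from `∂_t g = 2wh` and `∂_t h_ii = -∇_i∇_i w + wλ_i² - Kw`
(`IsAdapted.fderiv_time_diag`), where `w = 1/H`, and from the resulting equation for `H`.

Subtract the time inequality from `H⁻²` times the space inequality (`supersolution_algebra`). The
terms `∇_i∇_i H`, `ΔH` and all terms with `K` cancel; hence the bounds do not depend on `K`. The
cubic terms add up to `-2φw(|A|² - λ₁H) ≤ 0`. The dangerous term is `2w³(∇_i H)²`, which carries no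
factor `u` or `∇u`. The choice `c = -w(∇_i H - H∇_iφ - φ∇_i H)` produces a negative square that
cancels it up to multiples of `φ` and `∇_iφ`. What is left is the claim with `V = -2∇H + 4(∇_i
H)e_i` and `W = 4(∇_i H)² - 2|∇H|²`, so that `|V| = 2|∇H|` and `|W| ≤ 2|∇H|²`. Convexity enters
through `λ₁ ≥ 0`.

The computation is done in coordinates where the metric is Euclidean to first order at the point and
`h` is diagonal. They arise from a chart by a quadratic change of the space variables, and
`supersolution_coord` undoes the change. Two observations link this to the flow on manifolds. The
normal and the speed are smooth because they are the direction and length of `∂_t F`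
(`isFlowChart`). The second fundamental forms in different charts are compared through `∂_t g = 2wh`
(`exists_transition`), without second derivatives of transition maps. Lower semicontinuity is a
compactness argument on the unit sphere. -/

/-- `a` is twice differentiable at `0`, with value `a₀` and derivatives `a₁`, `a₂`. -/
def HasJet (a : ℝ → ℝ) (a₀ a₁ a₂ : ℝ) : Prop :=
  ∃ a' : ℝ → ℝ, (∀ᶠ r in 𝓝 (0 : ℝ), HasDerivAt a (a' r) r) ∧ HasDerivAt a' a₂ 0 ∧
    a 0 = a₀ ∧ a' 0 = a₁

theorem HasJet.of_eq {a : ℝ → ℝ} {a₀ a₁ a₂ b₀ b₁ b₂ : ℝ} (h : HasJet a a₀ a₁ a₂)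
    (h₀ : a₀ = b₀) (h₁ : a₁ = b₁) (h₂ : a₂ = b₂) : HasJet a b₀ b₁ b₂ := by
  subst h₀ h₁ h₂; exact h

theorem HasJet.congr {a b : ℝ → ℝ} {a₀ a₁ a₂ : ℝ} (h : HasJet a a₀ a₁ a₂)
    (hab : b =ᶠ[𝓝 0] a) : HasJet b a₀ a₁ a₂ := by
  obtain ⟨a', h1, h2, h3, h4⟩ := h
  refine ⟨a', ?_, h2, by rw [hab.self_of_nhds, h3], h4⟩
  filter_upwards [h1, hab.eventuallyEq_nhds] with r hr hr'
  exact hr.congr_of_eventuallyEq hr'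

theorem HasJet.unique {a : ℝ → ℝ} {a₀ a₁ a₂ b₀ b₁ b₂ : ℝ} (h : HasJet a a₀ a₁ a₂)
    (h' : HasJet a b₀ b₁ b₂) : a₀ = b₀ ∧ a₁ = b₁ ∧ a₂ = b₂ := by
  obtain ⟨a', h1, h2, h3, h4⟩ := h
  obtain ⟨b', k1, k2, k3, k4⟩ := h'
  have e : a' =ᶠ[𝓝 0] b' := by
    filter_upwards [h1, k1] with r hr hr' using hr.unique hr'
  exact ⟨h3.symm.trans k3, by rw [← h4, ← k4, e.self_of_nhds],
    h2.unique (k2.congr_of_eventuallyEq e)⟩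

theorem hasJet_const (c : ℝ) : HasJet (fun _ => c) c 0 0 :=
  ⟨fun _ => 0, Filter.Eventually.of_forall fun r => hasDerivAt_const r c,
    hasDerivAt_const 0 0, rfl, rfl⟩

theorem hasJet_id : HasJet (fun r => r) 0 1 0 :=
  ⟨fun _ => 1, Filter.Eventually.of_forall fun r => hasDerivAt_id r,
    hasDerivAt_const 0 1, rfl, rfl⟩

theorem HasJet.add {a b : ℝ → ℝ} {a₀ a₁ a₂ b₀ b₁ b₂ : ℝ} (h : HasJet a a₀ a₁ a₂)
    (k : HasJet b b₀ b₁ b₂) : HasJet (fun r => a r + b r) (a₀ + b₀) (a₁ + b₁) (a₂ + b₂) := by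
  obtain ⟨a', h1, h2, h3, h4⟩ := h
  obtain ⟨b', k1, k2, k3, k4⟩ := k
  refine ⟨fun r => a' r + b' r, ?_, h2.add k2, by simp [h3, k3], by simp [h4, k4]⟩
  filter_upwards [h1, k1] with r hr kr using hr.add kr

theorem HasJet.mul {a b : ℝ → ℝ} {a₀ a₁ a₂ b₀ b₁ b₂ : ℝ} (h : HasJet a a₀ a₁ a₂)
    (k : HasJet b b₀ b₁ b₂) : HasJet (fun r => a r * b r) (a₀ * b₀) (a₁ * b₀ + a₀ * b₁)
      (a₂ * b₀ + 2 * a₁ * b₁ + a₀ * b₂) := by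
  obtain ⟨a', h1, h2, h3, h4⟩ := h
  obtain ⟨b', k1, k2, k3, k4⟩ := k
  refine ⟨fun r => a' r * b r + a r * b' r, ?_, ?_, by simp [h3, k3], by simp [h3, h4, k3, k4]⟩
  · filter_upwards [h1, k1] with r hr kr using hr.mul kr
  · convert! (h2.mul k1.self_of_nhds).add (h1.self_of_nhds.mul k2) using 1
    rw [h3, h4, k3, k4]; ring

theorem HasJet.const_mul {a : ℝ → ℝ} {a₀ a₁ a₂ : ℝ} (c : ℝ) (h : HasJet a a₀ a₁ a₂) :
    HasJet (fun r => c * a r) (c * a₀) (c * a₁) (c * a₂) :=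
  ((hasJet_const c).mul h).of_eq (by ring) (by ring) (by ring)

theorem HasJet.sub {a b : ℝ → ℝ} {a₀ a₁ a₂ b₀ b₁ b₂ : ℝ} (h : HasJet a a₀ a₁ a₂)
    (k : HasJet b b₀ b₁ b₂) : HasJet (fun r => a r - b r) (a₀ - b₀) (a₁ - b₁) (a₂ - b₂) :=
  ((h.add (k.const_mul (-1))).of_eq (by ring) (by ring) (by ring)).congr
    (Filter.Eventually.of_forall fun r => by ring)

theorem HasJet.sum {ι : Type*} (s : Finset ι) {a : ι → ℝ → ℝ} {a₀ a₁ a₂ : ι → ℝ}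
    (h : ∀ i ∈ s, HasJet (a i) (a₀ i) (a₁ i) (a₂ i)) :
    HasJet (fun r => ∑ i ∈ s, a i r) (∑ i ∈ s, a₀ i) (∑ i ∈ s, a₁ i) (∑ i ∈ s, a₂ i) := by
  classical
  induction s using Finset.induction_on with
  | empty => simpa using hasJet_const 0
  | insert i s hi ih =>
    simp only [Finset.sum_insert hi]
    exact (h i (by simp)).add (ih fun j hj => h j (by simp [hj]))

theorem hasJet_of_contDiffAt {a : ℝ → ℝ} (h : ContDiffAt ℝ 2 a 0) :
    ∃ a₀ a₁ a₂, HasJet a a₀ a₁ a₂ := by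
  have h1 : ∀ᶠ r in 𝓝 (0 : ℝ), ContDiffAt ℝ 2 a r := h.eventually (by simp)
  have h2 : ContDiffAt ℝ 1 (deriv a) 0 := by
    simpa using h.fderiv_right (m := 1) (by norm_num) |>.clm_apply (contDiffAt_const (c := (1 : ℝ)))
  exact ⟨_, _, _, deriv a, h1.mono fun r hr => (hr.differentiableAt (by simp)).hasDerivAt,
    (h2.differentiableAt (by simp)).hasDerivAt, rfl, rfl⟩

/-- If `a₂ < 0`, the critical point `0` would be a local maximum as well as a local minimum, so `a`
would be locally constant and `a₂ = 0`. Twice differentiability at the single point suffices. -/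
theorem HasJet.nonneg_of_min {a : ℝ → ℝ} {a₁ a₂ : ℝ} (h : HasJet a 0 a₁ a₂)
    (hn : ∀ᶠ r in 𝓝 (0 : ℝ), 0 ≤ a r) : 0 ≤ a₂ := by
  obtain ⟨a', h1, h2, h3, h4⟩ := h
  by_contra! hneg
  have hmin : IsLocalMin a 0 := by filter_upwards [hn] with r hr; rwa [h3]
  have e1 : deriv a =ᶠ[𝓝 0] a' := h1.mono fun r hr => hr.deriv
  have h0 : deriv a 0 = 0 := hmin.deriv_eq_zero
  have e2 : deriv (deriv a) 0 = a₂ := by rw [e1.deriv_eq, h2.deriv]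
  have hmax : IsLocalMax a 0 := isLocalMax_of_deriv_deriv_neg (by rwa [e2]) h0
    h1.self_of_nhds.continuousAt
  have ez : a =ᶠ[𝓝 0] fun _ => 0 := by
    filter_upwards [hn, hmax] with r h1 h2
    rw [h3] at h2; exact le_antisymm h2 h1
  have := (HasJet.unique ⟨a', h1, h2, h3, h4⟩ ((hasJet_const 0).congr ez)).2.2
  linarith

/-- The jet of a twice differentiable function along a line. -/
theorem hasJet_line {P : Type*} [NormedAddCommGroup P] [NormedSpace ℝ P] {φ : P → ℝ} {x : P}
    (h : ContDiffAt ℝ 2 φ x) (ξ : P) :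
    HasJet (fun r => φ (x + r • ξ)) (φ x) (fderiv ℝ φ x ξ)
      (fderiv ℝ (fun y => fderiv ℝ φ y ξ) x ξ) := by
  have hl : ∀ r : ℝ, HasDerivAt (fun r : ℝ => x + r • ξ) ξ r := fun r => by
    simpa using ((hasDerivAt_id r).smul_const ξ).const_add x
  have hc : ContinuousAt (fun r : ℝ => x + r • ξ) 0 := (hl 0).continuousAt
  have h1 : ∀ᶠ y in 𝓝 x, ContDiffAt ℝ 2 φ y := h.eventually (by simp)
  have h2 : DifferentiableAt ℝ (fun y => fderiv ℝ φ y ξ) x :=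
    ((h.fderiv_right (m := 1) (by norm_num)).clm_apply contDiffAt_const).differentiableAt (by simp)
  refine ⟨fun r => fderiv ℝ φ (x + r • ξ) ξ, ?_, ?_, by simp, by simp⟩
  · have : ∀ᶠ r in 𝓝 (0 : ℝ), ContDiffAt ℝ 2 φ (x + r • ξ) :=
      hc.eventually (by simpa using h1)
    filter_upwards [this] with r hr
    exact ((hr.differentiableAt (by simp)).hasFDerivAt).comp_hasDerivAt r (hl r)
  · have h2' : HasFDerivAt (fun y => fderiv ℝ φ y ξ) (fderiv ℝ (fun y => fderiv ℝ φ y ξ) x)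
        (x + (0 : ℝ) • ξ) := by simpa using h2.hasFDerivAt
    exact h2'.comp_hasDerivAt (0 : ℝ) (hl 0)

/-- The first and second derivative of `tr (g⁻¹ h)` at a point where `g = 1`. -/
theorem HasJet.trace_inv_mul {n : ℕ} {g h : ℝ → Matrix (Fin n) (Fin n) ℝ} {H : ℝ → ℝ}
    {H₀ H₁ H₂ : ℝ} {h₀ h₁ h₂ g₁ g₂ : Matrix (Fin n) (Fin n) ℝ}
    (hg : ∀ k l, HasJet (fun r => g r k l) ((1 : Matrix (Fin n) (Fin n) ℝ) k l) (g₁ k l) (g₂ k l))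
    (hgs : ∀ k l, ContDiffAt ℝ 2 (fun r => g r k l) 0)
    (hh : ∀ k l, HasJet (fun r => h r k l) (h₀ k l) (h₁ k l) (h₂ k l))
    (hH : HasJet H H₀ H₁ H₂) (hHe : ∀ᶠ r in 𝓝 (0 : ℝ), H r = ((g r)⁻¹ * h r).trace) :
    H₁ = ∑ k, h₁ k k - ∑ k, ∑ l, g₁ k l * h₀ l k ∧
    (g₁ = 0 → H₂ = ∑ k, h₂ k k - ∑ k, ∑ l, g₂ k l * h₀ l k) := by
  have hg0 : g 0 = 1 := by
    ext k l; obtain ⟨_, _, _, h3, _⟩ := hg k l; exact h3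
  have hgc : ContDiffAt ℝ 2 (fun r => (g r).det) 0 := by
    simp only [Matrix.det_apply']
    exact ContDiffAt.sum fun σ _ => contDiffAt_const.mul (contDiffAt_prod fun i _ => hgs _ _)
  have hdet : (g 0).det ≠ 0 := by simp [hg0]
  have hdet' : ∀ᶠ r in 𝓝 (0 : ℝ), (g r).det ≠ 0 :=
    hgc.continuousAt.eventually_ne hdet
  have hBs : ∀ k l, ContDiffAt ℝ 2 (fun r => (g r)⁻¹ k l) 0 := by
    intro k l
    simp only [Matrix.inv_def, Matrix.smul_apply, Ring.inverse_eq_inv', smul_eq_mul,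
      Matrix.adjugate_apply]
    refine (hgc.inv hdet).mul ?_
    simp only [Matrix.det_apply']
    refine ContDiffAt.sum fun σ _ => contDiffAt_const.mul (contDiffAt_prod fun i _ => ?_)
    by_cases hi : σ i = l
    · subst hi; simpa using contDiffAt_const
    · simpa [Matrix.updateRow_ne hi] using hgs _ _
  choose B₀ B₁ B₂ hB using fun k l => hasJet_of_contDiffAt (hBs k l)
  have hB0 : ∀ k l, B₀ k l = (1 : Matrix (Fin n) (Fin n) ℝ) k l := by
    intro k l; obtain ⟨_, _, _, h3, _⟩ := hB k l; rw [← h3]; simp [hg0]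
  -- The derivatives of `g⁻¹` come from comparing the jet of the product `g⁻¹ g` with that of the
  -- constant `1`.
  have key : ∀ k m, HasJet (fun r => ((g r)⁻¹ * g r) k m)
      (∑ l, B₀ k l * (1 : Matrix (Fin n) (Fin n) ℝ) l m)
      (∑ l, (B₁ k l * (1 : Matrix (Fin n) (Fin n) ℝ) l m + B₀ k l * g₁ l m))
      (∑ l, (B₂ k l * (1 : Matrix (Fin n) (Fin n) ℝ) l m + 2 * B₁ k l * g₁ l m
        + B₀ k l * g₂ l m)) := by
    intro k m
    simp only [Matrix.mul_apply]
    exact HasJet.sum _ fun l _ => (hB k l).mul (hg l m)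
  have key2 : ∀ k m, HasJet (fun r => ((g r)⁻¹ * g r) k m)
      ((1 : Matrix (Fin n) (Fin n) ℝ) k m) 0 0 := by
    intro k m
    refine (hasJet_const _).congr ?_
    filter_upwards [hdet'] with r hr
    rw [Matrix.nonsing_inv_mul _ (by simpa using hr)]
  have hB1 : ∀ k m, B₁ k m = - g₁ k m := by
    intro k m
    have := ((key k m).unique (key2 k m)).2.1
    simp only [hB0, Finset.sum_add_distrib, Matrix.one_apply, mul_ite, ite_mul, mul_one, mul_zero,
      one_mul, zero_mul, Finset.sum_ite_eq, Finset.sum_ite_eq', Finset.mem_univ, if_true] at this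
    linarith
  have hB2 : g₁ = 0 → ∀ k m, B₂ k m = - g₂ k m := by
    intro h0 k m
    have := ((key k m).unique (key2 k m)).2.2
    simp only [hB0, hB1, h0, Finset.sum_add_distrib, Matrix.one_apply, mul_ite, ite_mul, mul_one,
      mul_zero, one_mul, zero_mul, Finset.sum_ite_eq, Finset.sum_ite_eq', Finset.mem_univ,
      if_true, Matrix.zero_apply, Finset.sum_const_zero, neg_zero] at this
    linarith
  have hT : HasJet H (∑ k, ∑ l, B₀ k l * h₀ l k)
      (∑ k, ∑ l, (B₁ k l * h₀ l k + B₀ k l * h₁ l k))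
      (∑ k, ∑ l, (B₂ k l * h₀ l k + 2 * B₁ k l * h₁ l k + B₀ k l * h₂ l k)) := by
    refine (HasJet.sum Finset.univ fun k _ => HasJet.sum Finset.univ fun l _ =>
      (hB k l).mul (hh l k)).congr ?_
    filter_upwards [hHe] with r hr
    rw [hr]; simp [Matrix.trace, Matrix.mul_apply]
  obtain ⟨-, e1, e2⟩ := hH.unique hT
  constructor
  · rw [e1]
    simp only [hB0, hB1, Finset.sum_add_distrib, Matrix.one_apply, ite_mul, one_mul, zero_mul,
      Finset.sum_ite_eq, Finset.mem_univ, if_true, neg_mul, Finset.sum_neg_distrib]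
    ring
  · intro h0
    rw [e2]
    simp only [hB0, hB1, hB2 h0, h0, Finset.sum_add_distrib, Matrix.one_apply, ite_mul, one_mul,
      zero_mul, Finset.sum_ite_eq, Finset.mem_univ, if_true, neg_mul, Finset.sum_neg_distrib,
      Matrix.zero_apply, neg_zero, mul_zero, Finset.sum_const_zero]
    ring

/-! ### Connections along a map -/

section Connection

variable {P W : Type*} [NormedAddCommGroup P] [NormedSpace ℝ P]
  [NormedAddCommGroup W] [NormedSpace ℝ W]

/-- The partial derivative of `f` in the direction `ξ`, as a vector field along `f`. -/
def along (f : P → W) (ξ : P) (x : P) : W := fderiv ℝ f x ξ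

/-- The covariant derivative of a vector field `Y` along a map, for the connection form `A`. -/
def covD (A : P → P →L[ℝ] W →L[ℝ] W) (ξ : P) (Y : P → W) (x : P) : W :=
  fderiv ℝ Y x ξ + A x ξ (Y x)

/-- The metric `G` and the connection form `A` along the map `f` behave like the pullbacks of a
metric of constant sectional curvature `K` and of its Levi-Civita connection. -/
structure IsSpaceFormMap (U : Set P) (f : P → W) (G : P → W →L[ℝ] W →L[ℝ] ℝ)
    (A : P → P →L[ℝ] W →L[ℝ] W) (K : ℝ) : Prop where
  isOpen : IsOpen U
  smooth : ContDiffOn ℝ ∞ f U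
  smooth_metric : ContDiffOn ℝ ∞ G U
  smooth_conn : ContDiffOn ℝ ∞ A U
  symm : ∀ x ∈ U, ∀ u v, G x u v = G x v u
  compat : ∀ x ∈ U, ∀ ξ u v, fderiv ℝ G x ξ u v = G x (A x ξ u) v + G x u (A x ξ v)
  torsion : ∀ x ∈ U, ∀ ξ η, A x ξ (fderiv ℝ f x η) = A x η (fderiv ℝ f x ξ)
  curv : ∀ x ∈ U, ∀ ξ η u, fderiv ℝ A x ξ η u - fderiv ℝ A x η ξ u
    + A x ξ (A x η u) - A x η (A x ξ u)
      = K • (G x (fderiv ℝ f x η) u • fderiv ℝ f x ξ - G x (fderiv ℝ f x ξ) u • fderiv ℝ f x η)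

theorem contDiffOn_along {U : Set P} {V : Type*} [NormedAddCommGroup V] [NormedSpace ℝ V]
    {f : P → V} (hU : IsOpen U) (hf : ContDiffOn ℝ ∞ f U) (ξ : P) :
    ContDiffOn ℝ ∞ (fun x => fderiv ℝ f x ξ) U :=
  (hf.fderiv_of_isOpen hU (by simp)).clm_apply contDiffOn_const

theorem differentiableAt_of_contDiffOn {U : Set P} {V : Type*} [NormedAddCommGroup V]
    [NormedSpace ℝ V] {f : P → V} (hU : IsOpen U) (hf : ContDiffOn ℝ ∞ f U) {x : P} (hx : x ∈ U) :
    DifferentiableAt ℝ f x :=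
  (hf.contDiffAt (hU.mem_nhds hx)).differentiableAt (by simp)

theorem fderiv_eq_of_eqOn {U : Set P} {V : Type*} [NormedAddCommGroup V]
    [NormedSpace ℝ V] {f g : P → V} (hU : IsOpen U) (h : ∀ y ∈ U, f y = g y) {x : P} (hx : x ∈ U) :
    fderiv ℝ f x = fderiv ℝ g x :=
  Filter.EventuallyEq.fderiv_eq (Filter.eventuallyEq_of_mem (hU.mem_nhds hx) h)

theorem fderiv_fderiv_comm {U : Set P} {V : Type*} [NormedAddCommGroup V]
    [NormedSpace ℝ V] {f : P → V} (hU : IsOpen U) (hf : ContDiffOn ℝ ∞ f U) {x : P} (hx : x ∈ U)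
    (ξ η : P) : fderiv ℝ (fun y => fderiv ℝ f y η) x ξ = fderiv ℝ (fun y => fderiv ℝ f y ξ) x η := by
  have hd : DifferentiableAt ℝ (fderiv ℝ f) x :=
    differentiableAt_of_contDiffOn hU (hf.fderiv_of_isOpen hU (by simp)) hx
  have hs := (hf.contDiffAt (hU.mem_nhds hx)).isSymmSndFDerivAt
    (by simpa using ENat.LEInfty.out)
  rw [fderiv_clm_apply hd (differentiableAt_const _), fderiv_clm_apply hd
      (differentiableAt_const _)]
  simpa using hs.eq ξ η

variable {U : Set P} {f : P → W} {G : P → W →L[ℝ] W →L[ℝ] ℝ}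
    {A : P → P →L[ℝ] W →L[ℝ] W} {K : ℝ}

namespace IsSpaceFormMap

theorem smooth_along (S : IsSpaceFormMap U f G A K) (ξ : P) : ContDiffOn ℝ ∞ (along f ξ) U :=
  contDiffOn_along S.isOpen S.smooth ξ

theorem smooth_covD (S : IsSpaceFormMap U f G A K) {Y : P → W} (hY : ContDiffOn ℝ ∞ Y U) (ξ : P) :
    ContDiffOn ℝ ∞ (covD A ξ Y) U :=
  (contDiffOn_along S.isOpen hY ξ).add ((S.smooth_conn.clm_apply contDiffOn_const).clm_apply hY)

theorem smooth_ip (S : IsSpaceFormMap U f G A K) {Y Z : P → W} (hY : ContDiffOn ℝ ∞ Y U)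
    (hZ : ContDiffOn ℝ ∞ Z U) : ContDiffOn ℝ ∞ (fun x => G x (Y x) (Z x)) U :=
  (S.smooth_metric.clm_apply hY).clm_apply hZ

theorem covD_congr (S : IsSpaceFormMap U f G A K) {Y Z : P → W} (h : ∀ y ∈ U, Y y = Z y)
    {x : P} (hx : x ∈ U) (ξ : P) : covD A ξ Y x = covD A ξ Z x := by
  rw [covD, covD, fderiv_eq_of_eqOn S.isOpen h hx, h x hx]

theorem fderiv_ip (S : IsSpaceFormMap U f G A K) {Y Z : P → W} (hY : ContDiffOn ℝ ∞ Y U)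
    (hZ : ContDiffOn ℝ ∞ Z U) {x : P} (hx : x ∈ U) (ξ : P) :
    fderiv ℝ (fun x => G x (Y x) (Z x)) x ξ =
      G x (covD A ξ Y x) (Z x) + G x (Y x) (covD A ξ Z x) := by
  have h1 := differentiableAt_of_contDiffOn S.isOpen S.smooth_metric hx
  have h2 := differentiableAt_of_contDiffOn S.isOpen hY hx
  have h3 := differentiableAt_of_contDiffOn S.isOpen hZ hx
  rw [fderiv_clm_apply (h1.clm_apply h2) h3, fderiv_clm_apply h1 h2]
  simp only [covD, map_add, add_apply, ContinuousLinearMap.comp_apply,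
    ContinuousLinearMap.flip_apply, S.compat x hx]
  ring

theorem fderiv_fderiv_ip (S : IsSpaceFormMap U f G A K) {Y Z : P → W} (hY : ContDiffOn ℝ ∞ Y U)
    (hZ : ContDiffOn ℝ ∞ Z U) {x : P} (hx : x ∈ U) (ξ η : P) :
    fderiv ℝ (fun y => fderiv ℝ (fun x => G x (Y x) (Z x)) y η) x ξ =
      G x (covD A ξ (covD A η Y) x) (Z x) + G x (covD A η Y x) (covD A ξ Z x) +
      G x (covD A ξ Y x) (covD A η Z x) + G x (Y x) (covD A ξ (covD A η Z) x) := by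
  rw [fderiv_eq_of_eqOn S.isOpen (fun y hy => S.fderiv_ip hY hZ hy η) hx]
  have h1 := S.smooth_covD hY η
  have h2 := S.smooth_covD hZ η
  rw [fderiv_fun_add (differentiableAt_of_contDiffOn S.isOpen (S.smooth_ip h1 hZ) hx)
    (differentiableAt_of_contDiffOn S.isOpen (S.smooth_ip hY h2) hx),
    add_apply, S.fderiv_ip h1 hZ hx, S.fderiv_ip hY h2 hx]
  ring

/-- Torsion-freeness of the connection together with symmetry of the second derivative of `f`. -/
theorem covD_along_comm (S : IsSpaceFormMap U f G A K) {x : P} (hx : x ∈ U) (ξ η : P) :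
    covD A ξ (along f η) x = covD A η (along f ξ) x := by
  simp only [covD, along]
  rw [S.torsion x hx ξ η]
  congr 1
  exact fderiv_fderiv_comm S.isOpen S.smooth hx ξ η

theorem covD_smul (S : IsSpaceFormMap U f G A K) {a : P → ℝ} {Y : P → W}
    (ha : ContDiffOn ℝ ∞ a U) (hY : ContDiffOn ℝ ∞ Y U) {x : P} (hx : x ∈ U) (ξ : P) :
    covD A ξ (fun y => a y • Y y) x = fderiv ℝ a x ξ • Y x + a x • covD A ξ Y x := by
  simp only [covD]
  rw [fderiv_fun_smul (differentiableAt_of_contDiffOn S.isOpen ha hx)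
    (differentiableAt_of_contDiffOn S.isOpen hY hx)]
  simp
  abel

/-- Second derivatives of `Y` commute and the mixed terms `A(∂Y)` are symmetric, so the commutator
is the curvature of `A` applied to `Y`, which the constant curvature condition makes explicit. -/
theorem covD_comm (S : IsSpaceFormMap U f G A K) {Y : P → W} (hY : ContDiffOn ℝ ∞ Y U)
    {x : P} (hx : x ∈ U) (ξ η : P) :
    covD A ξ (covD A η Y) x = covD A η (covD A ξ Y) x
      + K • (G x (along f η x) (Y x) • along f ξ x - G x (along f ξ x) (Y x) • along f η x) := by
  have hA := differentiableAt_of_contDiffOn S.isOpen S.smooth_conn hx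
  have hYd := differentiableAt_of_contDiffOn S.isOpen hY hx
  have key : ∀ ξ η : P, covD A ξ (covD A η Y) x = fderiv ℝ (fun y => fderiv ℝ Y y η) x ξ
      + fderiv ℝ A x ξ η (Y x) + A x η (fderiv ℝ Y x ξ) + A x ξ (fderiv ℝ Y x η)
      + A x ξ (A x η (Y x)) := by
    intro ξ η
    have h1 : DifferentiableAt ℝ (fun y => A y η) x := hA.clm_apply (differentiableAt_const _)
    have e : fderiv ℝ (covD A η Y) x ξ = fderiv ℝ (fun y => fderiv ℝ Y y η) x ξ
        + (fderiv ℝ A x ξ η (Y x) + A x η (fderiv ℝ Y x ξ)) := by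
      rw [show covD A η Y = fun y => fderiv ℝ Y y η + A y η (Y y) from rfl,
        fderiv_fun_add (differentiableAt_of_contDiffOn S.isOpen
          (contDiffOn_along S.isOpen hY η) hx) (h1.clm_apply hYd), fderiv_clm_apply h1 hYd,
        fderiv_clm_apply hA (differentiableAt_const _)]
      simp [add_comm]
    rw [covD, e]
    simp only [covD, map_add]
    abel
  rw [key ξ η, key η ξ, fderiv_fderiv_comm S.isOpen hY hx ξ η]
  have := S.curv x hx ξ η (Y x)
  simp only [along]
  rw [← this]
  abel

end IsSpaceFormMap

end Connection

/-! ### The flow in a chart -/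

section FlowChart

variable {E W : Type*} [NormedAddCommGroup E] [NormedSpace ℝ E]
  [NormedAddCommGroup W] [NormedSpace ℝ W]

/-- The map `f` of space and time moves with velocity `w ν`, where `ν` is a unit normal field. -/
structure IsFlowChart (U : Set (E × ℝ)) (f : E × ℝ → W) (G : E × ℝ → W →L[ℝ] W →L[ℝ] ℝ)
    (A : E × ℝ → (E × ℝ) →L[ℝ] W →L[ℝ] W) (K : ℝ) (ν : E × ℝ → W) (w : E × ℝ → ℝ) : Prop
    extends IsSpaceFormMap U f G A K where
  smooth_normal : ContDiffOn ℝ ∞ ν U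
  smooth_speed : ContDiffOn ℝ ∞ w U
  speed_pos : ∀ x ∈ U, 0 < w x
  unit : ∀ x ∈ U, G x (ν x) (ν x) = 1
  normal : ∀ x ∈ U, ∀ ξ : E, G x (ν x) (along f (ξ, 0) x) = 0
  velocity : ∀ x ∈ U, along f (0, 1) x = w x • ν x

variable {U : Set (E × ℝ)} {f : E × ℝ → W} {G : E × ℝ → W →L[ℝ] W →L[ℝ] ℝ}
    {A : E × ℝ → (E × ℝ) →L[ℝ] W →L[ℝ] W} {K : ℝ} {ν : E × ℝ → W} {w : E × ℝ → ℝ}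

namespace IsFlowChart

variable (S : IsFlowChart U f G A K ν w) {x : E × ℝ} (hx : x ∈ U)
include S hx

theorem ip_covD_normal_normal (ξ : E × ℝ) : G x (covD A ξ ν x) (ν x) = 0 := by
  have h := S.fderiv_ip S.smooth_normal S.smooth_normal hx ξ
  rw [fderiv_eq_of_eqOn S.isOpen (g := fun _ => (1 : ℝ)) S.unit hx, S.symm x hx (ν x)] at h
  simp at h
  linarith

theorem ip_covD_normal (ξ : E × ℝ) (η : E) : G x (covD A ξ ν x) (along f (η, 0) x) =
    - G x (ν x) (covD A ξ (along f (η, 0)) x) := by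
  have h := S.fderiv_ip S.smooth_normal (S.smooth_along (η, 0)) hx ξ
  rw [fderiv_eq_of_eqOn S.isOpen (g := fun _ => (0 : ℝ)) (fun y hy => S.normal y hy η) hx] at h
  simp at h
  linarith

theorem ip_covD_normal_symm (ξ η : E) : G x (covD A (ξ, 0) ν x) (along f (η, 0) x) =
    G x (covD A (η, 0) ν x) (along f (ξ, 0) x) := by
  rw [S.ip_covD_normal hx, S.ip_covD_normal hx, S.covD_along_comm hx]

/-- Exchange the time and space derivatives and differentiate the flow equation `∂_t F = wν`. -/
theorem covD_time_along (ξ : E) : covD A (0, 1) (along f (ξ, 0)) x =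
    fderiv ℝ w x (ξ, 0) • ν x + w x • covD A (ξ, 0) ν x := by
  rw [S.covD_along_comm hx, S.covD_congr S.velocity hx,
    S.covD_smul S.smooth_speed S.smooth_normal hx]

/-- The second fundamental form is half of the time derivative of the metric, up to the speed. -/
theorem fderiv_time_metric (ξ η : E) :
    fderiv ℝ (fun y => G y (along f (ξ, 0) y) (along f (η, 0) y)) x (0, 1) =
      2 * w x * G x (covD A (ξ, 0) ν x) (along f (η, 0) x) := by
  rw [S.fderiv_ip (S.smooth_along _) (S.smooth_along _) hx, S.covD_time_along hx,
    S.covD_time_along hx]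
  simp only [map_add, map_smul, add_apply, smul_apply,
    smul_eq_mul, S.normal x hx, S.symm x hx (along f (ξ, 0) x)]
  rw [S.ip_covD_normal_symm hx η ξ]
  ring

/-- In a space form the curvature `R(∂_ξ, ∂_η)ν` only involves the products of `ν` with tangent
vectors, which vanish. This is the source of the Codazzi equation. -/
theorem covD_normal_comm (ξ η : E) :
    covD A (ξ, 0) (covD A (η, 0) ν) x = covD A (η, 0) (covD A (ξ, 0) ν) x := by
  rw [S.covD_comm S.smooth_normal hx, S.symm x hx _ (ν x), S.symm x hx _ (ν x), S.normal x hx,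
    S.normal x hx]
  simp

theorem ip_covD_covD_normal_normal (ξ η : E × ℝ) :
    G x (covD A ξ (covD A η ν) x) (ν x) = - G x (covD A η ν x) (covD A ξ ν x) := by
  have h := S.fderiv_ip (S.smooth_covD S.smooth_normal η) S.smooth_normal hx ξ
  rw [fderiv_eq_of_eqOn S.isOpen (g := fun _ => (0 : ℝ))
    (fun y hy => S.ip_covD_normal_normal hy η) hx] at h
  simp at h
  linarith

end IsFlowChart

/-- The coordinates are adapted to the point `x`: the frame `e` is orthonormal, it diagonalises
the second fundamental form, and the first derivatives of the metric vanish. -/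
structure IsAdapted {n : ℕ} (f : E × ℝ → W) (G : E × ℝ → W →L[ℝ] W →L[ℝ] ℝ)
    (A : E × ℝ → (E × ℝ) →L[ℝ] W →L[ℝ] W) (ν : E × ℝ → W) (x : E × ℝ) (e : Fin n → E)
    (lam : Fin n → ℝ) : Prop where
  finrank_eq : Module.finrank ℝ W = n + 1
  orthonormal : ∀ k l, G x (along f (e k, 0) x) (along f (e l, 0) x) = if k = l then 1 else 0
  diagonal : ∀ k l, G x (covD A (e k, 0) ν x) (along f (e l, 0) x) = if k = l then lam k else 0
  normalCoord : ∀ k l m,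
    fderiv ℝ (fun y => G y (along f (e k, 0) y) (along f (e l, 0) y)) x (e m, 0) = 0

/-- Vectors with the same products with the vectors of an orthonormal basis are equal. -/
theorem eq_of_ip_eq {n : ℕ} (B : W →L[ℝ] W →L[ℝ] ℝ) (hdim : Module.finrank ℝ W = n + 1)
    {F : Fin n → W} {N : W} (hF : ∀ k l, B (F k) (F l) = if k = l then 1 else 0)
    (hN : B N N = 1) (hFN : ∀ k, B (F k) N = 0) (hNF : ∀ k, B N (F k) = 0) {u v : W}
    (h : ∀ k, B u (F k) = B v (F k)) (h' : B u N = B v N) : u = v := by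
  have : FiniteDimensional ℝ W := FiniteDimensional.of_finrank_pos (by omega)
  let b : Fin (n + 1) → W := Fin.cons N F
  have hb : ∀ i j, B (b i) (b j) = if i = j then 1 else 0 := by
    intro i j
    refine Fin.cases ?_ (fun i => ?_) i <;> refine Fin.cases ?_ (fun j => ?_) j <;>
      simp [b, hF, hN, hFN, hNF, Fin.succ_ne_zero, (Fin.succ_ne_zero _).symm]
  have hli : LinearIndependent ℝ b := by
    rw [Fintype.linearIndependent_iff]
    intro c hc i
    have : B (∑ j, c j • b j) (b i) = 0 := by simp [hc]
    simpa [hb] using this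
  have hspan : Submodule.span ℝ (Set.range b) = ⊤ :=
    hli.span_eq_top_of_card_eq_finrank' (by simp [hdim])
  obtain ⟨c, hc⟩ : ∃ c : Fin (n + 1) → ℝ, ∑ i, c i • b i = u - v := by
    have : u - v ∈ Submodule.span ℝ (Set.range b) := by rw [hspan]; trivial
    exact (Submodule.mem_span_range_iff_exists_fun ℝ).1 this
  have hz : ∀ i, B (u - v) (b i) = 0 := by
    intro i
    refine Fin.cases ?_ (fun k => ?_) i <;> simp [b, h, h']
  have hc0 : ∀ i, c i = 0 := by
    intro i
    have := hz i
    rw [← hc] at this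
    simpa [hb] using this
  rw [← sub_eq_zero, ← hc]
  simp [hc0]

namespace IsAdapted

variable {n : ℕ} {x : E × ℝ} {e : Fin n → E} {lam : Fin n → ℝ}
  (S : IsFlowChart U f G A K ν w) (hx : x ∈ U) (R : IsAdapted f G A ν x e lam)
include S hx R

/-- The expression is symmetric in `m, k`, because mixed derivatives commute, and antisymmetric in
`k, l`, because the first derivatives of the metric vanish. Such a three-index array is zero: the
tangential Christoffel symbols vanish at the point. -/
theorem ip_covD_along (m k l : Fin n) :
    G x (covD A (e m, 0) (along f (e k, 0)) x) (along f (e l, 0) x) = 0 := by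
  have key : ∀ m k l, G x (covD A (e m, 0) (along f (e k, 0)) x) (along f (e l, 0) x)
      + G x (covD A (e m, 0) (along f (e l, 0)) x) (along f (e k, 0) x) = 0 := by
    intro m k l
    have h := S.fderiv_ip (S.smooth_along (e k, 0)) (S.smooth_along (e l, 0)) hx (e m, 0)
    rw [R.normalCoord, S.symm x hx (along f (e k, 0) x)] at h
    exact h.symm
  have h1 := key m k l
  have h2 := key l m k
  have h3 := key k l m
  have c := fun a b => S.covD_along_comm hx (e a, 0) (e b, 0)
  rw [c l m, c l k] at h2
  rw [c k m] at h3
  linarith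

theorem covD_normal (k : Fin n) : covD A (e k, 0) ν x = lam k • along f (e k, 0) x := by
  refine eq_of_ip_eq (G x) R.finrank_eq R.orthonormal (S.unit x hx)
    (fun k => by rw [S.symm x hx, S.normal x hx]) (fun k => S.normal x hx _) (fun l => ?_) ?_
  · rw [R.diagonal]; simp [R.orthonormal]
  · rw [S.ip_covD_normal_normal hx]; simp [S.symm x hx _ (ν x), S.normal x hx]

theorem covD_along (k l : Fin n) : covD A (e k, 0) (along f (e l, 0)) x =
    (if k = l then - lam k else 0) • ν x := by
  refine eq_of_ip_eq (G x) R.finrank_eq R.orthonormal (S.unit x hx)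
    (fun k => by rw [S.symm x hx, S.normal x hx]) (fun k => S.normal x hx _) (fun m => ?_) ?_
  · rw [R.ip_covD_along S hx, map_smul, smul_apply, S.normal x hx, smul_zero]
  · have := S.ip_covD_normal hx (e k, 0) (e l)
    rw [R.diagonal] at this
    rw [S.symm x hx]
    simp only [map_smul, smul_apply, S.unit x hx, smul_eq_mul, mul_one]
    split_ifs at this ⊢ <;> linarith

/-- The derivatives of the second fundamental form are totally symmetric at an adapted point. -/
theorem codazzi (m k l : Fin n) :
    fderiv ℝ (fun y => G y (covD A (e k, 0) ν y) (along f (e l, 0) y)) x (e m, 0) =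
    fderiv ℝ (fun y => G y (covD A (e m, 0) ν y) (along f (e l, 0) y)) x (e k, 0) := by
  rw [S.fderiv_ip (S.smooth_covD S.smooth_normal _) (S.smooth_along _) hx,
    S.fderiv_ip (S.smooth_covD S.smooth_normal _) (S.smooth_along _) hx,
    S.covD_normal_comm hx, R.covD_along S hx, R.covD_along S hx, map_smul, map_smul,
    S.ip_covD_normal_normal hx, S.ip_covD_normal_normal hx]
  simp

/-- Simons' identity for a single pair of directions, before summing over `k`. The coordinates are
normal to first order only, so second derivatives of the metric survive; they enter exactly as the
corrections in the second derivative of `tr (g⁻¹ h)`, and summing over `k` gives `∇_i∇_i H` on the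
right. -/
theorem simons_aux (i k : Fin n) :
    fderiv ℝ (fun y => fderiv ℝ (fun z => G z (covD A (e i, 0) ν z) (along f (e i, 0) z)) y
        (e k, 0)) x (e k, 0)
      - lam i * fderiv ℝ (fun y => fderiv ℝ (fun z =>
        G z (along f (e i, 0) z) (along f (e i, 0) z)) y (e k, 0)) x (e k, 0)
    = fderiv ℝ (fun y => fderiv ℝ (fun z => G z (covD A (e k, 0) ν z) (along f (e k, 0) z)) y
        (e i, 0)) x (e i, 0)
      - lam k * fderiv ℝ (fun y => fderiv ℝ (fun z =>
        G z (along f (e k, 0) z) (along f (e k, 0) z)) y (e i, 0)) x (e i, 0)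
      - lam i * lam k ^ 2 + lam i ^ 2 * lam k + K * (lam i - lam k) := by
  have sν := S.smooth_normal
  have sF := fun k => S.smooth_along (e k, 0)
  have sDν := fun k => S.smooth_covD sν (e k, 0)
  have sDF := fun k l => S.smooth_covD (sF l) (e k, 0)
  have hDDν := fun k l => S.ip_covD_covD_normal_normal hx (e k, 0) (e l, 0)
  -- Moving the derivative `e i` to the outside costs one curvature term, both for the normal and,
  -- in `eq2`, for the coordinate fields.
  have eq1 : ∀ i k, covD A (e k, 0) (covD A (e k, 0) (covD A (e i, 0) ν)) x =
      covD A (e i, 0) (covD A (e k, 0) (covD A (e k, 0) ν)) x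
        + K • (G x (along f (e i, 0) x) (covD A (e k, 0) ν x) • along f (e k, 0) x
          - G x (along f (e k, 0) x) (covD A (e k, 0) ν x) • along f (e i, 0) x) := by
    intro i k
    rw [S.covD_congr (fun y hy => S.covD_normal_comm hy (e k) (e i)) hx, S.covD_comm (sDν k) hx]
  have eq2 : ∀ i k, covD A (e k, 0) (covD A (e k, 0) (along f (e i, 0))) x =
      covD A (e i, 0) (covD A (e k, 0) (along f (e k, 0))) x
        + K • (G x (along f (e i, 0) x) (along f (e k, 0) x) • along f (e k, 0) x
          - G x (along f (e k, 0) x) (along f (e k, 0) x) • along f (e i, 0) x) := by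
    intro i k
    rw [S.covD_congr (fun y hy => S.covD_along_comm hy (e k, 0) (e i, 0)) hx,
      S.covD_comm (sF k) hx]
  have eq3 := S.covD_congr (A := A) (fun y hy => S.covD_normal_comm hy (e k) (e i)) hx (e i, 0)
  have eq4 : covD A (e i, 0) (covD A (e i, 0) (along f (e k, 0))) x =
      covD A (e i, 0) (covD A (e k, 0) (along f (e i, 0))) x :=
    S.covD_congr (fun y hy => S.covD_along_comm hy (e i, 0) (e k, 0)) hx _
  -- the third derivatives of the normal are symmetric up to lower order terms
  have eq5 : ∀ y ∈ U, G y (covD A (e k, 0) (covD A (e k, 0) ν) y) (along f (e i, 0) y)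
      + G y (covD A (e k, 0) ν y) (covD A (e k, 0) (along f (e i, 0)) y) =
      G y (covD A (e k, 0) (covD A (e i, 0) ν) y) (along f (e k, 0) y)
      + G y (covD A (e i, 0) ν y) (covD A (e k, 0) (along f (e k, 0)) y) := by
    intro y hy
    rw [← S.fderiv_ip (sDν k) (sF i) hy, ← S.fderiv_ip (sDν i) (sF k) hy]
    congr 1
    exact fderiv_eq_of_eqOn S.isOpen (fun z hz => S.ip_covD_normal_symm hz _ _) hy
  have eq6 := congrArg (fun L => L (e i, 0)) (fderiv_eq_of_eqOn S.isOpen eq5 hx)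
  have d1 := differentiableAt_of_contDiffOn S.isOpen
    (S.smooth_ip (S.smooth_covD (sDν k) (e k, 0)) (sF i)) hx
  have d2 := differentiableAt_of_contDiffOn S.isOpen (S.smooth_ip (sDν k) (sDF k i)) hx
  have d3 := differentiableAt_of_contDiffOn S.isOpen
    (S.smooth_ip (S.smooth_covD (sDν i) (e k, 0)) (sF k)) hx
  have d4 := differentiableAt_of_contDiffOn S.isOpen (S.smooth_ip (sDν i) (sDF k k)) hx
  simp only [fderiv_fun_add d1 d2, fderiv_fun_add d3 d4, add_apply,
    S.fderiv_ip (S.smooth_covD (sDν k) (e k, 0)) (sF i) hx,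
    S.fderiv_ip (sDν k) (sDF k i) hx, S.fderiv_ip (S.smooth_covD (sDν i) (e k, 0)) (sF k) hx,
    S.fderiv_ip (sDν i) (sDF k k) hx] at eq6
  rw [S.fderiv_fderiv_ip (sDν i) (sF i) hx, S.fderiv_fderiv_ip (sF i) (sF i) hx,
    S.fderiv_fderiv_ip (sDν k) (sF k) hx, S.fderiv_fderiv_ip (sF k) (sF k) hx]
  simp only [eq1 i k, eq2 i k, eq3, eq4, map_add, map_sub, map_smul, add_apply, sub_apply,
    smul_apply, smul_eq_mul, R.covD_normal S hx, R.covD_along S hx, R.orthonormal, hDDν,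
    S.unit x hx, S.symm x hx (along f _ x) (covD A _ _ x)] at eq6 ⊢
  by_cases hik : i = k
  · subst hik
    simp only [if_true] at eq6 ⊢
    ring
  · have hki : ¬ k = i := fun h => hik h.symm
    simp only [if_neg hik, if_neg hki, if_true] at eq6 ⊢
    linear_combination eq6

/-- The normal component of `∇_k ∂_t ∂_k F` gives `-∂_k∂_k w`; exchanging `∂_t` and `∂_k` on `ν`
costs the ambient curvature `-Kw`, and the tangential part of `∂_t ∂_k F` gives `wλ_k²`. -/
theorem fderiv_time_diag (k : Fin n) :
    fderiv ℝ (fun y => G y (covD A (e k, 0) ν y) (along f (e k, 0) y)) x (0, 1) =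
      - fderiv ℝ (fun y => fderiv ℝ w y (e k, 0)) x (e k, 0) + w x * lam k ^ 2 - K * w x := by
  have sν := S.smooth_normal
  have e1 : ∀ y ∈ U, G y (covD A (0, 1) ν y) (along f (e k, 0) y) = - fderiv ℝ w y (e k, 0) := by
    intro y hy
    rw [S.ip_covD_normal hy, S.covD_time_along hy]
    simp [S.unit y hy, S.symm y hy (ν y) (covD A _ ν y), S.ip_covD_normal_normal hy]
  have e2 := congrArg (fun L => L (e k, 0)) (fderiv_eq_of_eqOn S.isOpen e1 hx)
  simp only [fderiv_fun_neg, S.fderiv_ip (S.smooth_covD sν _) (S.smooth_along _) hx,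
    R.covD_along S hx, map_smul, S.ip_covD_normal_normal hx, neg_apply] at e2
  rw [S.fderiv_ip (S.smooth_covD sν _) (S.smooth_along _) hx, S.covD_time_along hx,
    S.covD_comm sν hx, S.velocity x hx]
  simp only [map_add, map_sub, map_smul, add_apply, sub_apply,
    smul_apply, smul_eq_mul, R.covD_normal S hx, R.orthonormal, S.unit x hx, S.normal x hx,
    S.symm x hx (along f _ x) (ν x), if_true] at e2 ⊢
  linear_combination e2

end IsAdapted

end FlowChart

/-- The conclusion times `H` equals minus the time inequality, plus `w²` times the space inequality
for one value of `c`, plus three nonnegative remainders: two that contain squares and `2φw(Q - λH)`.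
Here `Q` stands for `|A|²`, `N` for `|∇H|²`, `D` for `⟨∇φ, ∇H⟩` and `m` for the dimension. -/
theorem supersolution_algebra {w H lam φ φt Hii Hi φi Q K ΔH Δφ N D m : ℝ} (hw : 0 < w)
    (hH : H = w⁻¹) (hφ : φ * H = lam) (h0 : 0 ≤ lam) (hQ : lam * H ≤ Q) (hm : 0 ≤ m)
    (hspace : ∀ c : ℝ, 0 ≤ Hii - lam * Q + lam ^ 2 * H + K * (m * lam - H) - H * Δφ - 2 * D
      - φ * ΔH + 4 * c * (Hi - H * φi - φ * Hi) + 2 * c ^ 2 * (H - m * lam))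
    (htime : w ^ 2 * Hii - 2 * w ^ 3 * Hi ^ 2 + w * lam ^ 2 - K * w - φt * H
      - φ * (w ^ 2 * ΔH - 2 * w ^ 3 * N - w * Q - m * K * w) - 2 * w * lam ^ 2 ≤ 0) :
    0 ≤ φt - (H ^ 2)⁻¹ * Δφ + (H ^ 3)⁻¹ * (-2 * D + 4 * Hi * φi)
      + (4 * Hi ^ 2 - 2 * N) / H ^ 4 * φ := by
  have hHp : 0 < H := by rw [hH]; positivity
  have hφ0 : 0 ≤ φ := by
    by_contra! h
    nlinarith [mul_neg_of_neg_of_pos h hHp]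
  -- `b` is the derivative of `φH` in the direction `e_i`. The choice of `c` minimises `4c(Hi - b) +
  -- 2c²H`, with minimum `-2w(Hi - b)²`; against `2w³Hi²` from the time inequality this leaves `4w³
  -- Hi b - 2w³b²`.
  obtain ⟨b, hb⟩ : ∃ b, b = H * φi + φ * Hi := ⟨_, rfl⟩
  obtain ⟨c, hc⟩ : ∃ c, c = - (w * (Hi - H * φi - φ * Hi)) := ⟨_, rfl⟩
  have h1 := mul_nonneg (sq_nonneg w) (hspace c)
  have h2 : 0 ≤ w ^ 2 * (2 * c ^ 2 * (m * lam)) := by positivity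
  have h3 : 0 ≤ 2 * w ^ 3 * b ^ 2 := by positivity
  have h4 : 0 ≤ 2 * φ * w * (Q - lam * H) := mul_nonneg (by positivity) (by linarith)
  have key : H * (φt - (H ^ 2)⁻¹ * Δφ + (H ^ 3)⁻¹ * (-2 * D + 4 * Hi * φi)
      + (4 * Hi ^ 2 - 2 * N) / H ^ 4 * φ) =
      - (w ^ 2 * Hii - 2 * w ^ 3 * Hi ^ 2 + w * lam ^ 2 - K * w - φt * H
      - φ * (w ^ 2 * ΔH - 2 * w ^ 3 * N - w * Q - m * K * w) - 2 * w * lam ^ 2)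
      + w ^ 2 * (Hii - lam * Q + lam ^ 2 * H + K * (m * lam - H) - H * Δφ - 2 * D
      - φ * ΔH + 4 * c * (Hi - H * φi - φ * Hi) + 2 * c ^ 2 * (H - m * lam))
      + w ^ 2 * (2 * c ^ 2 * (m * lam)) + 2 * w ^ 3 * b ^ 2
      + 2 * φ * w * (Q - lam * H) := by
    rw [hc, hb, ← hφ, hH]
    field_simp
    ring
  have : 0 ≤ H * (φt - (H ^ 2)⁻¹ * Δφ + (H ^ 3)⁻¹ * (-2 * D + 4 * Hi * φi)
      + (4 * Hi ^ 2 - 2 * N) / H ^ 4 * φ) := by rw [key]; linarith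
  exact (mul_nonneg_iff_of_pos_left hHp).1 this

/-! ### The touching inequality at an adapted point. -/

section FlowChart

variable {E W : Type*} [NormedAddCommGroup E] [NormedSpace ℝ E]
  [NormedAddCommGroup W] [NormedSpace ℝ W]
  {U : Set (E × ℝ)} {f : E × ℝ → W} {G : E × ℝ → W →L[ℝ] W →L[ℝ] ℝ}
    {A : E × ℝ → (E × ℝ) →L[ℝ] W →L[ℝ] W} {K : ℝ} {ν : E × ℝ → W} {w : E × ℝ → ℝ}
    {n : ℕ} {x : E × ℝ} {e : Fin n → E} {lam : Fin n → ℝ}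

/-- The Gram matrix of the frame `e`. -/
def gram (f : E × ℝ → W) (G : E × ℝ → W →L[ℝ] W →L[ℝ] ℝ) (e : Fin n → E) (y : E × ℝ) :
    Matrix (Fin n) (Fin n) ℝ :=
  Matrix.of fun k l => G y (along f (e k, 0) y) (along f (e l, 0) y)

/-- The matrix of the second fundamental form in the frame `e`. -/
def sff (f : E × ℝ → W) (G : E × ℝ → W →L[ℝ] W →L[ℝ] ℝ)
    (A : E × ℝ → (E × ℝ) →L[ℝ] W →L[ℝ] W) (ν : E × ℝ → W) (e : Fin n → E) (y : E × ℝ) :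
    Matrix (Fin n) (Fin n) ℝ :=
  Matrix.of fun k l => G y (covD A (e k, 0) ν y) (along f (e l, 0) y)

/-- The difference quotients from the left are nonpositive. Using only `r ≤ 0` is what allows test
functions that touch only up to the current time. -/
theorem HasJet.mono_left {a : ℝ → ℝ} {a₁ a₂ : ℝ} (h : HasJet a 0 a₁ a₂)
    (hn : ∀ᶠ r in 𝓝 (0 : ℝ), r ≤ 0 → 0 ≤ a r) : a₁ ≤ 0 := by
  obtain ⟨a', h1, -, h3, rfl⟩ := h
  have hd : HasDerivWithinAt a (a' 0) (Set.Iio 0) 0 := h1.self_of_nhds.hasDerivWithinAt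
  rw [hasDerivWithinAt_iff_tendsto_slope' (by simp)] at hd
  refine le_of_tendsto hd ?_
  filter_upwards [nhdsWithin_le_nhds hn, self_mem_nhdsWithin] with r hr hr0
  have hr0' : r < 0 := hr0
  rw [slope_def_field, h3]
  exact div_nonpos_of_nonneg_of_nonpos (by linarith [hr hr0'.le]) (by linarith)

namespace IsAdapted

/-- The differential inequality at an adapted point. -/
theorem supersolution (S : IsFlowChart U f G A K ν w) (hx : x ∈ U)
    (R : IsAdapted f G A ν x e lam) {i : Fin n} (hlow : ∀ k, lam i ≤ lam k) (h0 : 0 ≤ lam i)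
    (htr : ∀ᶠ y in 𝓝 x, (w y)⁻¹ = ((gram f G e y)⁻¹ * sff f G A ν e y).trace)
    {φ : E × ℝ → ℝ} (hφ : ContDiffAt ℝ 2 φ x) (hφx : φ x * (w x)⁻¹ = lam i)
    (hle : ∀ᶠ y in 𝓝 x, y.2 ≤ x.2 → ∀ ζ : E,
      φ y * (w y)⁻¹ * G y (along f (ζ, 0) y) (along f (ζ, 0) y) ≤
        G y (covD A (ζ, 0) ν y) (along f (ζ, 0) y)) :
    0 ≤ fderiv ℝ φ x (0, 1)
      - (((w x)⁻¹) ^ 2)⁻¹ * ∑ k, fderiv ℝ (fun y => fderiv ℝ φ y (e k, 0)) x (e k, 0)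
      + (((w x)⁻¹) ^ 3)⁻¹ * (-2 * ∑ k, fderiv ℝ φ x (e k, 0) * fderiv ℝ (fun y => (w y)⁻¹) x
          (e k, 0)
        + 4 * fderiv ℝ (fun y => (w y)⁻¹) x (e i, 0) * fderiv ℝ φ x (e i, 0))
      + (4 * fderiv ℝ (fun y => (w y)⁻¹) x (e i, 0) ^ 2
        - 2 * ∑ k, fderiv ℝ (fun y => (w y)⁻¹) x (e k, 0) ^ 2) / ((w x)⁻¹) ^ 4 * φ x := by
  have hU := S.isOpen
  have hwx := S.speed_pos x hx
  obtain ⟨H, hHdef⟩ : ∃ H : E × ℝ → ℝ, H = fun y => (w y)⁻¹ := ⟨_, rfl⟩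
  have hHs : ContDiffOn ℝ ∞ H U := by
    rw [hHdef]; exact S.smooth_speed.inv fun y hy => (S.speed_pos y hy).ne'
  obtain ⟨h, hh⟩ : ∃ h : Fin n → Fin n → E × ℝ → ℝ, h = fun k l y =>
    G y (covD A (e k, 0) ν y) (along f (e l, 0) y) := ⟨_, rfl⟩
  obtain ⟨g, hg⟩ : ∃ g : Fin n → Fin n → E × ℝ → ℝ, g = fun k l y =>
    G y (along f (e k, 0) y) (along f (e l, 0) y) := ⟨_, rfl⟩
  have hhs : ∀ k l, ContDiffOn ℝ ∞ (h k l) U := fun k l => by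
    rw [hh]; exact S.smooth_ip (S.smooth_covD S.smooth_normal _) (S.smooth_along _)
  have hgs : ∀ k l, ContDiffOn ℝ ∞ (g k l) U := fun k l => by
    rw [hg]; exact S.smooth_ip (S.smooth_along _) (S.smooth_along _)
  have C2 : ∀ {a : E × ℝ → ℝ}, ContDiffOn ℝ ∞ a U → ContDiffAt ℝ 2 a x := fun ha =>
    (ha.contDiffAt (hU.mem_nhds hx)).of_le ENat.LEInfty.out
  have line : ∀ ξ : E × ℝ, ContDiffAt ℝ 2 (fun r : ℝ => x + r • ξ) 0 := fun ξ =>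
    contDiffAt_const.add (contDiffAt_id.smul contDiffAt_const)
  have lineU : ∀ (ξ : E × ℝ) {p : E × ℝ → Prop}, (∀ᶠ y in 𝓝 x, p y) →
      ∀ᶠ r : ℝ in 𝓝 0, p (x + r • ξ) := fun ξ p hp =>
    (line ξ).continuousAt.eventually (by simpa using hp)
  have hgx : ∀ k l, g k l x = (1 : Matrix (Fin n) (Fin n) ℝ) k l := fun k l => by
    rw [hg, Matrix.one_apply]; exact R.orthonormal k l
  have hhx : ∀ k l, h k l x = Matrix.diagonal lam k l := fun k l => by
    rw [hh, Matrix.diagonal_apply]; exact R.diagonal k l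
  -- the derivatives of the trace
  have trace₀ := fun ξ : E × ℝ => HasJet.trace_inv_mul (n := n)
    (g := fun r => gram f G e (x + r • ξ)) (h := fun r => sff f G A ν e (x + r • ξ))
    (H := fun r => H (x + r • ξ)) (h₀ := Matrix.diagonal lam)
    (h₁ := Matrix.of fun k l => fderiv ℝ (h k l) x ξ)
    (h₂ := Matrix.of fun k l => fderiv ℝ (fun y => fderiv ℝ (h k l) y ξ) x ξ)
    (g₁ := Matrix.of fun k l => fderiv ℝ (g k l) x ξ)
    (g₂ := Matrix.of fun k l => fderiv ℝ (fun y => fderiv ℝ (g k l) y ξ) x ξ)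
    (fun k l => by
      have := hasJet_line (C2 (hgs k l)) ξ
      rw [hgx] at this; rw [hg] at this ⊢; exact this)
    (fun k l => by
      have : ContDiffAt ℝ 2 (fun r : ℝ => g k l (x + r • ξ)) 0 :=
        ContDiffAt.comp (0 : ℝ) (by simpa using C2 (hgs k l)) (line ξ)
      rw [hg] at this; exact this)
    (fun k l => by
      have := hasJet_line (C2 (hhs k l)) ξ
      rw [hhx] at this; rw [hh] at this ⊢; exact this)
    (hasJet_line (C2 hHs) ξ)
    (by
      filter_upwards [lineU ξ htr] with r hr
      rw [hHdef]; exact hr)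
  have diagsum : ∀ M : Matrix (Fin n) (Fin n) ℝ,
      ∑ k, ∑ l, M k l * Matrix.diagonal lam l k = ∑ k, M k k * lam k := fun M => by
    simp [Matrix.diagonal_apply]
  have trace : ∀ ξ : E × ℝ, fderiv ℝ H x ξ =
        ∑ k, fderiv ℝ (h k k) x ξ - ∑ k, fderiv ℝ (g k k) x ξ * lam k ∧
      ((Matrix.of fun k l => fderiv ℝ (g k l) x ξ) = 0 →
        fderiv ℝ (fun y => fderiv ℝ H y ξ) x ξ =
          ∑ k, fderiv ℝ (fun y => fderiv ℝ (h k k) y ξ) x ξ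
          - ∑ k, fderiv ℝ (fun y => fderiv ℝ (g k k) y ξ) x ξ * lam k) := fun ξ => by
    have h1 := trace₀ ξ
    rw [diagsum, diagsum] at h1
    exact h1
  have hg1 : ∀ m, (Matrix.of fun k l => fderiv ℝ (g k l) x (e m, 0)) = 0 := fun m => by
    ext k l; rw [hg]; exact R.normalCoord k l m
  have hHx : H x = ∑ k, lam k := by
    have := htr.self_of_nhds
    have e1 : gram f G e x = 1 := by
      ext k l; rw [← hgx, hg]; rfl
    have e2 : sff f G A ν e x = Matrix.diagonal lam := by
      ext k l; rw [← hhx, hh]; rfl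
    rw [e1, e2] at this
    rw [hHdef]; simpa using this
  -- first and second derivatives of the speed
  have hw1 : ∀ k, HasJet (fun r : ℝ => w (x + r • (e k, (0 : ℝ)))) (w x) (fderiv ℝ w x (e k, 0))
      (fderiv ℝ (fun y => fderiv ℝ w y (e k, 0)) x (e k, 0)) := fun k =>
    hasJet_line (C2 S.smooth_speed) _
  have hH1 : ∀ k, HasJet (fun r : ℝ => H (x + r • (e k, (0 : ℝ)))) (H x) (fderiv ℝ H x (e k, 0))
      (fderiv ℝ (fun y => fderiv ℝ H y (e k, 0)) x (e k, 0)) := fun k => hasJet_line (C2 hHs) _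
  have hHw : H x = (w x)⁻¹ := by rw [hHdef]
  have hw2 : ∀ k, fderiv ℝ (fun y => fderiv ℝ w y (e k, 0)) x (e k, 0) =
      - (w x) ^ 2 * fderiv ℝ (fun y => fderiv ℝ H y (e k, 0)) x (e k, 0)
      + 2 * (w x) ^ 3 * fderiv ℝ H x (e k, 0) ^ 2 := by
    intro k
    have hone : HasJet (fun r : ℝ => H (x + r • (e k, (0 : ℝ))) * w (x + r • (e k, (0 : ℝ)))) 1 0 0
        := by
      -- The derivatives of `w` are read off from those of `H` through `H w = 1`.
      refine (hasJet_const 1).congr ?_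
      filter_upwards [lineU (e k, 0) (hU.mem_nhds hx)] with r hr
      rw [hHdef]; exact inv_mul_cancel₀ (S.speed_pos _ hr).ne'
    obtain ⟨-, q1, q2⟩ := ((hH1 k).mul (hw1 k)).unique hone
    rw [hHw] at q1 q2
    have q1' : fderiv ℝ w x (e k, 0) = - (w x) ^ 2 * fderiv ℝ H x (e k, 0) := by
      field_simp at q1; linarith
    rw [q1'] at q2
    field_simp at q2
    linear_combination q2
  -- evolution of the trace
  have hHt : fderiv ℝ H x (0, 1) = (w x) ^ 2 * (∑ k,
      fderiv ℝ (fun y => fderiv ℝ H y (e k, 0)) x (e k, 0))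
      - 2 * (w x) ^ 3 * (∑ k, fderiv ℝ H x (e k, 0) ^ 2) - w x * (∑ k, lam k ^ 2)
      - n * K * w x := by
    have hgt : ∀ k, fderiv ℝ (g k k) x (0, 1) = 2 * w x * lam k := fun k => by
      rw [hg, S.fderiv_time_metric hx, R.diagonal]; simp
    have hht : ∀ k, fderiv ℝ (h k k) x (0, 1) = (w x) ^ 2 *
        fderiv ℝ (fun y => fderiv ℝ H y (e k, 0)) x (e k, 0)
        - 2 * (w x) ^ 3 * fderiv ℝ H x (e k, 0) ^ 2 + w x * lam k ^ 2 - K * w x := fun k => by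
      rw [hh, R.fderiv_time_diag S hx, hw2]; ring
    have : ∑ k, 2 * w x * lam k * lam k = 2 * w x * ∑ k, lam k ^ 2 := by
      rw [Finset.mul_sum]; exact Finset.sum_congr rfl fun k _ => by ring
    rw [(trace (0, 1)).1]
    simp only [hgt, hht, Finset.sum_add_distrib, Finset.sum_sub_distrib, ← Finset.mul_sum,
      Finset.sum_const, Finset.card_univ, Fintype.card_fin, nsmul_eq_mul, this]
    ring
  rw [show (fun y => (w y)⁻¹) = H from hHdef.symm, ← hHw]
  rw [← hHw] at hφx
  simp only [show ∀ y, (w y)⁻¹ = H y from fun y => by rw [hHdef]] at hle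
  -- Termwise, `λ_k(λ_k - λ_i) ≥ 0`, because `λ_k ≥ λ_i ≥ 0`.
  have hQ : lam i * H x ≤ ∑ k, lam k ^ 2 := by
    rw [hHx, Finset.mul_sum]
    exact Finset.sum_le_sum fun k _ => by nlinarith [hlow k]
  refine supersolution_algebra (K := K) (m := n) hwx hHw hφx h0 hQ (Nat.cast_nonneg n)
    (Hii := fderiv ℝ (fun y => fderiv ℝ H y (e i, 0)) x (e i, 0))
    (ΔH := ∑ k, fderiv ℝ (fun y => fderiv ℝ H y (e k, 0)) x (e k, 0)) (fun c => ?_) ?_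
  · -- the spatial inequality
    have main : ∀ k, 0 ≤ fderiv ℝ (fun y => fderiv ℝ (h i i) y (e k, 0)) x (e k, 0)
        + 4 * c * fderiv ℝ (h k k) x (e i, 0) + 2 * c ^ 2 * lam k
        - ((fderiv ℝ (fun y => fderiv ℝ φ y (e k, 0)) x (e k, 0) * H x
          + 2 * fderiv ℝ φ x (e k, 0) * fderiv ℝ H x (e k, 0)
          + φ x * fderiv ℝ (fun y => fderiv ℝ H y (e k, 0)) x (e k, 0))
          + 2 * (fderiv ℝ φ x (e k, 0) * H x + φ x * fderiv ℝ H x (e k, 0))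
            * (if k = i then 2 * c else 0)
          + lam i * (fderiv ℝ (fun y => fderiv ℝ (g i i) y (e k, 0)) x (e k, 0) + 2 * c ^ 2)) := by
      intro k
      have J : ∀ {a : E × ℝ → ℝ}, ContDiffOn ℝ ∞ a U → HasJet (fun r : ℝ => a (x + r • (e k, 0)))
          (a x) (fderiv ℝ a x (e k, 0)) (fderiv ℝ (fun y => fderiv ℝ a y (e k, 0)) x (e k, 0)) :=
        fun ha => hasJet_line (C2 ha) _
      -- Jets of `h(ζ,ζ)` and `g(ζ,ζ)` for the varying vector `ζ = e_i + c r e_k` along `x + r e_k`.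
      -- The free slope `c` brings in the first derivatives of `h`, which a constant `ζ` would not
      -- see.
      have jc := hasJet_id.const_mul c
      have jh := ((J (hhs i i)).add ((jc.mul (J (hhs i k))).const_mul 2)).add
        ((jc.mul jc).mul (J (hhs k k)))
      have jg := ((J (hgs i i)).add ((jc.mul (J (hgs i k))).const_mul 2)).add
        ((jc.mul jc).mul (J (hgs k k)))
      have jz := jh.sub (((hasJet_line hφ (e k, 0)).mul (J hHs)).mul jg)
      -- After this exchange the first order terms sum over `k` to the derivative of `H` in the
      -- direction `e i`.
      have hcod : fderiv ℝ (h i k) x (e k, 0) = fderiv ℝ (h k k) x (e i, 0) := by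
        rw [hh]; exact R.codazzi S hx k i k
      have hgz : ∀ a b, fderiv ℝ (g a b) x (e k, 0) = 0 := fun a b => by
        rw [hg]; exact R.normalCoord a b k
      have jz' := (jz.of_eq (b₀ := 0) (by
        rw [hhx, hgx]; simp [hφx]) rfl rfl).nonneg_of_min ?_
      · refine jz'.trans_eq ?_
        rw [hcod, ← hφx]
        simp only [hgz, hhx, hgx, Matrix.one_apply, Matrix.diagonal_apply, if_true, eq_comm
            (a := i)]
        split_ifs <;> ring
      · filter_upwards [lineU (e k, 0) hle, lineU (e k, 0) (hU.mem_nhds hx)] with r hr hrU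
        have := hr (by simp) (e i + (c * r) • e k)
        have e1 : ((e i + (c * r) • e k, 0) : E × ℝ) = (e i, 0) + (c * r) • (e k, 0) := by simp
        have e2 : along f (e i + (c * r) • e k, 0) (x + r • (e k, 0)) =
            along f (e i, 0) (x + r • (e k, 0)) + (c * r) • along f (e k, 0) (x + r • (e k, 0)) := by
          rw [e1]; simp only [along, map_add, map_smul]
        have e3 : covD A (e i + (c * r) • e k, 0) ν (x + r • (e k, 0)) =
            covD A (e i, 0) ν (x + r • (e k, 0))
              + (c * r) • covD A (e k, 0) ν (x + r • (e k, 0)) := by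
          rw [e1]; simp only [covD, map_add, map_smul, add_apply, smul_apply, smul_add]; abel
        rw [e2, e3] at this
        simp only [map_add, map_smul, add_apply, smul_apply, smul_eq_mul] at this
        rw [S.ip_covD_normal_symm hrU (e k) (e i), S.symm _ hrU (along f (e k, 0) _)
          (along f (e i, 0) _)] at this
        rw [hh, hg]
        dsimp only
        linarith
    have hsum := Finset.sum_nonneg fun k (_ : k ∈ Finset.univ) => main k
    have simons : ∀ k, fderiv ℝ (fun y => fderiv ℝ (h i i) y (e k, 0)) x (e k, 0) =
        lam i * fderiv ℝ (fun y => fderiv ℝ (g i i) y (e k, 0)) x (e k, 0) +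
        (fderiv ℝ (fun y => fderiv ℝ (h k k) y (e i, 0)) x (e i, 0)
        - fderiv ℝ (fun y => fderiv ℝ (g k k) y (e i, 0)) x (e i, 0) * lam k
        - lam i * lam k ^ 2 + lam i ^ 2 * lam k + K * (lam i - lam k)) := by
      intro k
      have := R.simons_aux S hx i k
      rw [hh, hg]
      linear_combination this
    have hH2 := (trace (e i, 0)).2 (hg1 i)
    have hH1i := (trace (e i, 0)).1
    have hz : ∀ k, fderiv ℝ (g k k) x (e i, 0) = 0 := fun k => by
      rw [hg]; exact R.normalCoord k k i
    simp only [hz, zero_mul, Finset.sum_const_zero, sub_zero] at hH1i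
    simp only [simons, Finset.sum_add_distrib, Finset.sum_sub_distrib, ← Finset.mul_sum,
      ← Finset.sum_mul, mul_add, mul_sub, mul_ite, mul_zero, Finset.sum_ite_eq', Finset.mem_univ,
      if_true, Finset.sum_const, Finset.card_univ, Fintype.card_fin, nsmul_eq_mul, ← hHx] at hsum
    have hD : ∑ k, 2 * fderiv ℝ φ x (e k, 0) * fderiv ℝ H x (e k, 0) =
        2 * ∑ k, fderiv ℝ φ x (e k, 0) * fderiv ℝ H x (e k, 0) := by
      rw [Finset.mul_sum]; exact Finset.sum_congr rfl fun k _ => by ring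
    rw [hD] at hsum
    rw [hH2]
    rw [← hH1i] at hsum
    refine hsum.trans_eq ?_
    ring
  · -- the inequality in time
    have jt := (hasJet_line (C2 (hhs i i)) (0, 1)).sub
      (((hasJet_line hφ (0, 1)).mul (hasJet_line (C2 hHs) (0, 1))).mul
        (hasJet_line (C2 (hgs i i)) (0, 1)))
    have := (jt.of_eq (b₀ := 0) (by rw [hhx, hgx]; simp [hφx]) rfl rfl).mono_left ?_
    · rw [hgx, hHt, Matrix.one_apply, if_pos rfl] at this
      have hgt : fderiv ℝ (g i i) x (0, 1) = 2 * w x * lam i := by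
        rw [hg, S.fderiv_time_metric hx, R.diagonal]; simp
      have hht : fderiv ℝ (h i i) x (0, 1) = (w x) ^ 2 *
          fderiv ℝ (fun y => fderiv ℝ H y (e i, 0)) x (e i, 0)
          - 2 * (w x) ^ 3 * fderiv ℝ H x (e i, 0) ^ 2 + w x * lam i ^ 2 - K * w x := by
        rw [hh, R.fderiv_time_diag S hx, hw2]; ring
      rw [hgt, hht, hφx] at this
      linarith
    · filter_upwards [lineU (0, 1) hle] with r hr hr0
      have := hr (by simpa using hr0) (e i)
      rw [hh, hg]
      dsimp only
      linarith

end IsAdapted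

end FlowChart

/-! ### Metrics of constant sectional curvature in coordinates -/

/-- Algebraic curvature tensors are determined by their sectional curvatures. -/
theorem curvatureTensor_eq_zero {W : Type*} [AddCommGroup W] {S : W → W → W → W → ℝ}
    (add₁ : ∀ a a' b c d, S (a + a') b c d = S a b c d + S a' b c d)
    (add₂ : ∀ a b b' c d, S a (b + b') c d = S a b c d + S a b' c d)
    (anti₁₂ : ∀ a b c d, S a b c d = - S b a c d)
    (anti₃₄ : ∀ a b c d, S a b c d = - S a b d c)
    (bianchi : ∀ a b c d, S a b c d + S b c a d + S c a b d = 0)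
    (sec : ∀ a b, S a b b a = 0) (a b c d : W) : S a b c d = 0 := by
  -- Pair symmetry, as a linear combination of the Bianchi identities for the cyclic shifts of the
  -- arguments.
  have pair : ∀ a b c d, S a b c d = S c d a b := by
    intro a b c d
    have h1 := bianchi a b c d
    have h2 := bianchi b c d a
    have h3 := bianchi c d a b
    have h4 := bianchi d a b c
    have e1 := anti₃₄ a b c d
    have e2 := anti₃₄ b c a d
    have e3 := anti₃₄ c a b d
    have e5 := anti₃₄ c d b a
    have e6 := anti₃₄ d b c a
    have e7 := anti₃₄ d a c b
    have f1 := anti₁₂ a c d b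
    have f2 := anti₁₂ b d c a
    linarith [anti₃₄ b c d a, anti₃₄ d a b c, anti₃₄ a b d c, anti₃₄ c d a b, anti₁₂ c a d b,
      anti₁₂ d b c a, anti₃₄ a c d b, anti₃₄ b d a c, anti₁₂ b d a c, anti₃₄ b d c a]
  -- Polarisation of the sectional curvature in the outer arguments; `s2` then polarises in the
  -- inner ones.
  have s1 : ∀ a a' b, S a b b a' = 0 := by
    intro a a' b
    have h := sec (a + a') b
    have e : S (a + a') b b (a + a') = S a b b a + S a b b a' + S a' b b a + S a' b b a' := by
      rw [add₁, pair a b, pair a' b, anti₁₂ b (a + a'), anti₁₂ b (a + a'), add₁, add₁,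
        pair a b b a, pair a b b a', pair a' b b a, pair a' b b a', anti₁₂ b a, anti₁₂ b a',
        anti₁₂ b a, anti₁₂ b a']
      ring
    rw [e, sec, sec] at h
    have : S a' b b a = S a b b a' := by rw [pair a' b b a, anti₁₂, anti₃₄]; ring
    linarith
  have s2 : ∀ a b b' d, S a b b' d = - S a b' b d := by
    intro a b b' d
    have h := s1 a d (b + b')
    have e : S a (b + b') (b + b') d = S a b b d + S a b b' d + S a b' b d + S a b' b' d := by
      rw [add₂, pair a b, pair a b', add₁, add₁, pair b d, pair b' d, pair b d, pair b' d]; ring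
    rw [e, s1, s1] at h
    linarith
  -- By total antisymmetry the three terms of the Bianchi identity coincide, so `3 S = 0`.
  have h := bianchi a b c d
  have h1 : S b c a d = S a b c d := by rw [s2 b c a d, anti₁₂ b a c d]; ring
  have h2 : S c a b d = S a b c d := by rw [anti₁₂ c a b d, s2 a c b d]; ring
  linarith

/-! ### Levi-Civita connections, their curvature, and pullback along a map. -/

section Pullback

variable {P W : Type*} [NormedAddCommGroup P] [NormedSpace ℝ P]
  [NormedAddCommGroup W] [NormedSpace ℝ W]

/-- On the open set `V`, the metric `G` has the Levi-Civita connection `Γ`. -/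
structure IsLeviCivita (V : Set W) (G : W → W →L[ℝ] W →L[ℝ] ℝ) (Γ : W → W →L[ℝ] W →L[ℝ] W) :
    Prop where
  isOpen : IsOpen V
  smooth_metric : ContDiffOn ℝ ∞ G V
  smooth_conn : ContDiffOn ℝ ∞ Γ V
  symm : ∀ y ∈ V, ∀ u v, G y u v = G y v u
  compat : ∀ y ∈ V, ∀ ξ u v, fderiv ℝ G y ξ u v = G y (Γ y ξ u) v + G y u (Γ y ξ v)
  torsion : ∀ y ∈ V, ∀ u v, Γ y u v = Γ y v u

/-- The curvature operator of the connection `Γ`. -/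
def curvOp (Γ : W → W →L[ℝ] W →L[ℝ] W) (y ξ η u : W) : W :=
  fderiv ℝ Γ y ξ η u - fderiv ℝ Γ y η ξ u + Γ y ξ (Γ y η u) - Γ y η (Γ y ξ u)

/-- On the open set `V`, the metric `G` has the Levi-Civita connection `Γ` and constant sectional
curvature `K`. -/
structure IsSpaceForm (V : Set W) (G : W → W →L[ℝ] W →L[ℝ] ℝ) (Γ : W → W →L[ℝ] W →L[ℝ] W)
    (K : ℝ) : Prop extends IsLeviCivita V G Γ where
  curv : ∀ y ∈ V, ∀ ξ η u, curvOp Γ y ξ η u = K • (G y η u • ξ - G y ξ u • η)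

theorem fderiv_bilin_apply {F : Type*} [NormedAddCommGroup F] [NormedSpace ℝ F]
    {B : P → W →L[ℝ] W →L[ℝ] F} {y : P} (hB : DifferentiableAt ℝ B y) (ξ : P) (u v : W) :
    fderiv ℝ (fun y => B y u v) y ξ = fderiv ℝ B y ξ u v := by
  rw [fderiv_clm_apply (hB.clm_apply (differentiableAt_const _)) (differentiableAt_const _),
    fderiv_clm_apply hB (differentiableAt_const _)]
  simp

namespace IsLeviCivita

variable {V : Set W} {G : W → W →L[ℝ] W →L[ℝ] ℝ} {Γ : W → W →L[ℝ] W →L[ℝ] W}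
  (S : IsLeviCivita V G Γ) {y : W} (hy : y ∈ V)
include S hy

/-- Mixed second derivatives of the function `G(u, v)`, for constant `u` and `v`, commute. Expanding
them by metric compatibility, the terms `G(Γu, Γv)` cancel and the two curvature terms remain. -/
theorem ip_curvOp_antisymm (ξ η u v : W) :
    G y (curvOp Γ y ξ η u) v = - G y (curvOp Γ y ξ η v) u := by
  have hG := differentiableAt_of_contDiffOn S.isOpen S.smooth_metric hy
  have hΓ := differentiableAt_of_contDiffOn S.isOpen S.smooth_conn hy
  have sΓ : ∀ η u, ContDiffOn ℝ ∞ (fun z => Γ z η u) V := fun η u =>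
    (S.smooth_conn.clm_apply contDiffOn_const).clm_apply contDiffOn_const
  have first : ∀ ξ u v, ∀ z ∈ V, fderiv ℝ (fun z => G z u v) z ξ =
      G z (Γ z ξ u) v + G z (Γ z ξ v) u := fun ξ u v z hz => by
    rw [fderiv_bilin_apply (differentiableAt_of_contDiffOn S.isOpen S.smooth_metric hz),
      S.compat z hz, S.symm z hz u]
  have second : ∀ ξ η u v, fderiv ℝ (fun z => G z (Γ z η u) v) y ξ =
      G y (Γ y ξ (Γ y η u)) v + G y (Γ y η u) (Γ y ξ v) + G y (fderiv ℝ Γ y ξ η u) v := by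
    intro ξ η u v
    have ha := differentiableAt_of_contDiffOn S.isOpen (sΓ η u) hy
    rw [fderiv_clm_apply (hG.clm_apply ha) (differentiableAt_const _), fderiv_clm_apply hG ha]
    simp [S.compat y hy, fderiv_bilin_apply hΓ]
    ring
  have sG : ContDiffOn ℝ ∞ (fun z => G z u v) V :=
    (S.smooth_metric.clm_apply contDiffOn_const).clm_apply contDiffOn_const
  have sGΓ : ∀ η u v, DifferentiableAt ℝ (fun z => G z (Γ z η u) v) y := fun η u v =>
    differentiableAt_of_contDiffOn S.isOpen
      ((S.smooth_metric.clm_apply (sΓ η u)).clm_apply contDiffOn_const) hy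
  have key := fderiv_fderiv_comm S.isOpen sG hy ξ η
  rw [fderiv_eq_of_eqOn S.isOpen (first η u v) hy, fderiv_eq_of_eqOn S.isOpen (first ξ u v) hy,
    fderiv_fun_add (sGΓ _ _ _) (sGΓ _ _ _), fderiv_fun_add (sGΓ _ _ _) (sGΓ _ _ _), add_apply,
    add_apply, second, second, second, second, S.symm y hy (Γ y η u) (Γ y ξ v),
    S.symm y hy (Γ y η v) (Γ y ξ u)] at key
  simp only [curvOp, map_add, map_sub, add_apply, sub_apply]
  linarith

/-- Symmetry of `Γ` in its two arguments passes to its derivative, and the cyclic sum cancels in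
pairs. -/
theorem curvOp_bianchi (ξ η u : W) :
    curvOp Γ y ξ η u + curvOp Γ y η u ξ + curvOp Γ y u ξ η = 0 := by
  have hΓ := differentiableAt_of_contDiffOn S.isOpen S.smooth_conn hy
  have hs : ∀ ξ η u, fderiv ℝ Γ y ξ η u = fderiv ℝ Γ y ξ u η := fun ξ η u => by
    rw [← fderiv_bilin_apply hΓ, ← fderiv_bilin_apply hΓ,
      fderiv_eq_of_eqOn S.isOpen (fun z hz => S.torsion z hz η u) hy]
  simp only [curvOp]
  rw [hs η u ξ, hs ξ u η, hs u η ξ, S.torsion y hy u ξ, S.torsion y hy u η, S.torsion y hy ξ η]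
  abel

/-- A connection with constant sectional curvature has the curvature operator of a space form. -/
theorem curvOp_eq {K : ℝ} (hsec : ∀ v w, G y (curvOp Γ y v w w) v =
      K * (G y v v * G y w w - G y v w ^ 2))
    (hnd : ∀ u, (∀ v, G y u v = 0) → u = 0) (ξ η u : W) :
    curvOp Γ y ξ η u = K • (G y η u • ξ - G y ξ u • η) := by
  have add₁ : ∀ a a' b c, curvOp Γ y (a + a') b c = curvOp Γ y a b c + curvOp Γ y a' b c :=
    fun a a' b c => by simp only [curvOp, map_add, add_apply]; abel
  have anti : ∀ a b c, curvOp Γ y a b c = - curvOp Γ y b a c := fun a b c => by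
    simp only [curvOp]; abel
  rw [← sub_eq_zero]
  refine hnd _ fun v => ?_
  -- Applied to the difference between the curvature and the model tensor of curvature `K`: it has
  -- the same symmetries, and its sectional curvatures vanish.
  refine curvatureTensor_eq_zero
    (S := fun a b c d => G y (curvOp Γ y a b c - K • (G y b c • a - G y a c • b)) d)
    ?_ ?_ ?_ ?_ ?_ ?_ ξ η u v
  · intro a a' b c d
    simp only [add₁, map_add, map_sub, map_smul, add_apply, sub_apply, smul_apply, smul_eq_mul]
    ring
  · intro a b b' c d
    rw [anti, anti a b, anti a b']
    simp only [add₁, map_add, map_sub, map_neg, map_smul, neg_apply, add_apply, sub_apply,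
      smul_apply, smul_eq_mul]
    ring
  · intro a b c d
    rw [anti]
    simp only [map_sub, map_neg, map_smul, neg_apply, sub_apply, smul_apply, smul_eq_mul]
    ring
  · intro a b c d
    simp only [map_sub, map_smul, sub_apply, smul_apply, smul_eq_mul]
    rw [S.ip_curvOp_antisymm hy a b c d, S.symm y hy b c, S.symm y hy a c, S.symm y hy b d,
      S.symm y hy a d]
    ring
  · intro a b c d
    have h := congrArg (fun z => G y z d) (S.curvOp_bianchi hy a b c)
    simp only [map_add, add_apply, map_zero, zero_apply] at h
    simp only [map_sub, map_smul, sub_apply, smul_apply, smul_eq_mul]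
    rw [S.symm y hy c a, S.symm y hy b a, S.symm y hy c b]
    linarith
  · intro a b
    simp only [map_sub, map_smul, sub_apply, smul_apply, smul_eq_mul]
    rw [hsec, S.symm y hy b a]
    ring

end IsLeviCivita

/-- Structure equations are natural under pullback. In the curvature equation the second derivative
of `f` appears once for each order of the two directions and cancels by symmetry. -/
theorem IsSpaceForm.pullback {V : Set W} {G : W → W →L[ℝ] W →L[ℝ] ℝ}
    {Γ : W → W →L[ℝ] W →L[ℝ] W} {K : ℝ} (S : IsSpaceForm V G Γ K) {U : Set P} {f : P → W}
    (hU : IsOpen U) (hf : ContDiffOn ℝ ∞ f U) (hfV : Set.MapsTo f U V) :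
    IsSpaceFormMap U f (fun x => G (f x)) (fun x => (Γ (f x)).comp (fderiv ℝ f x)) K where
  isOpen := hU
  smooth := hf
  smooth_metric := S.smooth_metric.comp hf hfV
  smooth_conn := (S.smooth_conn.comp hf hfV).clm_comp (hf.fderiv_of_isOpen hU (by simp))
  symm x hx := S.symm _ (hfV hx)
  compat x hx ξ u v := by
    have h1 := differentiableAt_of_contDiffOn S.isOpen S.smooth_metric (hfV hx)
    have h2 := differentiableAt_of_contDiffOn hU hf hx
    have : fderiv ℝ (fun x => G (f x)) x = (fderiv ℝ G (f x)).comp (fderiv ℝ f x) :=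
      fderiv_comp x h1 h2
    rw [this]
    exact S.compat _ (hfV hx) _ _ _
  torsion x hx ξ η := S.torsion _ (hfV hx) _ _
  curv x hx ξ η u := by
    have h1 := differentiableAt_of_contDiffOn S.isOpen S.smooth_conn (hfV hx)
    have h2 := differentiableAt_of_contDiffOn hU hf hx
    have hd : DifferentiableAt ℝ (fderiv ℝ f) x :=
      differentiableAt_of_contDiffOn hU (hf.fderiv_of_isOpen hU (by simp)) hx
    have h3 : fderiv ℝ (fun x => Γ (f x)) x = (fderiv ℝ Γ (f x)).comp (fderiv ℝ f x) :=
      fderiv_comp x h1 h2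
    have h4 : DifferentiableAt ℝ (fun x => Γ (f x)) x := h1.comp x h2
    have hs := ((hf.contDiffAt (hU.mem_nhds hx)).isSymmSndFDerivAt
      (by simpa using ENat.LEInfty.out)).eq ξ η
    rw [fderiv_clm_comp h4 hd, h3]
    simp only [add_apply, ContinuousLinearMap.comp_apply, ContinuousLinearMap.compL_apply,
      ContinuousLinearMap.flip_apply]
    rw [hs, ← S.curv _ (hfV hx), curvOp]
    abel

end Pullback

/-! ### Metrics, Christoffel symbols and curvature given by coefficients. -/

section Coordinates

variable {m : ℕ}

/-- The bilinear form with matrix `M`. -/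
def formCLM (M : Matrix (Fin m) (Fin m) ℝ) : EuclideanSpace ℝ (Fin m) →L[ℝ]
    EuclideanSpace ℝ (Fin m) →L[ℝ] ℝ :=
  ∑ i, ∑ j, M i j • (EuclideanSpace.proj (𝕜 := ℝ) i : EuclideanSpace ℝ (Fin m) →L[ℝ] ℝ).smulRight
    (EuclideanSpace.proj (𝕜 := ℝ) j : EuclideanSpace ℝ (Fin m) →L[ℝ] ℝ)

/-- The bilinear map with coefficients `Γ`. -/
def connCLM (Γ : Fin m → Fin m → Fin m → ℝ) : EuclideanSpace ℝ (Fin m) →L[ℝ]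
    EuclideanSpace ℝ (Fin m) →L[ℝ] EuclideanSpace ℝ (Fin m) :=
  ∑ a, ∑ b, ∑ c, Γ a b c • (EuclideanSpace.proj (𝕜 := ℝ) b : EuclideanSpace ℝ (Fin m) →L[ℝ]
      ℝ).smulRight
    ((EuclideanSpace.proj (𝕜 := ℝ) c : EuclideanSpace ℝ (Fin m) →L[ℝ] ℝ).smulRight
        (EuclideanSpace.single a (1 : ℝ)))

theorem formCLM_apply (M : Matrix (Fin m) (Fin m) ℝ) (u v : EuclideanSpace ℝ (Fin m)) :
    formCLM M u v = ∑ i, ∑ j, M i j * u i * v j := by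
  simp [formCLM, sum_apply, mul_assoc]

theorem formCLM_eq_dotProduct (M : Matrix (Fin m) (Fin m) ℝ) (u v : EuclideanSpace ℝ (Fin m)) :
    formCLM M u v = (fun i => u i) ⬝ᵥ M.mulVec (fun i => v i) := by
  simp only [formCLM_apply, dotProduct, Matrix.mulVec, Finset.mul_sum]
  exact Finset.sum_congr rfl fun i _ => Finset.sum_congr rfl fun j _ => by ring

theorem formCLM_single (M : Matrix (Fin m) (Fin m) ℝ) (i j : Fin m) :
    formCLM M (EuclideanSpace.single i 1) (EuclideanSpace.single j 1) = M i j := by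
  simp [formCLM_apply]

theorem connCLM_apply (Γ : Fin m → Fin m → Fin m → ℝ) (u v : EuclideanSpace ℝ (Fin m)) (a : Fin m) :
    connCLM Γ u v a = ∑ b, ∑ c, Γ a b c * u b * v c := by
  simp [connCLM, sum_apply, mul_assoc, Finset.sum_apply, Pi.single_apply]

theorem connCLM_single (Γ : Fin m → Fin m → Fin m → ℝ) (a b c : Fin m) :
    connCLM Γ (EuclideanSpace.single b 1) (EuclideanSpace.single c 1) a = Γ a b c := by
  simp [connCLM_apply]

theorem clm_ext_single {V : Type*} [AddCommGroup V] [Module ℝ V]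
    {L R : EuclideanSpace ℝ (Fin m) → V} (hL : IsLinearMap ℝ L) (hR : IsLinearMap ℝ R)
    (h : ∀ i, L (EuclideanSpace.single i 1) = R (EuclideanSpace.single i 1))
        (u : EuclideanSpace ℝ (Fin m)) :
    L u = R u := by
  have : hL.mk' L = hR.mk' R := by
    refine (EuclideanSpace.basisFun (Fin m) ℝ).toBasis.ext fun i => ?_
    simpa using h i
  exact congrArg (fun f => f u) this

theorem contDiffOn_smul_const {P F : Type*} [NormedAddCommGroup P] [NormedSpace ℝ P]
    [NormedAddCommGroup F] [NormedSpace ℝ F] {V : Set P} {a : P → ℝ} (h : ContDiffOn ℝ ∞ a V)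
    (c : F) : ContDiffOn ℝ ∞ (fun y => a y • c) V := h.smul contDiffOn_const

theorem contDiffOn_formCLM {P : Type*} [NormedAddCommGroup P] [NormedSpace ℝ P] {V : Set P}
    {G : P → Matrix (Fin m) (Fin m) ℝ} (h : ∀ i j, ContDiffOn ℝ ∞ (fun y => G y i j) V) :
    ContDiffOn ℝ ∞ (fun y => formCLM (G y)) V :=
  ContDiffOn.sum fun i _ => ContDiffOn.sum fun j _ => contDiffOn_smul_const (h i j) _

theorem contDiffOn_connCLM {P : Type*} [NormedAddCommGroup P] [NormedSpace ℝ P] {V : Set P}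
    {Γ : P → Fin m → Fin m → Fin m → ℝ} (h : ∀ a b c, ContDiffOn ℝ ∞ (fun y => Γ y a b c) V) :
    ContDiffOn ℝ ∞ (fun y => connCLM (Γ y)) V :=
  ContDiffOn.sum fun a _ => ContDiffOn.sum fun b _ => ContDiffOn.sum fun c _ =>
    contDiffOn_smul_const (h a b c) _

variable {V : Set (EuclideanSpace ℝ (Fin m))} {G : EuclideanSpace ℝ (Fin m) →
    Matrix (Fin m) (Fin m) ℝ}

theorem fderiv_formCLM_single (hV : IsOpen V) (h : ∀ i j, ContDiffOn ℝ ∞ (fun y => G y i j) V)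
    {y : EuclideanSpace ℝ (Fin m)} (hy : y ∈ V) (k i j : Fin m) :
    fderiv ℝ (fun y => formCLM (G y)) y (EuclideanSpace.single k 1) (EuclideanSpace.single i 1)
      (EuclideanSpace.single j 1) = pderiv k (fun y => G y i j) y := by
  have hd := differentiableAt_of_contDiffOn hV (contDiffOn_formCLM h) hy
  have e : (fun y => G y i j) = fun y => formCLM (G y) (EuclideanSpace.single i 1)
      (EuclideanSpace.single j 1) := by
    funext y; rw [formCLM_single]
  rw [pderiv, e, fderiv_bilin_apply hd]

theorem fderiv_connCLM_single {Γ : EuclideanSpace ℝ (Fin m) → Fin m → Fin m → Fin m → ℝ}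
    (hV : IsOpen V)
    (h : ∀ a b c, ContDiffOn ℝ ∞ (fun y => Γ y a b c) V)
    {y : EuclideanSpace ℝ (Fin m)} (hy : y ∈ V) (k a b c : Fin m) :
    fderiv ℝ (fun y => connCLM (Γ y)) y (EuclideanSpace.single k 1) (EuclideanSpace.single b 1)
      (EuclideanSpace.single c 1) a = pderiv k (fun y => Γ y a b c) y := by
  have hd := differentiableAt_of_contDiffOn hV (contDiffOn_connCLM h) hy
  have e : (fun y => Γ y a b c) = fun y => (EuclideanSpace.proj (𝕜 := ℝ) a :
      EuclideanSpace ℝ (Fin m) →L[ℝ] ℝ)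
      (connCLM (Γ y) (EuclideanSpace.single b 1) (EuclideanSpace.single c 1)) := by
    funext y; simp [connCLM_single]
  have hd2 : DifferentiableAt ℝ (fun y => connCLM (Γ y) (EuclideanSpace.single b 1)
      (EuclideanSpace.single c 1)) y :=
    (hd.clm_apply (differentiableAt_const _)).clm_apply (differentiableAt_const _)
  rw [pderiv, e, ← fderiv_bilin_apply hd]
  exact (congrArg (fun L => L (EuclideanSpace.single k 1))
    ((EuclideanSpace.proj (𝕜 := ℝ) a : EuclideanSpace ℝ (Fin m) →L[ℝ] ℝ).hasFDerivAt.comp y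
      hd2.hasFDerivAt).fderiv).symm

/-- A smooth metric in coordinates. -/
structure IsCoordMetric (V : Set (EuclideanSpace ℝ (Fin m)))
    (G : EuclideanSpace ℝ (Fin m) → Matrix (Fin m) (Fin m) ℝ) : Prop where
  isOpen : IsOpen V
  smooth : ∀ i j, ContDiffOn ℝ ∞ (fun y => G y i j) V
  symm : ∀ y ∈ V, ∀ i j, G y i j = G y j i
  posDef : ∀ y ∈ V, (G y).PosDef

namespace IsCoordMetric

theorem det_ne_zero (S : IsCoordMetric V G) {y : EuclideanSpace ℝ (Fin m)} (hy : y ∈ V) :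
    (G y).det ≠ 0 :=
  (S.posDef y hy).det_pos.ne'

theorem pderiv_symm (S : IsCoordMetric V G) {y : EuclideanSpace ℝ (Fin m)} (hy : y ∈ V)
    (k i j : Fin m) :
    pderiv k (fun y => G y i j) y = pderiv k (fun y => G y j i) y := by
  rw [pderiv, pderiv, fderiv_eq_of_eqOn S.isOpen (fun z hz => S.symm z hz i j) hy]

theorem smooth_inv (S : IsCoordMetric V G) (i j : Fin m) :
    ContDiffOn ℝ ∞ (fun y => (G y)⁻¹ i j) V := by
  simp only [Matrix.inv_def, Matrix.smul_apply, Ring.inverse_eq_inv', smul_eq_mul,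
    Matrix.adjugate_apply]
  refine ContDiffOn.mul (ContDiffOn.inv ?_ fun y hy => S.det_ne_zero hy) ?_
  · simp only [Matrix.det_apply']
    exact ContDiffOn.sum fun σ _ => contDiffOn_const.mul (contDiffOn_prod fun i _ => S.smooth _ _)
  · simp only [Matrix.det_apply']
    refine ContDiffOn.sum fun σ _ => contDiffOn_const.mul (contDiffOn_prod fun k _ => ?_)
    by_cases hk : σ k = j
    · subst hk; simpa using contDiffOn_const
    · simpa [Matrix.updateRow_ne hk] using S.smooth _ _

theorem smooth_christoffel (S : IsCoordMetric V G) (k i j : Fin m) :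
    ContDiffOn ℝ ∞ (fun y => christoffel G y k i j) V := by
  have hp : ∀ a b c, ContDiffOn ℝ ∞ (fun y => pderiv a (fun z => G z b c) y) V := fun a b c =>
    contDiffOn_along S.isOpen (S.smooth b c) _
  exact contDiffOn_const.mul (ContDiffOn.sum fun l _ => (S.smooth_inv k l).mul
    (((hp _ _ _).add (hp _ _ _)).sub (hp _ _ _)))

theorem christoffel_symm (S : IsCoordMetric V G) {y : EuclideanSpace ℝ (Fin m)} (hy : y ∈ V)
    (k i j : Fin m) :
    christoffel G y k i j = christoffel G y k j i := by
  simp only [christoffel]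
  congr 1
  refine Finset.sum_congr rfl fun l _ => ?_
  rw [S.pderiv_symm hy l i j]; ring

theorem lower_christoffel (S : IsCoordMetric V G) {y : EuclideanSpace ℝ (Fin m)} (hy : y ∈ V)
    (l i j : Fin m) :
    ∑ k, G y l k * christoffel G y k i j = (1 / 2) * (pderiv i (fun y => G y l j) y
      + pderiv j (fun y => G y l i) y - pderiv l (fun y => G y i j) y) := by
  have h1 : G y * (G y)⁻¹ = 1 := Matrix.mul_nonsing_inv _ (S.det_ne_zero hy).isUnit
  have h2 : ∀ p, ∑ k, G y l k * (G y)⁻¹ k p = if l = p then 1 else 0 := fun p => by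
    rw [← Matrix.mul_apply, h1, Matrix.one_apply]
  simp only [christoffel, Finset.mul_sum]
  rw [Finset.sum_comm]
  have : ∀ p, ∑ k, G y l k * (1 / 2 * ((G y)⁻¹ k p * (pderiv i (fun y => G y p j) y
      + pderiv j (fun y => G y p i) y - pderiv p (fun y => G y i j) y))) =
      (∑ k, G y l k * (G y)⁻¹ k p) * (1 / 2 * (pderiv i (fun y => G y p j) y
      + pderiv j (fun y => G y p i) y - pderiv p (fun y => G y i j) y)) := fun p => by
    rw [Finset.sum_mul]; exact Finset.sum_congr rfl fun k _ => by ring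
  rw [Finset.sum_congr rfl fun p _ => this p]
  simp [h2]

theorem formCLM_symm (S : IsCoordMetric V G) {y : EuclideanSpace ℝ (Fin m)} (hy : y ∈ V)
    (u v : EuclideanSpace ℝ (Fin m)) :
    formCLM (G y) u v = formCLM (G y) v u := by
  rw [formCLM_apply, formCLM_apply, Finset.sum_comm]
  refine Finset.sum_congr rfl fun i _ => Finset.sum_congr rfl fun j _ => ?_
  rw [S.symm y hy]; ring

theorem formCLM_pos (S : IsCoordMetric V G) {y : EuclideanSpace ℝ (Fin m)} (hy : y ∈ V)
    {u : EuclideanSpace ℝ (Fin m)} (hu : u ≠ 0) :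
    0 < formCLM (G y) u u := by
  rw [formCLM_eq_dotProduct]
  have := (S.posDef y hy).dotProduct_mulVec_pos (x := fun i => u i) (fun h => hu (by
    ext i; exact congrFun h i))
  simpa using this

theorem conn_symm (S : IsCoordMetric V G) {y : EuclideanSpace ℝ (Fin m)} (hy : y ∈ V)
    (u v : EuclideanSpace ℝ (Fin m)) :
    connCLM (christoffel G y) u v = connCLM (christoffel G y) v u := by
  ext a
  rw [connCLM_apply, connCLM_apply, Finset.sum_comm]
  refine Finset.sum_congr rfl fun i _ => Finset.sum_congr rfl fun j _ => ?_
  rw [S.christoffel_symm hy]; ring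

/-- On basis vectors the claim is that the two lowered Christoffel symbols add up to `∂_k g_ij`. -/
theorem compat (S : IsCoordMetric V G) {y : EuclideanSpace ℝ (Fin m)} (hy : y ∈ V)
    (ξ u v : EuclideanSpace ℝ (Fin m)) :
    fderiv ℝ (fun y => formCLM (G y)) y ξ u v =
      formCLM (G y) (connCLM (christoffel G y) ξ u) v
      + formCLM (G y) u (connCLM (christoffel G y) ξ v) := by
  refine clm_ext_single (L := fun ξ => fderiv ℝ (fun y => formCLM (G y)) y ξ u v)
    (R := fun ξ => formCLM (G y) (connCLM (christoffel G y) ξ u) v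
      + formCLM (G y) u (connCLM (christoffel G y) ξ v))
    ⟨fun a b => by simp, fun c a => by simp⟩
    ⟨fun a b => by simp; ring, fun c a => by simp; ring⟩ (fun k => ?_) ξ
  refine clm_ext_single (L := fun u => fderiv ℝ (fun y => formCLM (G y)) y _ u v)
    (R := fun u => formCLM (G y) (connCLM (christoffel G y) (EuclideanSpace.single k 1) u) v
      + formCLM (G y) u (connCLM (christoffel G y) (EuclideanSpace.single k 1) v))
    ⟨fun a b => by simp, fun c a => by simp⟩
    ⟨fun a b => by simp; ring, fun c a => by simp; ring⟩ (fun i => ?_) u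
  refine clm_ext_single (L := fun v => fderiv ℝ (fun y => formCLM (G y)) y _ _ v)
    (R := fun v => formCLM (G y) (connCLM (christoffel G y) (EuclideanSpace.single k 1)
      (EuclideanSpace.single i 1)) v
      + formCLM (G y) (EuclideanSpace.single i 1)
        (connCLM (christoffel G y) (EuclideanSpace.single k 1) v))
    ⟨fun a b => by simp, fun c a => by simp⟩
    ⟨fun a b => by simp; ring, fun c a => by simp; ring⟩ (fun j => ?_) v
  rw [fderiv_formCLM_single S.isOpen S.smooth hy, S.formCLM_symm hy (connCLM _ _ _)]
  have low : ∀ i j, formCLM (G y) (EuclideanSpace.single i 1)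
      (connCLM (christoffel G y) (EuclideanSpace.single k 1) (EuclideanSpace.single j 1)) =
      (1 / 2) * (pderiv k (fun y => G y i j) y
      + pderiv j (fun y => G y i k) y - pderiv i (fun y => G y k j) y) := by
    intro i j
    rw [← S.lower_christoffel hy, formCLM_apply]
    simp [connCLM_single]
  rw [low, low, S.pderiv_symm hy k j i, S.pderiv_symm hy j i k, S.pderiv_symm hy i j k]
  ring

theorem curvOp_single (S : IsCoordMetric V G) {y : EuclideanSpace ℝ (Fin m)} (hy : y ∈ V)
    (a b c d : Fin m) :
    curvOp (fun z => connCLM (christoffel G z)) y (EuclideanSpace.single c 1)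
        (EuclideanSpace.single d 1)
      (EuclideanSpace.single b 1) a = riemann G y a b c d := by
  have h := fun k a b c => fderiv_connCLM_single (Γ := christoffel G) S.isOpen
    S.smooth_christoffel hy k a b c
  have e : ∀ (u : EuclideanSpace ℝ (Fin m)) (p : Fin m),
      connCLM (christoffel G y) (EuclideanSpace.single p 1) u a
        = ∑ e, christoffel G y a p e * u e := fun u p => by
    simp [connCLM_apply]
  simp only [curvOp, PiLp.sub_apply, PiLp.add_apply, h, e, connCLM_single, riemann,
    Finset.sum_sub_distrib]
  ring

/-- Both sides are multilinear; on basis vectors the curvature operator has the components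
`riemann`. -/
theorem sectional_numerator (S : IsCoordMetric V G) {y : EuclideanSpace ℝ (Fin m)} (hy : y ∈ V)
    (v w : EuclideanSpace ℝ (Fin m)) :
    ∑ e, ∑ a, ∑ b, ∑ c, ∑ d, G y e a * riemann G y a b c d * v e * w b * v c * w d =
      formCLM (G y) v (curvOp (fun z => connCLM (christoffel G z)) y v w w) := by
  have hR : ∀ ξ η u : EuclideanSpace ℝ (Fin m), ∀ a, curvOp (fun z => connCLM (christoffel G z)) y ξ
      η u a =
      ∑ b, ∑ c, ∑ d, riemann G y a b c d * u b * ξ c * η d := by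
    intro ξ η u a
    have lin : ∀ a, (fun ξ η u : EuclideanSpace ℝ (Fin m) => curvOp
        (fun z => connCLM (christoffel G z)) y ξ η u a) = fun ξ η u =>
        ∑ b, ∑ c, ∑ d, riemann G y a b c d * u b * ξ c * η d := by
      intro a
      funext ξ η u
      refine clm_ext_single (L := fun ξ => curvOp (fun z => connCLM (christoffel G z)) y ξ η u a)
        (R := fun ξ => ∑ b, ∑ c, ∑ d, riemann G y a b c d * u b * ξ c * η d)
        ⟨fun x z => by simp [curvOp]; ring, fun c x => by simp [curvOp]; ring⟩
        ⟨fun x z => by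
          simp only [PiLp.add_apply, mul_add, add_mul, Finset.sum_add_distrib],
          fun c x => by
            simp only [PiLp.smul_apply, smul_eq_mul, Finset.mul_sum]
            refine Finset.sum_congr rfl fun _ _ => Finset.sum_congr rfl fun _ _ =>
              Finset.sum_congr rfl fun _ _ => by ring⟩ (fun c' => ?_) ξ
      refine clm_ext_single (L := fun η => curvOp (fun z => connCLM (christoffel G z)) y _ η u a)
        (R := fun η => ∑ b, ∑ c, ∑ d, riemann G y a b c d * u b
          * (EuclideanSpace.single c' (1 : ℝ) : EuclideanSpace ℝ (Fin m)) c * η d)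
        ⟨fun x z => by simp [curvOp]; ring, fun c x => by simp [curvOp]; ring⟩
        ⟨fun x z => by
          simp only [PiLp.add_apply, mul_add, Finset.sum_add_distrib],
          fun c x => by
            simp only [PiLp.smul_apply, smul_eq_mul, Finset.mul_sum]
            refine Finset.sum_congr rfl fun _ _ => Finset.sum_congr rfl fun _ _ =>
              Finset.sum_congr rfl fun _ _ => by ring⟩ (fun d' => ?_) η
      refine clm_ext_single (L := fun u => curvOp (fun z => connCLM (christoffel G z)) y _ _ u a)
        (R := fun u => ∑ b, ∑ c, ∑ d, riemann G y a b c d * u b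
          * (EuclideanSpace.single c' (1 : ℝ) : EuclideanSpace ℝ (Fin m)) c *
              (EuclideanSpace.single d' (1 : ℝ) : EuclideanSpace ℝ (Fin m)) d)
        ⟨fun x z => by simp [curvOp]; ring, fun c x => by simp [curvOp]; ring⟩
        ⟨fun x z => by
          simp only [PiLp.add_apply, mul_add, add_mul, Finset.sum_add_distrib],
          fun c x => by
            simp only [PiLp.smul_apply, smul_eq_mul, Finset.mul_sum]
            refine Finset.sum_congr rfl fun _ _ => Finset.sum_congr rfl fun _ _ =>
              Finset.sum_congr rfl fun _ _ => by ring⟩ (fun b' => ?_) u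
      dsimp only
      rw [S.curvOp_single hy]
      simp
    exact congrFun (congrFun (congrFun (lin a) ξ) η) u
  rw [formCLM_apply]
  refine Finset.sum_congr rfl fun e _ => Finset.sum_congr rfl fun a _ => ?_
  rw [hR, Finset.mul_sum]
  refine Finset.sum_congr rfl fun b _ => ?_
  rw [Finset.mul_sum]
  refine Finset.sum_congr rfl fun c _ => ?_
  rw [Finset.mul_sum]
  refine Finset.sum_congr rfl fun d _ => by ring

theorem isLeviCivita (S : IsCoordMetric V G) :
    IsLeviCivita V (fun y => formCLM (G y)) (fun y => connCLM (christoffel G y)) where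
  isOpen := S.isOpen
  smooth_metric := contDiffOn_formCLM S.smooth
  smooth_conn := contDiffOn_connCLM S.smooth_christoffel
  symm _ hy := S.formCLM_symm hy
  compat _ hy := S.compat hy
  torsion _ hy := S.conn_symm hy

theorem isSpaceForm (S : IsCoordMetric V G) {K : ℝ}
    (hK : ∀ y ∈ V, ∀ v w : Fin m → ℝ, LinearIndependent ℝ ![v, w] →
      sectionalCurvature G y v w = K) :
    IsSpaceForm V (fun y => formCLM (G y)) (fun y => connCLM (christoffel G y)) K where
  toIsLeviCivita := S.isLeviCivita
  curv y hy := by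
    refine S.isLeviCivita.curvOp_eq hy (fun v w => ?_) (fun u hu => ?_)
    · obtain ⟨B, hB⟩ : ∃ B, B = formCLM (G y) := ⟨_, rfl⟩
      have hpos : ∀ u, u ≠ 0 → 0 < B u u := fun u hu => by rw [hB]; exact S.formCLM_pos hy hu
      have hsymm : ∀ u v, B u v = B v u := fun u v => by rw [hB]; exact S.formCLM_symm hy u v
      by_cases hli : LinearIndependent ℝ ![(fun i => v i : Fin m → ℝ), fun i => w i]
      · have h := hK y hy _ _ hli
        rw [sectionalCurvature] at h
        rw [S.sectional_numerator hy v w, ← formCLM_eq_dotProduct, ← formCLM_eq_dotProduct,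
          ← formCLM_eq_dotProduct, ← hB] at h
        rw [← hB]
        have hw : w ≠ 0 := by
          rintro rfl
          exact hli.ne_zero 1 (by ext i; simp)
        -- Strict Cauchy–Schwarz: this vector is nonzero, and its square length is `B w w` times the
        -- denominator of the sectional curvature, which is therefore positive.
        have hu : B w w • v - B v w • w ≠ 0 := by
          intro h0
          rw [LinearIndependent.pair_iff] at hli
          have := (hli (B w w) (- B v w) (by
            ext i
            have := congrArg (fun z : EuclideanSpace ℝ (Fin m) => z i) h0
            simp at this
            simp
            linarith)).1
          exact (hpos w hw).ne' this
        have h1 := hpos _ hu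
        have h2 : B (B w w • v - B v w • w) (B w w • v - B v w • w) =
            B w w * (B v v * B w w - B v w ^ 2) := by
          simp only [map_sub, map_smul, sub_apply, smul_apply, smul_eq_mul]
          rw [hsymm w v]; ring
        rw [h2] at h1
        have h3 := (pos_iff_pos_of_mul_pos h1).1 (hpos w hw)
        rw [hsymm, ← h]
        field_simp
      -- On dependent pairs the hypothesis says nothing, but both sides vanish.
      · have hdep : v = 0 ∨ ∃ c : ℝ, w = c • v := by
          by_contra! hc
          refine hli ((LinearIndependent.pair_iff' ?_).2 fun c hcw => hc.2 c ?_)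
          · intro h0; exact hc.1 (by ext i; exact congrFun h0 i)
          · ext i; simpa using (congrFun hcw i).symm
        have zero : ∀ v, curvOp (fun z => connCLM (christoffel G z)) y v v = 0 := fun v => by
          funext u; simp [curvOp]
        rcases hdep with rfl | ⟨c, rfl⟩
        · simp
        · have : curvOp (fun z => connCLM (christoffel G z)) y v (c • v) (c • v) = 0 := by
            have e : curvOp (fun z => connCLM (christoffel G z)) y v (c • v) (c • v) =
                c • curvOp (fun z => connCLM (christoffel G z)) y v v (c • v) := by
              simp [curvOp]
            rw [e, zero]; simp
          rw [this, ← hB]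
          simp only [map_smul, smul_apply, smul_eq_mul, map_zero, zero_apply]
          ring
    · by_contra hne
      exact (S.formCLM_pos hy hne).ne' (hu u)

end IsCoordMetric

end Coordinates

/-! ### Pairs of quadratic forms -/

section PairsOfForms

open Matrix

variable {n : ℕ}

theorem exists_orthogonal_diagonal {A : Matrix (Fin n) (Fin n) ℝ} (hA : A.IsHermitian) :
    ∃ (Q : Matrix (Fin n) (Fin n) ℝ) (d : Fin n → ℝ), Qᵀ * Q = 1 ∧ Qᵀ * A * Q = diagonal d := by
  refine ⟨hA.eigenvectorUnitary, hA.eigenvalues, ?_, ?_⟩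
  · have := Unitary.coe_star_mul_self hA.eigenvectorUnitary
    rwa [star_eq_conjTranspose, conjTranspose_eq_transpose_of_trivial] at this
  · have := hA.conjStarAlgAut_star_eigenvectorUnitary
    rw [Unitary.conjStarAlgAut_apply] at this
    simpa [star_eq_conjTranspose, conjTranspose_eq_transpose_of_trivial, Function.comp_def] using
        this

/-- Simultaneous diagonalisation of a positive definite and a symmetric matrix. -/
theorem exists_simultaneous_diagonal {g h : Matrix (Fin n) (Fin n) ℝ} (hg : g.PosDef)
    (hh : h.IsSymm) : ∃ (Q : Matrix (Fin n) (Fin n) ℝ) (d : Fin n → ℝ),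
      Qᵀ * g * Q = 1 ∧ Qᵀ * h * Q = diagonal d := by
  obtain ⟨U, a, hU, ha⟩ := exists_orthogonal_diagonal hg.isHermitian
  have hinj : ∀ k, U.mulVec (Pi.single k 1) ≠ 0 := by
    intro k h0
    have : (Uᵀ * U).mulVec (Pi.single k 1) = 0 := by rw [← mulVec_mulVec, h0, mulVec_zero]
    rw [hU, one_mulVec] at this
    simpa using congrFun this k
  have hpos : ∀ k, 0 < a k := by
    intro k
    have h1 := hg.dotProduct_mulVec_pos (hinj k)
    have h2 : (Pi.single k 1 : Fin n → ℝ) ⬝ᵥ (Uᵀ * g * U).mulVec (Pi.single k 1) = a k := by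
      rw [ha]; simp
    rw [← h2, ← mulVec_mulVec, ← mulVec_mulVec, dotProduct_mulVec, vecMul_transpose]
    simpa using h1
  -- `C` takes `g` to the identity. An orthogonal diagonalisation of the transformed `h` then keeps
  -- `g` the identity.
  obtain ⟨C, hC⟩ : ∃ C, C = U * diagonal fun k => (Real.sqrt (a k))⁻¹ := ⟨_, rfl⟩
  have hCg : Cᵀ * g * C = 1 := by
    have : Cᵀ * g * C = diagonal (fun k => (Real.sqrt (a k))⁻¹) * (Uᵀ * g * U)
        * diagonal fun k => (Real.sqrt (a k))⁻¹ := by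
      rw [hC, transpose_mul, diagonal_transpose]; simp only [Matrix.mul_assoc]
    rw [this, ha, diagonal_mul_diagonal, diagonal_mul_diagonal, ← diagonal_one]
    congr 1
    funext k
    have := Real.sqrt_pos.2 (hpos k)
    field_simp
    rw [Real.sq_sqrt (hpos k).le]
  have hS : (Cᵀ * h * C).IsHermitian := by
    rw [IsHermitian, conjTranspose_eq_transpose_of_trivial]
    simp only [transpose_mul, transpose_transpose, hh.eq, Matrix.mul_assoc]
  obtain ⟨R, d, hR, hd⟩ := exists_orthogonal_diagonal hS
  refine ⟨C * R, d, ?_, ?_⟩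
  · calc (C * R)ᵀ * g * (C * R) = Rᵀ * (Cᵀ * g * C) * R := by
          rw [transpose_mul]; simp only [Matrix.mul_assoc]
      _ = 1 := by rw [hCg, Matrix.mul_one, hR]
  · rw [← hd, transpose_mul]; simp only [Matrix.mul_assoc]

/-- The lowest eigenvalue of `g⁻¹ h`. -/
theorem lowest_eigenvalue [NeZero n] {g h Q : Matrix (Fin n) (Fin n) ℝ} {d : Fin n → ℝ}
    (hg : Qᵀ * g * Q = 1) (hh : Qᵀ * h * Q = diagonal d) :
    ∃ i, (∀ k, d i ≤ d k) ∧
      sInf {l : ℝ | Module.End.HasEigenvalue (Matrix.toLin' (g⁻¹ * h)) l} = d i := by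
  obtain ⟨i, hi⟩ := Finite.exists_min d
  refine ⟨i, hi, ?_⟩
  have hQ : Q * (Qᵀ * g) = 1 := mul_eq_one_comm.1 hg
  have hginv : g⁻¹ = Q * Qᵀ := by
    refine Matrix.inv_eq_left_inv ?_
    rw [Matrix.mul_assoc]; exact hQ
  have hsh : g⁻¹ * h * Q = Q * diagonal d := by
    rw [hginv, ← hh]; simp only [Matrix.mul_assoc]
  -- The columns of `Q` are eigenvectors of `g⁻¹ h` and form a basis, so the entries of `d` are all
  -- the eigenvalues.
  have hset : {l : ℝ | Module.End.HasEigenvalue (Matrix.toLin' (g⁻¹ * h)) l} = Set.range d := by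
    ext l
    constructor
    · intro hl
      obtain ⟨v, hv⟩ := hl.exists_hasEigenvector
      have hv1 : (g⁻¹ * h).mulVec v = l • v := by simpa using hv.apply_eq_smul
      obtain ⟨w, hw⟩ : ∃ w, w = (Qᵀ * g).mulVec v := ⟨_, rfl⟩
      have hvw : v = Q.mulVec w := by rw [hw, mulVec_mulVec, hQ, one_mulVec]
      have hw0 : w ≠ 0 := by rintro rfl; exact hv.2 (by rw [hvw, mulVec_zero])
      have h2 : (diagonal d).mulVec w = l • w := by
        have h3 : Q.mulVec ((diagonal d).mulVec w) = Q.mulVec (l • w) := by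
          rw [mulVec_mulVec, ← hsh, ← mulVec_mulVec, ← hvw, hv1, hvw, mulVec_smul]
        have key : ∀ z, (Qᵀ * g).mulVec (Q.mulVec z) = z := fun z => by
          rw [mulVec_mulVec, hg, one_mulVec]
        rw [← key ((diagonal d).mulVec w), h3, key]
      obtain ⟨k, hk⟩ := Function.ne_iff.1 hw0
      refine ⟨k, ?_⟩
      have := congrFun h2 k
      rw [mulVec_diagonal] at this
      exact mul_right_cancel₀ hk this
    · rintro ⟨k, rfl⟩
      refine Module.End.hasEigenvalue_of_hasEigenvector (x := Q.mulVec (Pi.single k 1)) ⟨?_, ?_⟩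
      · rw [Module.End.mem_eigenspace_iff, toLin'_apply, mulVec_mulVec, hsh, ← mulVec_mulVec,
          ← mulVec_smul]
        congr 1
        ext j
        by_cases hj : j = k
        · subst hj; simp [mulVec_diagonal]
        · simp [mulVec_diagonal, hj]
      · intro h0
        have : (Qᵀ * g * Q).mulVec (Pi.single k 1) = 0 := by rw [← mulVec_mulVec, h0, mulVec_zero]
        rw [hg, one_mulVec] at this
        simpa using congrFun this k
  rw [hset]
  exact IsLeast.csInf_eq ⟨⟨i, rfl⟩, by rintro _ ⟨k, rfl⟩; exact hi k⟩

/-- The lowest eigenvalue of `g⁻¹ h` is the minimum of the Rayleigh quotient. -/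
theorem lowest_eigenvalue_isLeast [NeZero n] {g h : Matrix (Fin n) (Fin n) ℝ} (hg : g.PosDef)
    (hh : h.IsSymm) :
    (∀ ζ, sInf {l : ℝ | Module.End.HasEigenvalue (Matrix.toLin' (g⁻¹ * h)) l} * (ζ ⬝ᵥ g.mulVec ζ) ≤
      ζ ⬝ᵥ h.mulVec ζ) ∧
    ∃ ζ, ζ ≠ 0 ∧ ζ ⬝ᵥ h.mulVec ζ =
      sInf {l : ℝ | Module.End.HasEigenvalue (Matrix.toLin' (g⁻¹ * h)) l} * (ζ ⬝ᵥ g.mulVec ζ) := by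
  obtain ⟨Q, d, hQg, hQh⟩ := exists_simultaneous_diagonal hg hh
  obtain ⟨i, hi, hl⟩ := lowest_eigenvalue hQg hQh
  rw [hl]
  have conj : ∀ (A : Matrix (Fin n) (Fin n) ℝ) w,
      Q.mulVec w ⬝ᵥ A.mulVec (Q.mulVec w) = w ⬝ᵥ (Qᵀ * A * Q).mulVec w := fun A w => by
    rw [← mulVec_mulVec, ← mulVec_mulVec, dotProduct_mulVec w, vecMul_transpose]
  constructor
  · intro ζ
    have hζ : ζ = Q.mulVec ((Qᵀ * g).mulVec ζ) := by
      rw [mulVec_mulVec, mul_eq_one_comm.1 hQg, one_mulVec]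
    rw [hζ, conj, conj, hQg, hQh, one_mulVec]
    simp only [dotProduct, mulVec_diagonal, Finset.mul_sum]
    exact Finset.sum_le_sum fun k _ => by
      nlinarith [hi k, mul_self_nonneg ((Qᵀ * g).mulVec ζ k)]
  · refine ⟨Q.mulVec (Pi.single i 1), fun h0 => ?_, ?_⟩
    · have : (Qᵀ * g * Q).mulVec (Pi.single i 1) = 0 := by rw [← mulVec_mulVec, h0, mulVec_zero]
      rw [hQg, one_mulVec] at this
      simpa using congrFun this i
    · rw [conj, conj, hQg, hQh]; simp

theorem trace_inv_mul_conj {g h P : Matrix (Fin n) (Fin n) ℝ} (hP : IsUnit P.det) :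
    ((Pᵀ * g * P)⁻¹ * (Pᵀ * h * P)).trace = (g⁻¹ * h).trace := by
  have hP' : IsUnit Pᵀ.det := by rwa [det_transpose]
  rw [Matrix.mul_inv_rev, Matrix.mul_inv_rev]
  have : P⁻¹ * (g⁻¹ * Pᵀ⁻¹) * (Pᵀ * h * P) = P⁻¹ * (g⁻¹ * h * P) := by
    calc P⁻¹ * (g⁻¹ * Pᵀ⁻¹) * (Pᵀ * h * P) = P⁻¹ * (g⁻¹ * ((Pᵀ⁻¹ * Pᵀ) * (h * P))) := by
          simp only [Matrix.mul_assoc]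
      _ = _ := by rw [Matrix.nonsing_inv_mul _ hP', Matrix.one_mul, Matrix.mul_assoc g⁻¹]
  rw [this, Matrix.trace_mul_comm, Matrix.mul_assoc, Matrix.mul_nonsing_inv _ hP, Matrix.mul_one]

end PairsOfForms

/-! ### Change of the spatial coordinates -/

section Reparam

variable {E W : Type*} [NormedAddCommGroup E] [NormedSpace ℝ E]
  [NormedAddCommGroup W] [NormedSpace ℝ W]

/-- The quadratic change of the spatial coordinates with second derivative `Q` at `x₀`. -/
def reparam (Q : E →L[ℝ] E →L[ℝ] E) (x₀ : E) (y : E × ℝ) : E × ℝ :=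
  (y.1 + (1 / 2 : ℝ) • Q (y.1 - x₀) (y.1 - x₀), y.2)

theorem contDiff_reparam (Q : E →L[ℝ] E →L[ℝ] E) (x₀ : E) : ContDiff ℝ ∞ (reparam Q x₀) := by
  have h : ContDiff ℝ ∞ fun y : E × ℝ => y.1 - x₀ := contDiff_fst.sub contDiff_const
  exact (contDiff_fst.add (contDiff_const.smul ((Q.contDiff.comp h).clm_apply h))).prodMk
    contDiff_snd

theorem fderiv_reparam {Q : E →L[ℝ] E →L[ℝ] E} (hQ : ∀ u v, Q u v = Q v u) (x₀ : E) (y : E × ℝ)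
    (ξ : E × ℝ) : fderiv ℝ (reparam Q x₀) y ξ = (ξ.1 + Q (y.1 - x₀) ξ.1, ξ.2) := by
  have h1 : HasFDerivAt (fun y : E × ℝ => y.1 - x₀) (ContinuousLinearMap.fst ℝ E ℝ) y :=
    hasFDerivAt_fst.sub_const x₀
  have h2 := ((Q.hasFDerivAt (x := y.1 - x₀)).comp y h1).clm_apply h1
  have h3 := (hasFDerivAt_fst.add (h2.const_smul (1 / 2 : ℝ))).prodMk
    (hasFDerivAt_snd (𝕜 := ℝ) (p := y) (E := E) (F := ℝ))
  have : fderiv ℝ (reparam Q x₀) y = _ := h3.fderiv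
  rw [this]
  ext
  · simp only [ContinuousLinearMap.prod_apply, add_apply, smul_apply,
      ContinuousLinearMap.comp_apply, ContinuousLinearMap.flip_apply,
      ContinuousLinearMap.coe_fst', Function.comp_apply]
    rw [hQ ξ.1, ← two_smul ℝ (Q (y.1 - x₀) ξ.1), smul_smul]
    norm_num
  · rfl

theorem reparam_base (Q : E →L[ℝ] E →L[ℝ] E) (x₀ : E) (t : ℝ) :
    reparam Q x₀ (x₀, t) = (x₀, t) := by simp [reparam]

/-- The connection form along `f` of a connection `Γ`. -/
def connAlong {P : Type*} [NormedAddCommGroup P] [NormedSpace ℝ P] (Γ : W → W →L[ℝ] W →L[ℝ] W)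
    (f : P → W) (x : P) : P →L[ℝ] W →L[ℝ] W :=
  (Γ (f x)).comp (fderiv ℝ f x)

variable {V : Set W} {G : W → W →L[ℝ] W →L[ℝ] ℝ} {Γ : W → W →L[ℝ] W →L[ℝ] W} {K : ℝ}
  {U : Set (E × ℝ)} {f : E × ℝ → W} {ν : E × ℝ → W} {w : E × ℝ → ℝ}

theorem along_reparam {Q : E →L[ℝ] E →L[ℝ] E} (hQ : ∀ u v, Q u v = Q v u) (x₀ : E)
    {g : E × ℝ → W} {y : E × ℝ} (hg : DifferentiableAt ℝ g (reparam Q x₀ y)) (ξ : E × ℝ) :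
    along (g ∘ reparam Q x₀) ξ y =
      along g (ξ.1 + Q (y.1 - x₀) ξ.1, ξ.2) (reparam Q x₀ y) := by
  rw [along, along, fderiv_comp y hg ((contDiff_reparam Q x₀).differentiable (by simp) y),
    ContinuousLinearMap.comp_apply, fderiv_reparam hQ]

theorem covD_reparam {Q : E →L[ℝ] E →L[ℝ] E} (hQ : ∀ u v, Q u v = Q v u) (x₀ : E)
    {Y : E × ℝ → W} {y : E × ℝ} (hf : DifferentiableAt ℝ f (reparam Q x₀ y))
    (hY : DifferentiableAt ℝ Y (reparam Q x₀ y)) (ξ : E × ℝ) :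
    covD (connAlong Γ (f ∘ reparam Q x₀)) ξ (Y ∘ reparam Q x₀) y =
      covD (connAlong Γ f) (ξ.1 + Q (y.1 - x₀) ξ.1, ξ.2) Y (reparam Q x₀ y) := by
  have h1 := along_reparam hQ x₀ hY ξ
  have h2 := along_reparam hQ x₀ hf ξ
  simp only [along] at h1 h2
  simp only [covD, connAlong, ContinuousLinearMap.comp_apply, h1, h2, Function.comp_apply]

/-- The change of coordinates leaves time alone: space directions go to space directions and `(0,
1)` to itself, so normality and the velocity equation persist. -/
theorem IsFlowChart.reparam (SF : IsSpaceForm V G Γ K) (hfV : Set.MapsTo f U V)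
    (S : IsFlowChart U f (fun x => G (f x)) (connAlong Γ f) K ν w)
    {Q : E →L[ℝ] E →L[ℝ] E} (hQ : ∀ u v, Q u v = Q v u) (x₀ : E) :
    IsFlowChart (reparam Q x₀ ⁻¹' U) (f ∘ reparam Q x₀) (fun x => G ((f ∘ reparam Q x₀) x))
      (connAlong Γ (f ∘ reparam Q x₀)) K (ν ∘ reparam Q x₀) (w ∘ reparam Q x₀) where
  toIsSpaceFormMap := by
    have hs := (contDiff_reparam Q x₀).contDiffOn (s := IMCF.reparam Q x₀ ⁻¹' U)
    exact SF.pullback (S.isOpen.preimage (contDiff_reparam Q x₀).continuous)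
      (S.smooth.comp hs fun y hy => hy) (fun y hy => hfV hy)
  smooth_normal := S.smooth_normal.comp (contDiff_reparam Q x₀).contDiffOn fun y hy => hy
  smooth_speed := S.smooth_speed.comp (contDiff_reparam Q x₀).contDiffOn fun y hy => hy
  speed_pos y hy := S.speed_pos _ hy
  unit y hy := S.unit _ hy
  normal y hy ξ := by
    rw [along_reparam hQ x₀ (differentiableAt_of_contDiffOn S.isOpen S.smooth hy)]
    exact S.normal _ hy _
  velocity y hy := by
    rw [along_reparam hQ x₀ (differentiableAt_of_contDiffOn S.isOpen S.smooth hy)]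
    simpa using S.velocity _ hy

end Reparam

/-! ### Derivatives at fixed time and their behaviour under the quadratic change. -/

section Slices

variable {E W : Type*} [NormedAddCommGroup E] [NormedSpace ℝ E]
  [NormedAddCommGroup W] [NormedSpace ℝ W]

theorem hasFDerivAt_slice {F : Type*} [NormedAddCommGroup F] [NormedSpace ℝ F] {B : E × ℝ → F}
    {x : E} {t : ℝ} (hB : DifferentiableAt ℝ B (x, t)) :
    HasFDerivAt (fun x => B (x, t)) ((fderiv ℝ B (x, t)).comp (ContinuousLinearMap.inl ℝ E ℝ)) x :=
  hB.hasFDerivAt.comp x (hasFDerivAt_prodMk_left x t)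

theorem fderiv_slice {F : Type*} [NormedAddCommGroup F] [NormedSpace ℝ F] {B : E × ℝ → F}
    {x : E} {t : ℝ} (hB : DifferentiableAt ℝ B (x, t)) (ξ : E) :
    fderiv ℝ (fun x => B (x, t)) x ξ = fderiv ℝ B (x, t) (ξ, 0) := by
  rw [(hasFDerivAt_slice hB).fderiv]; rfl

/-- For `Q = -Γ` the right-hand side is the covariant derivative of the metric, which is zero: this
is how normal coordinates arise. -/
theorem fderiv_metric_reparam {B : E × ℝ → E →L[ℝ] E →L[ℝ] ℝ} {Q : E →L[ℝ] E →L[ℝ] E}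
    (hQ : ∀ u v, Q u v = Q v u) {x : E} {t : ℝ} (hB : DifferentiableAt ℝ B (x, t)) (u v m : E) :
    fderiv ℝ (fun y : E × ℝ => B (reparam Q x y) (u + Q (y.1 - x) u) (v + Q (y.1 - x) v)) (x, t)
      (m, 0) = fderiv ℝ (fun x => B (x, t)) x m u v + B (x, t) (Q m u) v + B (x, t) u (Q m v) := by
  have h1 : ∀ u : E, HasFDerivAt (fun y : E × ℝ => u + Q (y.1 - x) u)
      ((Q.flip u).comp (ContinuousLinearMap.fst ℝ E ℝ)) (x, t) := by
    intro u
    have h : HasFDerivAt (fun y : E × ℝ => y.1 - x) (ContinuousLinearMap.fst ℝ E ℝ) (x, t) :=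
      hasFDerivAt_fst.sub_const x
    exact (((Q.flip u).hasFDerivAt (x := (x, t).1 - x)).comp (x, t) h).const_add u
  have h2 : DifferentiableAt ℝ (reparam Q x) (x, t) :=
    (contDiff_reparam Q x).differentiable (by simp) _
  have hB' : DifferentiableAt ℝ B (reparam Q x (x, t)) := by rwa [reparam_base]
  have h3 : HasFDerivAt (fun y => B (reparam Q x y))
      ((fderiv ℝ B (reparam Q x (x, t))).comp (fderiv ℝ (reparam Q x) (x, t))) (x, t) :=
    HasFDerivAt.comp (g := B) (f := reparam Q x) (x, t) hB'.hasFDerivAt h2.hasFDerivAt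
  have h4 : fderiv ℝ (fun x => B (x, t)) x m = fderiv ℝ B (x, t) (m, 0) :=
    fderiv_slice (F := E →L[ℝ] E →L[ℝ] ℝ) hB m
  rw [((h3.clm_apply (h1 u)).clm_apply (h1 v)).fderiv, h4]
  simp only [add_apply, ContinuousLinearMap.comp_apply, ContinuousLinearMap.flip_apply,
    fderiv_reparam hQ, reparam_base, sub_self, map_zero, zero_apply, add_zero,
    ContinuousLinearMap.coe_fst']
  ring

/-- For `Q = -Γ` the extra first order term turns the second derivative into the covariant Hessian.
-/
theorem fderiv_fderiv_reparam {φ : E × ℝ → ℝ} {Q : E →L[ℝ] E →L[ℝ] E}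
    (hQ : ∀ u v, Q u v = Q v u) {x : E} {t : ℝ} (hφ : ContDiffAt ℝ 2 φ (x, t)) (u : E) :
    fderiv ℝ (fun y => fderiv ℝ (φ ∘ reparam Q x) y (u, 0)) (x, t) (u, 0) =
      fderiv ℝ (fun y => fderiv ℝ φ y (u, 0)) (x, t) (u, 0) + fderiv ℝ φ (x, t) (Q u u, 0) := by
  have hc : ContinuousAt (reparam Q x) (x, t) :=
    (contDiff_reparam Q x).continuous.continuousAt
  have hev : ∀ᶠ y in 𝓝 (x, t), ContDiffAt ℝ 2 φ (reparam Q x y) :=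
    hc.eventually (by rw [reparam_base]; exact hφ.eventually (by simp))
  have e1 : (fun y => fderiv ℝ (φ ∘ reparam Q x) y (u, 0)) =ᶠ[𝓝 (x, t)]
      fun y => fderiv ℝ φ (reparam Q x y) (u + Q (y.1 - x) u, 0) := by
    filter_upwards [hev] with y hy
    exact along_reparam hQ x (hy.differentiableAt (by simp)) (u, 0)
  have hd : DifferentiableAt ℝ (fderiv ℝ φ) (x, t) :=
    (hφ.fderiv_right (m := 1) (by norm_num)).differentiableAt (by simp)
  have h1 : HasFDerivAt (fun y : E × ℝ => (u + Q (y.1 - x) u, (0 : ℝ)))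
      (((Q.flip u).comp (ContinuousLinearMap.fst ℝ E ℝ)).prod 0) (x, t) := by
    have h : HasFDerivAt (fun y : E × ℝ => y.1 - x) (ContinuousLinearMap.fst ℝ E ℝ) (x, t) :=
      hasFDerivAt_fst.sub_const x
    exact ((((Q.flip u).hasFDerivAt (x := (x, t).1 - x)).comp (x, t) h).const_add u).prodMk
      (hasFDerivAt_const (0 : ℝ) (x, t))
  have h2 : DifferentiableAt ℝ (reparam Q x) (x, t) :=
    (contDiff_reparam Q x).differentiable (by simp) _
  have hd' : DifferentiableAt ℝ (fderiv ℝ φ) (reparam Q x (x, t)) := by rwa [reparam_base]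
  have h3 : HasFDerivAt (fun y => fderiv ℝ φ (reparam Q x y))
      ((fderiv ℝ (fderiv ℝ φ) (reparam Q x (x, t))).comp (fderiv ℝ (reparam Q x) (x, t))) (x, t) :=
    hd'.hasFDerivAt.comp (x, t) h2.hasFDerivAt
  rw [e1.fderiv_eq, (h3.clm_apply h1).fderiv,
    fderiv_clm_apply hd (differentiableAt_const _)]
  simp [fderiv_reparam hQ, reparam_base]
  ring

end Slices

/-! ### The inequality in arbitrary coordinates. -/

section CoordinateInequality

variable {n : ℕ} {W : Type*} [NormedAddCommGroup W] [NormedSpace ℝ W]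
  {V : Set W} {G : W → W →L[ℝ] W →L[ℝ] ℝ} {Γ : W → W →L[ℝ] W →L[ℝ] W} {K : ℝ}
  {U : Set (EuclideanSpace ℝ (Fin n) × ℝ)} {f : EuclideanSpace ℝ (Fin n) × ℝ → W}
  {ν : EuclideanSpace ℝ (Fin n) × ℝ → W} {w : EuclideanSpace ℝ (Fin n) × ℝ → ℝ}

/-- The standard frame. -/
def stdFrame (n : ℕ) (i : Fin n) : EuclideanSpace ℝ (Fin n) := EuclideanSpace.single i 1

theorem formCLM_gram (f : EuclideanSpace ℝ (Fin n) × ℝ → W)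
    (B : EuclideanSpace ℝ (Fin n) × ℝ → W →L[ℝ] W →L[ℝ] ℝ) (y : EuclideanSpace ℝ (Fin n) × ℝ)
    (ζ η : EuclideanSpace ℝ (Fin n)) :
    formCLM (gram f B (stdFrame n) y) ζ η = B y (along f (ζ, 0) y) (along f (η, 0) y) := by
  have lin : ∀ a b : EuclideanSpace ℝ (Fin n), along f (a + b, 0) y =
      along f (a, 0) y + along f (b, 0) y := fun a b => by
    simp only [along, ← map_add, Prod.mk_add_mk, add_zero]
  have lin' : ∀ (c : ℝ) (a : EuclideanSpace ℝ (Fin n)), along f (c • a, 0) y =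
      c • along f (a, 0) y := fun c a => by
    simp only [along, ← map_smul, Prod.smul_mk, smul_zero]
  refine clm_ext_single (L := fun ζ => formCLM (gram f B (stdFrame n) y) ζ η)
    (R := fun ζ => B y (along f (ζ, 0) y) (along f (η, 0) y))
    ⟨fun a b => by simp, fun c a => by simp⟩
    ⟨fun a b => by simp [lin], fun c a => by simp [lin']⟩ (fun i => ?_) ζ
  refine clm_ext_single (L := fun η => formCLM (gram f B (stdFrame n) y) _ η)
    (R := fun η => B y (along f (_, 0) y) (along f (η, 0) y))
    ⟨fun a b => by simp, fun c a => by simp⟩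
    ⟨fun a b => by simp [lin], fun c a => by simp [lin']⟩ (fun j => ?_) η
  rw [formCLM_single]; rfl

theorem formCLM_sff (f : EuclideanSpace ℝ (Fin n) × ℝ → W)
    (B : EuclideanSpace ℝ (Fin n) × ℝ → W →L[ℝ] W →L[ℝ] ℝ)
    (A : EuclideanSpace ℝ (Fin n) × ℝ → (EuclideanSpace ℝ (Fin n) × ℝ) →L[ℝ] W →L[ℝ] W)
    (ν : EuclideanSpace ℝ (Fin n) × ℝ → W) (y : EuclideanSpace ℝ (Fin n) × ℝ)
    (ζ η : EuclideanSpace ℝ (Fin n)) :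
    formCLM (sff f B A ν (stdFrame n) y) ζ η =
      B y (covD A (ζ, 0) ν y) (along f (η, 0) y) := by
  have lin : ∀ a b : EuclideanSpace ℝ (Fin n), along f (a + b, 0) y =
      along f (a, 0) y + along f (b, 0) y := fun a b => by
    simp only [along, ← map_add, Prod.mk_add_mk, add_zero]
  have lin' : ∀ (c : ℝ) (a : EuclideanSpace ℝ (Fin n)), along f (c • a, 0) y =
      c • along f (a, 0) y := fun c a => by
    simp only [along, ← map_smul, Prod.smul_mk, smul_zero]
  have mk : ∀ a b : EuclideanSpace ℝ (Fin n), ((a + b, 0) : EuclideanSpace ℝ (Fin n) × ℝ) =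
    (a, 0) + (b, 0) := fun a b => by simp
  have mk' : ∀ (c : ℝ) (a : EuclideanSpace ℝ (Fin n)),
    ((c • a, 0) : EuclideanSpace ℝ (Fin n) × ℝ) = c • (a, 0) := fun c a => by simp
  have dlin : ∀ a b : EuclideanSpace ℝ (Fin n), covD A (a + b, 0) ν y =
      covD A (a, 0) ν y + covD A (b, 0) ν y := fun a b => by
    rw [covD, mk, map_add, map_add, add_apply, covD, covD]; abel
  have dlin' : ∀ (c : ℝ) (a : EuclideanSpace ℝ (Fin n)), covD A (c • a, 0) ν y =
      c • covD A (a, 0) ν y := fun c a => by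
    rw [covD, mk', map_smul, map_smul, smul_apply, covD, smul_add]
  refine clm_ext_single (L := fun ζ => formCLM (sff f B A ν (stdFrame n) y) ζ η)
    (R := fun ζ => B y (covD A (ζ, 0) ν y) (along f (η, 0) y))
    ⟨fun a b => by simp, fun c a => by simp⟩
    ⟨fun a b => by simp [dlin], fun c a => by simp [dlin']⟩ (fun i => ?_) ζ
  refine clm_ext_single (L := fun η => formCLM (sff f B A ν (stdFrame n) y) _ η)
    (R := fun η => B y (covD A (_, 0) ν y) (along f (η, 0) y))
    ⟨fun a b => by simp, fun c a => by simp⟩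
    ⟨fun a b => by simp [lin], fun c a => by simp [lin']⟩ (fun j => ?_) η
  rw [formCLM_single]; rfl

/-- The frame whose vectors are the columns of a matrix. -/
def colFrame (Q : Matrix (Fin n) (Fin n) ℝ) (k : Fin n) : EuclideanSpace ℝ (Fin n) :=
  WithLp.toLp 2 fun j => Q j k

theorem conj_apply_eq_formCLM (M Q : Matrix (Fin n) (Fin n) ℝ) (k l : Fin n) :
    (Q.transpose * M * Q) k l = formCLM M (colFrame Q k) (colFrame Q l) := by
  rw [formCLM_apply, Matrix.mul_apply]
  simp only [Matrix.mul_apply, Matrix.transpose_apply, colFrame, Finset.sum_mul]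
  rw [Finset.sum_comm]
  exact Finset.sum_congr rfl fun i _ => Finset.sum_congr rfl fun j _ => by ring

theorem clm_apply_eq_sum {F : Type*} [NormedAddCommGroup F] [NormedSpace ℝ F]
    (L : EuclideanSpace ℝ (Fin n) × ℝ →L[ℝ] F) (u : EuclideanSpace ℝ (Fin n)) :
    L (u, 0) = ∑ i, u i • L (stdFrame n i, 0) := by
  refine clm_ext_single (L := fun u => L (u, 0)) (R := fun u => ∑ i, u i • L (stdFrame n i, 0))
    ⟨fun a b => ?_, fun c a => ?_⟩ ⟨fun a b => ?_, fun c a => ?_⟩ (fun j => ?_) u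
  · rw [← map_add, Prod.mk_add_mk, add_zero]
  · rw [← map_smul, Prod.smul_mk, smul_zero]
  · simp [add_smul, Finset.sum_add_distrib]
  · simp [mul_smul, Finset.smul_sum]
  · simp [stdFrame]

/-- The differential inequality in arbitrary coordinates. -/
theorem supersolution_coord (hW : Module.finrank ℝ W = n + 1)
    (SF : IsSpaceForm V G Γ K) (hfV : Set.MapsTo f U V)
    (S : IsFlowChart U f (fun x => G (f x)) (connAlong Γ f) K ν w)
    (hpd : ∀ y ∈ U, (gram f (fun x => G (f x)) (stdFrame n) y).PosDef)
    (htr : ∀ y ∈ U, (w y)⁻¹ = ((gram f (fun x => G (f x)) (stdFrame n) y)⁻¹ *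
      sff f (fun x => G (f x)) (connAlong Γ f) ν (stdFrame n) y).trace)
    {x : EuclideanSpace ℝ (Fin n)} {t : ℝ} (hx : (x, t) ∈ U)
    {Q : Matrix (Fin n) (Fin n) ℝ} {d : Fin n → ℝ}
    (hQg : Q.transpose * gram f (fun x => G (f x)) (stdFrame n) (x, t) * Q = 1)
    (hQh : Q.transpose * sff f (fun x => G (f x)) (connAlong Γ f) ν (stdFrame n) (x, t) * Q =
      Matrix.diagonal d)
    {i : Fin n} (hlow : ∀ k, d i ≤ d k) (h0 : 0 ≤ d i)
    {φ : EuclideanSpace ℝ (Fin n) × ℝ → ℝ} (hφ : ContDiffAt ℝ 2 φ (x, t))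
    (hφx : φ (x, t) * (w (x, t))⁻¹ = d i)
    (hle : ∀ᶠ y in 𝓝 (x, t), y.2 ≤ t → ∀ ζ : EuclideanSpace ℝ (Fin n),
      φ y * (w y)⁻¹ * formCLM (gram f (fun x => G (f x)) (stdFrame n) y) ζ ζ ≤
        formCLM (sff f (fun x => G (f x)) (connAlong Γ f) ν (stdFrame n) y) ζ ζ) :
    0 ≤ deriv (fun s => φ (x, s)) t
      - (((w (x, t))⁻¹) ^ 2)⁻¹ * ∑ a, ∑ b,
          (gram f (fun x => G (f x)) (stdFrame n) (x, t))⁻¹ a b *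
          (pderiv a (pderiv b fun z => φ (z, t)) x - ∑ c,
            christoffel (fun z => gram f (fun x => G (f x)) (stdFrame n) (z, t)) x c a b *
              pderiv c (fun z => φ (z, t)) x)
      + (((w (x, t))⁻¹) ^ 3)⁻¹ * (-2 * ∑ k,
          (∑ j, Q j k * pderiv j (fun z => φ (z, t)) x) *
          (∑ j, Q j k * pderiv j (fun z => (w (z, t))⁻¹) x)
        + 4 * (∑ j, Q j i * pderiv j (fun z => (w (z, t))⁻¹) x) *
          (∑ j, Q j i * pderiv j (fun z => φ (z, t)) x))
      + (4 * (∑ j, Q j i * pderiv j (fun z => (w (z, t))⁻¹) x) ^ 2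
        - 2 * ∑ k, (∑ j, Q j k * pderiv j (fun z => (w (z, t))⁻¹) x) ^ 2) / ((w (x, t))⁻¹) ^ 4
          * φ (x, t) := by
  obtain ⟨Gt, hGt⟩ : ∃ Gt, Gt = fun z => gram f (fun x => G (f x)) (stdFrame n) (z, t) := ⟨_, rfl⟩
  have hpre : IsOpen {z : EuclideanSpace ℝ (Fin n) | (z, t) ∈ U} :=
    S.isOpen.preimage (by fun_prop)
  have sgram : ∀ a b, ContDiffOn ℝ ∞ (fun y => gram f (fun x => G (f x)) (stdFrame n) y a b) U :=
    fun a b => S.smooth_ip (S.smooth_along _) (S.smooth_along _)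
  have CM : IsCoordMetric {z : EuclideanSpace ℝ (Fin n) | (z, t) ∈ U} Gt := by
    rw [hGt]
    refine ⟨hpre, fun a b => ?_, fun z hz a b => ?_, fun z hz => hpd _ hz⟩
    · exact (sgram a b).comp (contDiff_id.prodMk contDiff_const).contDiffOn fun z hz => hz
    · exact S.symm _ hz _ _
  -- With minus the Christoffel symbols as second derivative, the change of coordinates kills the
  -- first derivatives of the metric at `x`, without moving `x` or its frame.
  obtain ⟨q, hq⟩ : ∃ q, q = - connCLM (christoffel Gt x) := ⟨_, rfl⟩
  have hqs : ∀ u v, q u v = q v u := fun u v => by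
    rw [hq, neg_apply, neg_apply, neg_apply, neg_apply, CM.conn_symm hx]
  have S' := S.reparam SF hfV hqs x
  have hxU : (x, t) ∈ reparam q x ⁻¹' U := by
    rw [Set.mem_preimage, reparam_base]; exact hx
  have hΨ : ContinuousAt (reparam q x) (x, t) := (contDiff_reparam q x).continuous.continuousAt
  have lift : ∀ {p : EuclideanSpace ℝ (Fin n) × ℝ → Prop}, (∀ᶠ y in 𝓝 (x, t), p y) →
      ∀ᶠ y in 𝓝 (x, t), p (reparam q x y) := fun hp => hΨ.eventually (by rwa [reparam_base])
  have fd : ∀ y ∈ reparam q x ⁻¹' U, DifferentiableAt ℝ f (reparam q x y) := fun y hy =>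
    differentiableAt_of_contDiffOn S.isOpen S.smooth hy
  have νd : ∀ y ∈ reparam q x ⁻¹' U, DifferentiableAt ℝ ν (reparam q x y) := fun y hy =>
    differentiableAt_of_contDiffOn S.isOpen S.smooth_normal hy
  have gramΨ : ∀ y ∈ reparam q x ⁻¹' U, ∀ ζ η,
      G ((f ∘ reparam q x) y) (along (f ∘ reparam q x) (ζ, 0) y)
        (along (f ∘ reparam q x) (η, 0) y) =
      formCLM (gram f (fun x => G (f x)) (stdFrame n) (reparam q x y)) (ζ + q (y.1 - x) ζ)
        (η + q (y.1 - x) η) := fun y hy ζ η => by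
    rw [formCLM_gram, along_reparam hqs x (fd y hy), along_reparam hqs x (fd y hy)]; rfl
  have sffΨ : ∀ y ∈ reparam q x ⁻¹' U, ∀ ζ η,
      G ((f ∘ reparam q x) y) (covD (connAlong Γ (f ∘ reparam q x)) (ζ, 0) (ν ∘ reparam q x) y)
        (along (f ∘ reparam q x) (η, 0) y) =
      formCLM (sff f (fun x => G (f x)) (connAlong Γ f) ν (stdFrame n) (reparam q x y))
        (ζ + q (y.1 - x) ζ) (η + q (y.1 - x) η) := fun y hy ζ η => by
    rw [formCLM_sff, along_reparam hqs x (fd y hy), covD_reparam hqs x (fd y hy) (νd y hy)]; rfl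
  have R : IsAdapted (f ∘ reparam q x) (fun y => G ((f ∘ reparam q x) y))
      (connAlong Γ (f ∘ reparam q x)) (ν ∘ reparam q x) (x, t) (colFrame Q) d := by
    refine ⟨hW, fun k l => ?_, fun k l => ?_, fun k l m => ?_⟩
    · rw [gramΨ _ hxU, reparam_base]
      simp only [sub_self, map_zero, zero_apply, add_zero]
      rw [← conj_apply_eq_formCLM, hQg, Matrix.one_apply]
    · rw [sffΨ _ hxU, reparam_base]
      simp only [sub_self, map_zero, zero_apply, add_zero]
      rw [← conj_apply_eq_formCLM, hQh, Matrix.diagonal_apply]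
    · rw [fderiv_eq_of_eqOn S'.isOpen (fun y hy => gramΨ y hy (colFrame Q k) (colFrame Q l)) hxU,
        fderiv_metric_reparam hqs (B := fun y =>
          formCLM (gram f (fun x => G (f x)) (stdFrame n) y))
          (differentiableAt_of_contDiffOn S.isOpen (contDiffOn_formCLM sgram) hx)]
      have h1 := CM.compat hx (colFrame Q m) (colFrame Q k) (colFrame Q l)
      rw [hGt] at h1
      rw [h1, hq, hGt]
      simp
  -- the trace near the base point
  have htr' : ∀ᶠ y in 𝓝 (x, t), ((w ∘ reparam q x) y)⁻¹ =
      ((gram (f ∘ reparam q x) (fun y => G ((f ∘ reparam q x) y)) (colFrame Q) y)⁻¹ *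
        sff (f ∘ reparam q x) (fun y => G ((f ∘ reparam q x) y))
          (connAlong Γ (f ∘ reparam q x)) (ν ∘ reparam q x) (colFrame Q) y).trace := by
    -- The columns of `P y` are the images of the constant frame under the differential of the
    -- change of coordinates. `P` equals the invertible `Q` at the base point, so it is invertible
    -- nearby, and the trace is invariant under conjugation.
    obtain ⟨P, hP⟩ : ∃ P : EuclideanSpace ℝ (Fin n) × ℝ → Matrix (Fin n) (Fin n) ℝ,
      P = fun y => Matrix.of fun j k => (colFrame Q k + q (y.1 - x) (colFrame Q k)) j := ⟨_, rfl⟩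
    have hPc : Continuous fun y => (P y).det := by
      rw [hP]
      refine Continuous.matrix_det (continuous_matrix fun j k => ?_)
      have h1 : Continuous fun y : EuclideanSpace ℝ (Fin n) × ℝ =>
          colFrame Q k + (q.flip (colFrame Q k)) (y.1 - x) :=
        continuous_const.add ((q.flip (colFrame Q k)).continuous.comp (by fun_prop))
      exact (EuclideanSpace.proj (𝕜 := ℝ) j).continuous.comp h1
    have hP0 : (P (x, t)).det ≠ 0 := by
      have : P (x, t) = Q := by rw [hP]; ext j k; simp [colFrame]
      rw [this]
      intro h
      have := congrArg Matrix.det hQg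
      simp [h] at this
    have hcol : ∀ y k, colFrame (P y) k = colFrame Q k + q (y.1 - x) (colFrame Q k) := fun y k => by
      rw [hP]; ext j; simp [colFrame]
    filter_upwards [hPc.continuousAt.eventually_ne hP0, S'.isOpen.mem_nhds hxU] with y hy hyU
    have e1 : gram (f ∘ reparam q x) (fun y => G ((f ∘ reparam q x) y)) (colFrame Q) y =
        (P y).transpose * gram f (fun x => G (f x)) (stdFrame n) (reparam q x y) * P y := by
      ext k l
      rw [conj_apply_eq_formCLM, hcol, hcol, ← gramΨ y hyU]; rfl
    have e2 : sff (f ∘ reparam q x) (fun y => G ((f ∘ reparam q x) y))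
          (connAlong Γ (f ∘ reparam q x)) (ν ∘ reparam q x) (colFrame Q) y =
        (P y).transpose * sff f (fun x => G (f x)) (connAlong Γ f) ν (stdFrame n)
          (reparam q x y) * P y := by
      ext k l
      rw [conj_apply_eq_formCLM, hcol, hcol, ← sffΨ y hyU]; rfl
    rw [e1, e2, trace_inv_mul_conj hy.isUnit]
    exact htr _ hyU
  have hφ' : ContDiffAt ℝ 2 (φ ∘ reparam q x) (x, t) :=
    ContDiffAt.comp (x, t) (by rwa [reparam_base])
      ((contDiff_reparam q x).contDiffAt.of_le ENat.LEInfty.out)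
  have hle' : ∀ᶠ y in 𝓝 (x, t), y.2 ≤ (x, t).2 → ∀ ζ : EuclideanSpace ℝ (Fin n),
      (φ ∘ reparam q x) y * ((w ∘ reparam q x) y)⁻¹ * G ((f ∘ reparam q x) y)
        (along (f ∘ reparam q x) (ζ, 0) y) (along (f ∘ reparam q x) (ζ, 0) y) ≤
      G ((f ∘ reparam q x) y) (covD (connAlong Γ (f ∘ reparam q x)) (ζ, 0) (ν ∘ reparam q x) y)
        (along (f ∘ reparam q x) (ζ, 0) y) := by
    filter_upwards [lift hle, S'.isOpen.mem_nhds hxU] with y hy hyU hyt ζ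
    rw [gramΨ y hyU, sffΨ y hyU]
    exact hy hyt _
  have main := R.supersolution S' hxU hlow h0 htr' hφ' (by
    simpa [reparam_base] using hφx) hle'
  -- translation of the derivatives
  have hφd : DifferentiableAt ℝ φ (x, t) := hφ.differentiableAt (by simp)
  have hwd : DifferentiableAt ℝ (fun y => (w y)⁻¹) (x, t) :=
    (differentiableAt_of_contDiffOn S.isOpen S.smooth_speed hx).inv (S.speed_pos _ hx).ne'
  have first : ∀ {g : EuclideanSpace ℝ (Fin n) × ℝ → ℝ}, DifferentiableAt ℝ g (x, t) →
      ∀ ξ, fderiv ℝ (g ∘ reparam q x) (x, t) ξ = fderiv ℝ g (x, t) ξ := fun {g} hg ξ => by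
    have := along_reparam hqs x (g := g) (y := (x, t)) (by rwa [reparam_base]) ξ
    simpa [along, reparam_base] using this
  have pd : ∀ {g : EuclideanSpace ℝ (Fin n) × ℝ → ℝ}, DifferentiableAt ℝ g (x, t) →
      ∀ k, fderiv ℝ g (x, t) (colFrame Q k, 0) = ∑ j, Q j k * pderiv j (fun z => g (z, t)) x :=
    fun {g} hg k => by
      rw [clm_apply_eq_sum]
      refine Finset.sum_congr rfl fun j _ => ?_
      rw [pderiv, fderiv_slice hg]; rfl
  -- `g⁻¹ = Q Qᵀ` converts sums over the orthonormal frame into contractions with the inverse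
  -- metric.
  have hinv : (gram f (fun x => G (f x)) (stdFrame n) (x, t))⁻¹ = Q * Q.transpose := by
    refine Matrix.inv_eq_left_inv ?_
    rw [Matrix.mul_assoc]; exact mul_eq_one_comm.1 hQg
  have htime : fderiv ℝ φ (x, t) (0, 1) = deriv (fun s => φ (x, s)) t := by
    have h1 : HasDerivAt (fun s : ℝ => (x, s)) ((0 : EuclideanSpace ℝ (Fin n)), (1 : ℝ)) t :=
      (hasDerivAt_const t x).prodMk (hasDerivAt_id t)
    exact (hφd.hasFDerivAt.comp_hasDerivAt t h1).deriv.symm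
  have hlap : ∑ k, fderiv ℝ (fun y => fderiv ℝ (φ ∘ reparam q x) y (colFrame Q k, 0)) (x, t)
      (colFrame Q k, 0) = ∑ a, ∑ b,
          (gram f (fun x => G (f x)) (stdFrame n) (x, t))⁻¹ a b *
          (pderiv a (pderiv b fun z => φ (z, t)) x - ∑ c,
            christoffel (fun z => gram f (fun x => G (f x)) (stdFrame n) (z, t)) x c a b *
              pderiv c (fun z => φ (z, t)) x) := by
    have hd2 : ∀ ξ, DifferentiableAt ℝ (fun y => fderiv ℝ φ y ξ) (x, t) := fun ξ =>
      ((hφ.fderiv_right (m := 1) (by norm_num)).clm_apply contDiffAt_const).differentiableAt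
        (by simp)
    have second : ∀ a b, pderiv a (pderiv b fun z => φ (z, t)) x =
        fderiv ℝ (fun y => fderiv ℝ φ y (stdFrame n b, 0)) (x, t) (stdFrame n a, 0) := by
      intro a b
      have : pderiv b (fun z => φ (z, t)) =ᶠ[𝓝 x]
          fun z => (fun y => fderiv ℝ φ y (stdFrame n b, 0)) (z, t) := by
        have hc : ContinuousAt (fun z : EuclideanSpace ℝ (Fin n) => (z, t)) x := by fun_prop
        filter_upwards [hc.eventually (hφ.eventually (by simp))] with z hz
        exact fderiv_slice (hz.differentiableAt (by simp)) _
      rw [pderiv, this.fderiv_eq, fderiv_slice (hd2 _)]; rfl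
    have hess : ∀ k, fderiv ℝ (fun y => fderiv ℝ φ y (colFrame Q k, 0)) (x, t) (colFrame Q k, 0) =
        ∑ a, ∑ b, Q a k * Q b k * pderiv a (pderiv b fun z => φ (z, t)) x := by
      intro k
      have e : (fun y => fderiv ℝ φ y (colFrame Q k, 0)) =
          fun y => ∑ b, Q b k * fderiv ℝ φ y (stdFrame n b, 0) := by
        funext y; rw [clm_apply_eq_sum]; rfl
      rw [e, fderiv_fun_sum fun b _ => (hd2 _).const_mul _, sum_apply, Finset.sum_comm]
      refine Finset.sum_congr rfl fun b _ => ?_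
      rw [fderiv_const_mul (hd2 _), smul_apply, clm_apply_eq_sum, smul_eq_mul, Finset.mul_sum]
      refine Finset.sum_congr rfl fun a _ => ?_
      rw [second, smul_eq_mul, colFrame]; ring
    have hgamma : ∀ k, fderiv ℝ φ (x, t) (q (colFrame Q k) (colFrame Q k), 0) =
        - ∑ a, ∑ b, Q a k * Q b k * ∑ c,
            christoffel Gt x c a b * pderiv c (fun z => φ (z, t)) x := by
      intro k
      rw [clm_apply_eq_sum]
      have e : ∀ c, q (colFrame Q k) (colFrame Q k) c =
          - ∑ a, ∑ b, christoffel Gt x c a b * Q a k * Q b k := fun c => by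
        rw [hq, neg_apply, neg_apply, PiLp.neg_apply, connCLM_apply]; rfl
      simp only [e, smul_eq_mul, neg_mul, Finset.sum_neg_distrib, Finset.sum_mul, Finset.mul_sum]
      rw [Finset.sum_comm]
      congr 1
      refine Finset.sum_congr rfl fun a _ => ?_
      rw [Finset.sum_comm]
      refine Finset.sum_congr rfl fun b _ => Finset.sum_congr rfl fun c _ => ?_
      rw [pderiv, fderiv_slice hφd, stdFrame]; ring
    simp only [fderiv_fderiv_reparam hqs hφ, hess, hgamma, hinv, ← sub_eq_add_neg,
      ← Finset.sum_sub_distrib, ← mul_sub, Matrix.mul_apply, Matrix.transpose_apply,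
      Finset.sum_mul, ← hGt]
    rw [Finset.sum_comm]
    refine Finset.sum_congr rfl fun a _ => ?_
    rw [Finset.sum_comm]
  have hw1 : ∀ ξ, fderiv ℝ (fun y => ((w ∘ reparam q x) y)⁻¹) (x, t) ξ =
      fderiv ℝ (fun y => (w y)⁻¹) (x, t) ξ := first hwd
  simp only [hw1, first hφd, hlap] at main
  simp only [Function.comp_apply, reparam_base, pd hφd, pd hwd,
    htime] at main
  exact main

end CoordinateInequality

/-! ### Charts of a manifold -/

theorem clm_eq_sum_stdFrame {m : ℕ} {F : Type*} [NormedAddCommGroup F] [NormedSpace ℝ F]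
    (L : EuclideanSpace ℝ (Fin m) →L[ℝ] F) (c : EuclideanSpace ℝ (Fin m)) :
    L c = ∑ i, c i • L (stdFrame m i) :=
  clm_ext_single (L := fun c => L c) (R := fun c => ∑ i, c i • L (stdFrame m i))
    ⟨fun a b => map_add _ _ _, fun c a => map_smul _ _ _⟩
    ⟨fun a b => by simp [add_smul, Finset.sum_add_distrib],
      fun c a => by simp [mul_smul, Finset.smul_sum]⟩ (fun j => by simp [stdFrame]) c

section Charts

variable {m : ℕ} {X : Type*} [TopologicalSpace X] [ChartedSpace (EuclideanSpace ℝ (Fin m)) X]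

/-- The differential of the inverse of the chart around `x₀`. -/
def chartInv (x₀ : X) (z : EuclideanSpace ℝ (Fin m)) :
    EuclideanSpace ℝ (Fin m) →L[ℝ] EuclideanSpace ℝ (Fin m) :=
  mfderiv (𝓡 m) (𝓡 m) (extChartAt (𝓡 m) x₀).symm z

theorem chartInv_eq_sum (x₀ : X) (z c : EuclideanSpace ℝ (Fin m)) :
    chartInv x₀ z c = (∑ i, c i • (coordVec x₀ z i : EuclideanSpace ℝ (Fin m)) :
      EuclideanSpace ℝ (Fin m)) :=
  clm_eq_sum_stdFrame (chartInv x₀ z) c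

theorem formCLM_coeff {b : ∀ x : X, TangentSpace (𝓡 m) x → TangentSpace (𝓡 m) x → ℝ}
    (hl : ∀ x v, IsLinearMap ℝ fun u => b x u v) (hr : ∀ x u, IsLinearMap ℝ fun v => b x u v)
    (x₀ : X) (z u v : EuclideanSpace ℝ (Fin m)) :
    formCLM (coeff b x₀ z) u v =
      b ((extChartAt (𝓡 m) x₀).symm z) (chartInv x₀ z u) (chartInv x₀ z v) := by
  refine clm_ext_single (L := fun u => formCLM (coeff b x₀ z) u v)
    (R := fun u => b ((extChartAt (𝓡 m) x₀).symm z) (chartInv x₀ z u) (chartInv x₀ z v))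
    ⟨fun a b => by simp, fun c a => by simp⟩
    ⟨fun a c => ?_, fun c a => ?_⟩ (fun i => ?_) u
  · rw [map_add]; exact (hl _ _).map_add _ _
  · rw [map_smul]; exact (hl _ _).map_smul _ _
  refine clm_ext_single (L := fun v => formCLM (coeff b x₀ z) _ v)
    (R := fun v => b ((extChartAt (𝓡 m) x₀).symm z) (chartInv x₀ z _) (chartInv x₀ z v))
    ⟨fun a b => by simp, fun c a => by simp⟩
    ⟨fun a c => ?_, fun c a => ?_⟩ (fun j => ?_) v
  · rw [map_add]; exact (hr _ _).map_add _ _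
  · rw [map_smul]; exact (hr _ _).map_smul _ _
  · rw [formCLM_single]; rfl

variable [IsManifold (𝓡 m) ∞ X]

theorem mdifferentiableAt_chart_symm {x₀ : X} {z : EuclideanSpace ℝ (Fin m)}
    (hz : z ∈ (extChartAt (𝓡 m) x₀).target) :
    MDifferentiableAt (𝓡 m) (𝓡 m) (extChartAt (𝓡 m) x₀).symm z :=
  ((contMDiffOn_extChartAt_symm (n := ∞) x₀).contMDiffAt
    ((isOpen_extChartAt_target x₀).mem_nhds hz)).mdifferentiableAt (by simp)

theorem chartInv_isInvertible {x₀ : X} {z : EuclideanSpace ℝ (Fin m)}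
    (hz : z ∈ (extChartAt (𝓡 m) x₀).target) : (chartInv x₀ z).IsInvertible := by
  have : IsManifold (𝓡 m) 1 X := IsManifold.of_le (n := ∞) (by simp)
  have h := isInvertible_mfderivWithin_extChartAt_symm (I := 𝓡 m) hz
  rw [modelWithCornersSelf_coe, Set.range_id, mfderivWithin_univ] at h
  exact h

/-- The differential of a map is the differential of its expression in charts. -/
theorem mfderiv_chartInv {k : ℕ} {Y : Type*} [TopologicalSpace Y]
    [ChartedSpace (EuclideanSpace ℝ (Fin k)) Y] [IsManifold (𝓡 k) ∞ Y]
    {h : X → Y} {x₀ : X} {y₀ : Y} {x : EuclideanSpace ℝ (Fin m)}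
    (hx : x ∈ (extChartAt (𝓡 m) x₀).target)
    (hy : h ((extChartAt (𝓡 m) x₀).symm x) ∈ (extChartAt (𝓡 k) y₀).source)
    (hd : MDifferentiableAt (𝓡 m) (𝓡 k) h ((extChartAt (𝓡 m) x₀).symm x))
    (ξ : EuclideanSpace ℝ (Fin m)) :
    mfderiv (𝓡 m) (𝓡 k) h ((extChartAt (𝓡 m) x₀).symm x) (chartInv x₀ x ξ) =
      chartInv y₀ (extChartAt (𝓡 k) y₀ (h ((extChartAt (𝓡 m) x₀).symm x)))
        (fderiv ℝ (fun x => extChartAt (𝓡 k) y₀ (h ((extChartAt (𝓡 m) x₀).symm x))) x ξ) := by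
  have h1 := mdifferentiableAt_chart_symm hx
  have h2 := hd.comp x h1
  have hy' := (extChartAt (𝓡 k) y₀).map_source hy
  have h3 : MDifferentiableAt (𝓡 m) (𝓡 k)
      (fun x => extChartAt (𝓡 k) y₀ (h ((extChartAt (𝓡 m) x₀).symm x))) x :=
    MDifferentiableAt.comp (g := extChartAt (𝓡 k) y₀) x
      (mdifferentiableAt_extChartAt (by rwa [extChartAt_source] at hy)) h2
  have h4 : (h ∘ (extChartAt (𝓡 m) x₀).symm) =ᶠ[𝓝 x] (extChartAt (𝓡 k) y₀).symm ∘
      (fun x => extChartAt (𝓡 k) y₀ (h ((extChartAt (𝓡 m) x₀).symm x))) := by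
    filter_upwards [h2.continuousAt.preimage_mem_nhds (extChartAt_source_mem_nhds' hy)] with z hz
    exact ((extChartAt (𝓡 k) y₀).left_inv hz).symm
  have e1 := mfderiv_comp x hd h1
  have e2 := mfderiv_comp x (mdifferentiableAt_chart_symm hy') h3
  rw [h4.mfderiv_eq, e2, mfderiv_eq_fderiv] at e1
  exact (DFunLike.congr_fun e1 ξ).symm

end Charts

/-! ### The ambient metric in a chart. -/

section Ambient

variable {n : ℕ} {N : Type*} [TopologicalSpace N] [ChartedSpace (EuclideanSpace ℝ (Fin (n + 1))) N]
  [IsManifold (𝓡 (n + 1)) ∞ N] (g : SmoothMetric (n + 1) N)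

theorem form_congr {y y' : N} (h : y = y') (v w : EuclideanSpace ℝ (Fin (n + 1))) :
    form g y v w = form g y' v w := by subst h; rfl

theorem form_symm (y : N) (v w : TangentSpace (𝓡 (n + 1)) y) : form g y v w = form g y w v :=
  g.symm y v w

theorem form_isLinearMap_left (y : N) (w : TangentSpace (𝓡 (n + 1)) y) :
    IsLinearMap ℝ fun v => form g y v w :=
  ⟨fun a b => by simp [form], fun c a => by simp [form]⟩

theorem form_isLinearMap_right (y : N) (v : TangentSpace (𝓡 (n + 1)) y) :
    IsLinearMap ℝ fun w => form g y v w :=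
  ⟨fun a b => by simp [form], fun c a => by simp [form]⟩

theorem form_pos (y : N) {v : TangentSpace (𝓡 (n + 1)) y} (hv : v ≠ 0) : 0 < form g y v v :=
  g.pos y v hv

/-- A coordinate field is the tangent map of the inverse chart applied to a constant field. -/
theorem contMDiffOn_coordVec (y₀ : N) (i : Fin (n + 1)) :
    ContMDiffOn (𝓡 (n + 1)) (𝓡 (n + 1)).tangent ∞ (fun z => (⟨_, coordVec y₀ z i⟩ :
      TangentBundle (𝓡 (n + 1)) N)) (extChartAt (𝓡 (n + 1)) y₀).target := by
  have hopen := isOpen_extChartAt_target (I := 𝓡 (n + 1)) y₀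
  have h1 := (contMDiffOn_extChartAt_symm (I := 𝓡 (n + 1)) (n := ∞)
    y₀).contMDiffOn_tangentMapWithin (m := ∞) (by simp) hopen.uniqueMDiffOn
  have h2 : ContMDiffOn (𝓡 (n + 1)) (𝓡 (n + 1)).tangent ∞
      (fun z => (⟨z, stdFrame (n + 1) i⟩ : TangentBundle (𝓡 (n + 1))
          (EuclideanSpace ℝ (Fin (n+1)))))
      (extChartAt (𝓡 (n + 1)) y₀).target := fun z hz =>
    contMDiffWithinAt_vectorSpace_iff_contDiffWithinAt.2 contDiffWithinAt_const
  refine (h1.comp h2 fun z hz => hz).congr fun z hz => ?_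
  simp only [Function.comp_apply, tangentMapWithin]
  rw [mfderivWithin_of_isOpen hopen hz]
  rfl

theorem contDiffOn_coeff_form (y₀ : N) (i j : Fin (n + 1)) :
    ContDiffOn ℝ ∞ (fun z => coeff (form g) y₀ z i j) (extChartAt (𝓡 (n + 1)) y₀).target := by
  have : IsManifold (𝓡 (n + 1)) 1 N := IsManifold.of_le (n := ∞) (by simp)
  have h1 := contMDiffOn_coordVec y₀ i
  have h2 := contMDiffOn_coordVec y₀ j
  have hg := g.contMDiff.comp_contMDiffOn
    (contMDiffOn_extChartAt_symm (I := 𝓡 (n + 1)) (n := ∞) y₀)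
  have h3 := ContMDiffOn.clm_bundle_apply₂ (F₁ := EuclideanSpace ℝ (Fin (n + 1)))
    (F₂ := EuclideanSpace ℝ (Fin (n + 1))) (F₃ := ℝ) (E₁ := fun x : N => TangentSpace (𝓡 (n + 1)) x)
    (E₂ := fun x : N => TangentSpace (𝓡 (n + 1)) x)
    (E₃ := Bundle.Trivial N ℝ) hg h1 h2
  intro z hz
  have h4 := h3 z hz
  simp only [Bundle.contMDiffWithinAt_totalSpace] at h4
  exact h4.2.contDiffWithinAt

/-- The metric in a chart, as a field of bilinear forms. -/
def chartForm (y₀ : N) (y : EuclideanSpace ℝ (Fin (n + 1))) :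
    EuclideanSpace ℝ (Fin (n + 1)) →L[ℝ] EuclideanSpace ℝ (Fin (n + 1)) →L[ℝ] ℝ :=
  formCLM (coeff (form g) y₀ y)

/-- The Levi-Civita connection in a chart. -/
def chartConn (y₀ : N) (y : EuclideanSpace ℝ (Fin (n + 1))) :
    EuclideanSpace ℝ (Fin (n + 1)) →L[ℝ] EuclideanSpace ℝ (Fin (n + 1)) →L[ℝ]
      EuclideanSpace ℝ (Fin (n + 1)) :=
  connCLM (christoffel (coeff (form g) y₀) y)

theorem chartForm_apply (y₀ : N) (y u v : EuclideanSpace ℝ (Fin (n + 1))) :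
    chartForm g y₀ y u v =
      form g ((extChartAt (𝓡 (n + 1)) y₀).symm y) (chartInv y₀ y u) (chartInv y₀ y v) :=
  formCLM_coeff (form_isLinearMap_left g) (form_isLinearMap_right g) y₀ y u v

theorem chartInv_injective {m : ℕ} {X : Type*} [TopologicalSpace X]
    [ChartedSpace (EuclideanSpace ℝ (Fin m)) X] [IsManifold (𝓡 m) ∞ X] {x₀ : X}
    {z : EuclideanSpace ℝ (Fin m)} (hz : z ∈ (extChartAt (𝓡 m) x₀).target) :
    Function.Injective (chartInv x₀ z) :=
  (chartInv_isInvertible hz).injective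

theorem posDef_of_formCLM {m : ℕ} {A : Matrix (Fin m) (Fin m) ℝ} (hs : ∀ i j, A i j = A j i)
    (hp : ∀ u : EuclideanSpace ℝ (Fin m), u ≠ 0 → 0 < formCLM A u u) : A.PosDef := by
  refine Matrix.PosDef.of_dotProduct_mulVec_pos (Matrix.IsHermitian.ext fun i j => ?_) fun v hv =>
      ?_
  · simp [hs i j]
  · have := hp (WithLp.toLp 2 v) (by simpa using hv)
    rw [formCLM_eq_dotProduct] at this
    simpa using this

/-- Positivity survives because the differential of the inverse chart is injective. -/
theorem isCoordMetric_coeff_form (y₀ : N) :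
    IsCoordMetric (extChartAt (𝓡 (n + 1)) y₀).target (coeff (form g) y₀) where
  isOpen := isOpen_extChartAt_target y₀
  smooth := contDiffOn_coeff_form g y₀
  symm y _ i j := form_symm g _ _ _
  posDef y hy := by
    refine posDef_of_formCLM (fun i j => form_symm g _ _ _) fun u hu => ?_
    have h := chartForm_apply g y₀ y u u
    rw [chartForm] at h
    rw [h]
    refine form_pos g _ fun h0 => hu (chartInv_injective hy ?_)
    rw [map_zero]; exact h0

theorem isSpaceForm_chart {K : ℝ} (hK : HasConstantSectionalCurvature (form g) K) (y₀ : N) :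
    IsSpaceForm (extChartAt (𝓡 (n + 1)) y₀).target (chartForm g y₀) (chartConn g y₀) K :=
  (isCoordMetric_coeff_form g y₀).isSpaceForm (hK y₀)

end Ambient

/-! ### The flow in charts -/

section FlowInCharts

variable {n : ℕ}
  {M : Type*} [TopologicalSpace M] [ChartedSpace (EuclideanSpace ℝ (Fin n)) M]
  {N : Type*} [TopologicalSpace N] [ChartedSpace (EuclideanSpace ℝ (Fin (n + 1))) N]

/-- The map of the flow in charts around `p` and `y₀`. -/
def flowMap (F : M → ℝ → N) (p : M) (y₀ : N) (z : EuclideanSpace ℝ (Fin n) × ℝ) :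
    EuclideanSpace ℝ (Fin (n + 1)) :=
  extChartAt (𝓡 (n + 1)) y₀ (F ((extChartAt (𝓡 n) p).symm z.1) z.2)

/-- The domain of the flow in charts. -/
def flowDomain (F : M → ℝ → N) (J : Set ℝ) (p : M) (y₀ : N) : Set (EuclideanSpace ℝ (Fin n) × ℝ) :=
  ((extChartAt (𝓡 n) p).target ×ˢ J) ∩
    (fun z => F ((extChartAt (𝓡 n) p).symm z.1) z.2) ⁻¹' (extChartAt (𝓡 (n + 1)) y₀).source

theorem contDiffAt_of_contMDiffAt_prod {E E' F : Type*} [NormedAddCommGroup E] [NormedSpace ℝ E]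
    [NormedAddCommGroup E'] [NormedSpace ℝ E'] [NormedAddCommGroup F] [NormedSpace ℝ F]
    {r : WithTop ℕ∞} {f : E × E' → F} {z : E × E'}
    (h : ContMDiffAt (𝓘(ℝ, E).prod 𝓘(ℝ, E')) 𝓘(ℝ, F) r f z) : ContDiffAt ℝ r f z := by
  rw [← modelWithCornersSelf_prod] at h
  exact contMDiffAt_iff_contDiffAt.1 (by rw [chartedSpaceSelf_prod] at h; exact h)

variable [IsManifold (𝓡 n) ∞ M] [IsManifold (𝓡 (n + 1)) ∞ N]

variable {F : M → ℝ → N} {J : Set ℝ} (hJ : IsOpen J)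
  (hF : ContMDiffOn ((𝓡 n).prod 𝓘(ℝ, ℝ)) (𝓡 (n + 1)) ∞ (fun z : M × ℝ => F z.1 z.2) (Set.univ ×ˢ J))
include hF

omit [IsManifold (𝓡 (n + 1)) ∞ N] in
theorem contMDiffOn_chart_flow (p : M) :
    ContMDiffOn ((𝓡 n).prod 𝓘(ℝ, ℝ)) (𝓡 (n + 1)) ∞
      (fun z : EuclideanSpace ℝ (Fin n) × ℝ => F ((extChartAt (𝓡 n) p).symm z.1) z.2)
      ((extChartAt (𝓡 n) p).target ×ˢ J) := by
  have h1 : ContMDiffOn ((𝓡 n).prod 𝓘(ℝ, ℝ)) ((𝓡 n).prod 𝓘(ℝ, ℝ)) ∞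
      (fun z : EuclideanSpace ℝ (Fin n) × ℝ => ((extChartAt (𝓡 n) p).symm z.1, z.2))
      ((extChartAt (𝓡 n) p).target ×ˢ J) :=
    ((contMDiffOn_extChartAt_symm (n := ∞) p).comp contMDiffOn_fst fun z hz => hz.1).prodMk
      contMDiffOn_snd
  exact hF.comp h1 fun z hz => ⟨trivial, hz.2⟩

include hJ

omit [IsManifold (𝓡 (n + 1)) ∞ N] in
theorem isOpen_flowDomain (p : M) (y₀ : N) : IsOpen (flowDomain (n := n) F J p y₀) :=
  (contMDiffOn_chart_flow hF p).continuousOn.isOpen_inter_preimage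
    ((isOpen_extChartAt_target p).prod hJ) (isOpen_extChartAt_source y₀)

theorem contDiffOn_flowMap (p : M) (y₀ : N) :
    ContDiffOn ℝ ∞ (flowMap F p y₀) (flowDomain (n := n) F J p y₀) :=
  fun z hz => (contDiffAt_of_contMDiffAt_prod <|
    ((contMDiffOn_extChartAt (I := 𝓡 (n + 1)) (n := ∞) (x := y₀)).comp
      ((contMDiffOn_chart_flow hF p).mono Set.inter_subset_left)
      fun z hz => by simpa using hz.2).contMDiffAt
      ((isOpen_flowDomain hJ hF p y₀).mem_nhds hz)).contDiffWithinAt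

omit [IsManifold (𝓡 n) ∞ M] [IsManifold (𝓡 (n + 1)) ∞ N] in
theorem mdifferentiableAt_flow_space (q : M) {s : ℝ} (hs : s ∈ J) :
    MDifferentiableAt (𝓡 n) (𝓡 (n + 1)) (fun q => F q s) q := by
  have h := (hF.contMDiffAt (x := (q, s)) (prod_mem_nhds Filter.univ_mem (hJ.mem_nhds hs))).comp q
    (contMDiffAt_id.prodMk (contMDiffAt_const (c := s)))
  exact h.mdifferentiableAt (by simp)

variable {p : M} {y₀ : N} {z : EuclideanSpace ℝ (Fin n) × ℝ} (hz : z ∈ flowDomain (n := n) F J p y₀)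
include hz

theorem dF_chartInv (ξ : EuclideanSpace ℝ (Fin n)) :
    dF F z.2 ((extChartAt (𝓡 n) p).symm z.1) (chartInv p z.1 ξ) =
      chartInv y₀ (flowMap F p y₀ z) (along (flowMap F p y₀) (ξ, 0) z) := by
  have h := mfderiv_chartInv (h := fun q => F q z.2) (y₀ := y₀) hz.1.1 hz.2
    (mdifferentiableAt_flow_space hJ hF _ hz.1.2) ξ
  have hd := differentiableAt_of_contDiffOn (isOpen_flowDomain hJ hF p y₀)
    (contDiffOn_flowMap hJ hF p y₀) hz
  refine h.trans (congrArg _ ?_)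
  exact fderiv_slice (x := z.1) (t := z.2) hd ξ

theorem velocity_chart :
    velocity (n := n) F ((extChartAt (𝓡 n) p).symm z.1) z.2 =
      chartInv y₀ (flowMap F p y₀ z) (along (flowMap F p y₀) (0, 1) z) := by
  have hopen := isOpen_flowDomain hJ hF p y₀
  have hd := differentiableAt_of_contDiffOn hopen (contDiffOn_flowMap hJ hF p y₀) hz
  have h1 : HasFDerivAt (fun s => flowMap F p y₀ (z.1, s))
      ((fderiv ℝ (flowMap F p y₀) z).comp (ContinuousLinearMap.inr ℝ _ ℝ)) z.2 :=
    HasFDerivAt.comp (g := flowMap F p y₀) (f := fun s => (z.1, s)) z.2 hd.hasFDerivAt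
      (hasFDerivAt_prodMk_right z.1 z.2)
  have hc : Continuous fun s : ℝ => (z.1, s) := by fun_prop
  have h4 : (fun s => F ((extChartAt (𝓡 n) p).symm z.1) s) =ᶠ[𝓝 z.2]
      (extChartAt (𝓡 (n + 1)) y₀).symm ∘ fun s => flowMap F p y₀ (z.1, s) := by
    filter_upwards [hc.continuousAt.preimage_mem_nhds (hopen.mem_nhds hz)] with s hs
    exact ((extChartAt (𝓡 (n + 1)) y₀).left_inv hs.2).symm
  have e2 := mfderiv_comp (I := 𝓘(ℝ, ℝ)) (I' := 𝓡 (n + 1)) (I'' := 𝓡 (n + 1)) z.2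
    (mdifferentiableAt_chart_symm ((extChartAt (𝓡 (n + 1)) y₀).map_source hz.2))
    h1.differentiableAt.mdifferentiableAt
  have e1 := h4.mfderiv_eq (I := 𝓘(ℝ, ℝ)) (I' := 𝓡 (n + 1))
  rw [e2, mfderiv_eq_fderiv, h1.fderiv] at e1
  exact DFunLike.congr_fun e1 (1 : ℝ)

end FlowInCharts

/-! ### Speed, normal and induced metric of the flow in charts. -/

section FlowChartOfFlow

variable {n : ℕ}
  {M : Type*} [TopologicalSpace M] [ChartedSpace (EuclideanSpace ℝ (Fin n)) M]
  {N : Type*} [TopologicalSpace N] [ChartedSpace (EuclideanSpace ℝ (Fin (n + 1))) N]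
  [IsManifold (𝓡 (n + 1)) ∞ N]
  (g : SmoothMetric (n + 1) N)

theorem inducedMetric_isLinearMap_left (F : M → ℝ → N) (t : ℝ) (p : M) (w : TangentSpace (𝓡 n) p) :
    IsLinearMap ℝ fun v => inducedMetric g F t p v w :=
  ⟨fun a b => by simp [inducedMetric, dF, form], fun c a => by simp [inducedMetric, dF, form]⟩

theorem inducedMetric_isLinearMap_right (F : M → ℝ → N) (t : ℝ) (p : M)
    (v : TangentSpace (𝓡 n) p) : IsLinearMap ℝ fun w => inducedMetric g F t p v w :=
  ⟨fun a b => by simp [inducedMetric, dF, form], fun c a => by simp [inducedMetric, dF, form]⟩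

theorem inducedMetric_congr (F : M → ℝ → N) (t : ℝ) {p p' : M} (h : p = p')
    (v w : EuclideanSpace ℝ (Fin n)) :
    inducedMetric g F t p v w = inducedMetric g F t p' v w := by subst h; rfl

/-- The metric of the ambient space along the flow, in charts. -/
def flowForm (F : M → ℝ → N) (p : M) (y₀ : N) (z : EuclideanSpace ℝ (Fin n) × ℝ) :
    EuclideanSpace ℝ (Fin (n + 1)) →L[ℝ] EuclideanSpace ℝ (Fin (n + 1)) →L[ℝ] ℝ :=
  chartForm g y₀ (flowMap F p y₀ z)

/-- The speed of the flow in charts. -/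
def flowSpeed (F : M → ℝ → N) (p : M) (y₀ : N) (z : EuclideanSpace ℝ (Fin n) × ℝ) : ℝ :=
  Real.sqrt (flowForm g F p y₀ z (along (flowMap F p y₀) (0, 1) z)
    (along (flowMap F p y₀) (0, 1) z))

/-- The unit normal field of the flow in charts. -/
def flowNormal (F : M → ℝ → N) (p : M) (y₀ : N) (z : EuclideanSpace ℝ (Fin n) × ℝ) :
    EuclideanSpace ℝ (Fin (n + 1)) :=
  (flowSpeed g F p y₀ z)⁻¹ • along (flowMap F p y₀) (0, 1) z

variable [IsManifold (𝓡 n) ∞ M] {g} {J : Set ℝ} {F : M → ℝ → N}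
  {ν : ∀ (p : M) (t : ℝ), TangentSpace (𝓡 (n + 1)) (F p t)} {p : M} {y₀ : N}

omit [IsManifold (𝓡 n) ∞ M] in
theorem flowForm_apply {z : EuclideanSpace ℝ (Fin n) × ℝ} (hz : z ∈ flowDomain (n := n) F J p y₀)
    (u v : EuclideanSpace ℝ (Fin (n + 1))) :
    flowForm g F p y₀ z u v = form g (F ((extChartAt (𝓡 n) p).symm z.1) z.2)
      (chartInv y₀ (flowMap F p y₀ z) u) (chartInv y₀ (flowMap F p y₀ z) v) := by
  rw [flowForm, chartForm_apply]
  exact form_congr g ((extChartAt (𝓡 (n + 1)) y₀).left_inv hz.2) _ _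

variable (hJ : IsOpen J) (hF : IsSmoothIMCF g J F ν)
include hJ hF

variable {z : EuclideanSpace ℝ (Fin n) × ℝ} (hz : z ∈ flowDomain (n := n) F J p y₀)
include hz

theorem flowForm_along (ξ η : EuclideanSpace ℝ (Fin n)) :
    flowForm g F p y₀ z (along (flowMap F p y₀) (ξ, 0) z) (along (flowMap F p y₀) (η, 0) z) =
      inducedMetric g F z.2 ((extChartAt (𝓡 n) p).symm z.1)
        (chartInv p z.1 ξ) (chartInv p z.1 η) := by
  rw [flowForm_apply hz, ← dF_chartInv hJ hF.smooth hz, ← dF_chartInv hJ hF.smooth hz]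
  rfl

theorem coeff_inducedMetric :
    coeff (inducedMetric g F z.2) p z.1 =
      gram (flowMap F p y₀) (flowForm g F p y₀) (stdFrame n) z := by
  ext i j
  exact (flowForm_along hJ hF hz _ _).symm

theorem flowForm_velocity :
    flowForm g F p y₀ z (along (flowMap F p y₀) (0, 1) z) (along (flowMap F p y₀) (0, 1) z) =
      ((meanCurvature g F ν ((extChartAt (𝓡 n) p).symm z.1) z.2)⁻¹) ^ 2 := by
  rw [flowForm_apply hz, ← velocity_chart hJ hF.smooth hz, hF.flow _ _ hz.1.2]
  have h := hF.unit ((extChartAt (𝓡 n) p).symm z.1) z.2 hz.1.2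
  rw [(form_isLinearMap_left g _ _).map_smul, (form_isLinearMap_right g _ _).map_smul, h]
  simp [pow_two]

/-- The flow equation and `|ν| = 1` give `|∂_t F|² = H⁻²`, and `H > 0` selects the root. -/
theorem flowSpeed_eq : flowSpeed g F p y₀ z =
    (meanCurvature g F ν ((extChartAt (𝓡 n) p).symm z.1) z.2)⁻¹ := by
  rw [flowSpeed, flowForm_velocity hJ hF hz]
  exact Real.sqrt_sq (inv_nonneg.2 (hF.meanConvex _ _ hz.1.2).le)

theorem flowSpeed_pos : 0 < flowSpeed g F p y₀ z := by
  rw [flowSpeed_eq hJ hF hz]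
  exact inv_pos.2 (hF.meanConvex _ _ hz.1.2)

theorem chartInv_flowNormal : chartInv y₀ (flowMap F p y₀ z) (flowNormal g F p y₀ z) =
    ν ((extChartAt (𝓡 n) p).symm z.1) z.2 := by
  have h := hF.meanConvex ((extChartAt (𝓡 n) p).symm z.1) z.2 hz.1.2
  have e := velocity_chart hJ hF.smooth hz
  rw [hF.flow _ _ hz.1.2] at e
  rw [flowNormal, map_smul, ← e, flowSpeed_eq hJ hF hz, inv_inv]
  exact smul_inv_smul₀ h.ne' _

theorem posDef_gram : (gram (flowMap F p y₀) (flowForm g F p y₀) (stdFrame n) z).PosDef := by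
  rw [← coeff_inducedMetric hJ hF hz]
  refine posDef_of_formCLM (fun i j => form_symm g _ _ _) fun u hu => ?_
  rw [formCLM_coeff (inducedMetric_isLinearMap_left g F _) (inducedMetric_isLinearMap_right g F _)]
  refine form_pos g _ fun h0 => hu (chartInv_injective hz.1.1 ?_)
  rw [map_zero]
  refine hF.immersion _ _ hz.1.2 (h0.trans ?_)
  exact (map_zero (mfderiv (𝓡 n) (𝓡 (n + 1)) (fun q => F q z.2) _)).symm

-- No regularity of `ν` is assumed. Smoothness of the normal and of the speed comes from that of
-- `∂_t F`, whose length never vanishes.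
omit hz in
theorem isFlowChart {K : ℝ} (hK : HasConstantSectionalCurvature (form g) K) (p : M) (y₀ : N) :
    IsFlowChart (flowDomain (n := n) F J p y₀) (flowMap F p y₀) (flowForm g F p y₀)
      (connAlong (chartConn g y₀) (flowMap F p y₀)) K (flowNormal g F p y₀)
      (flowSpeed g F p y₀) := by
  have S : IsSpaceFormMap (flowDomain (n := n) F J p y₀) (flowMap F p y₀) (flowForm g F p y₀)
      (connAlong (chartConn g y₀) (flowMap F p y₀)) K :=
    (isSpaceForm_chart g hK y₀).pullback (isOpen_flowDomain hJ hF.smooth p y₀)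
      (contDiffOn_flowMap hJ hF.smooth p y₀)
      fun z hz => (extChartAt (𝓡 (n + 1)) y₀).map_source hz.2
  have hw : ContDiffOn ℝ ∞ (flowSpeed g F p y₀) (flowDomain (n := n) F J p y₀) :=
    (S.smooth_ip (S.smooth_along (0, 1)) (S.smooth_along (0, 1))).sqrt fun z hz => by
      rw [flowForm_velocity hJ hF hz]
      exact pow_ne_zero 2 (inv_ne_zero (hF.meanConvex _ _ hz.1.2).ne')
  have hsq : ∀ z ∈ flowDomain (n := n) F J p y₀,
    flowForm g F p y₀ z (along (flowMap F p y₀) (0, 1) z) (along (flowMap F p y₀) (0, 1) z) =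
      flowSpeed g F p y₀ z ^ 2 := fun z hz => by
    rw [flowForm_velocity hJ hF hz, flowSpeed_eq hJ hF hz]
  refine ⟨S, (hw.inv fun z hz => (flowSpeed_pos hJ hF hz).ne').smul (S.smooth_along (0, 1)), hw,
    fun z hz => flowSpeed_pos hJ hF hz, fun z hz => ?_, fun z hz ξ => ?_, fun z hz => ?_⟩
  · have := (flowSpeed_pos hJ hF hz).ne'
    rw [flowNormal, map_smul, map_smul, smul_apply, hsq z hz]
    simp only [smul_eq_mul]
    field_simp
  · rw [flowForm_apply hz, chartInv_flowNormal hJ hF hz, ← dF_chartInv hJ hF.smooth hz]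
    exact hF.normal _ _ hz.1.2 _
  · exact (smul_inv_smul₀ (flowSpeed_pos hJ hF hz).ne' _).symm

end FlowChartOfFlow

/-! ### The second fundamental form in the chart at a point and in a fixed chart. -/

section SecondFundamentalForm

variable {n : ℕ}
  {M : Type*} [TopologicalSpace M] [ChartedSpace (EuclideanSpace ℝ (Fin n)) M]
  {N : Type*} [TopologicalSpace N] [ChartedSpace (EuclideanSpace ℝ (Fin (n + 1))) N]
  [IsManifold (𝓡 (n + 1)) ∞ N]
  (g : SmoothMetric (n + 1) N)

/-- The second fundamental form of the flow in charts. -/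
def flowSff (F : M → ℝ → N) (p : M) (y₀ : N) (z : EuclideanSpace ℝ (Fin n) × ℝ) :
    Matrix (Fin n) (Fin n) ℝ :=
  sff (flowMap F p y₀) (flowForm g F p y₀) (connAlong (chartConn g y₀) (flowMap F p y₀))
    (flowNormal g F p y₀) (stdFrame n) z

/-- The induced metric of the flow in charts. -/
def flowGram (F : M → ℝ → N) (p : M) (y₀ : N) (z : EuclideanSpace ℝ (Fin n) × ℝ) :
    Matrix (Fin n) (Fin n) ℝ :=
  gram (flowMap F p y₀) (flowForm g F p y₀) (stdFrame n) z

variable [IsManifold (𝓡 n) ∞ M] {g} {J : Set ℝ} {F : M → ℝ → N}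
  {ν : ∀ (p : M) (t : ℝ), TangentSpace (𝓡 (n + 1)) (F p t)}

omit [IsManifold (𝓡 (n + 1)) ∞ N] [IsManifold (𝓡 n) ∞ M] in
theorem base_mem_flowDomain (p : M) {t : ℝ} (ht : t ∈ J) :
    (extChartAt (𝓡 n) p p, t) ∈ flowDomain (n := n) F J p (F p t) := by
  refine ⟨⟨mem_extChartAt_target p, ht⟩, ?_⟩
  simp only [Set.mem_preimage, extChartAt_to_inv]
  exact mem_extChartAt_source _

variable (hJ : IsOpen J) (hF : IsSmoothIMCF g J F ν) {K : ℝ}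
  (hK : HasConstantSectionalCurvature (form g) K)
include hJ hF hK

theorem flowSff_symm {p : M} {y₀ : N} {z : EuclideanSpace ℝ (Fin n) × ℝ}
    (hz : z ∈ flowDomain (n := n) F J p y₀) (i j : Fin n) :
    flowSff g F p y₀ z i j = flowSff g F p y₀ z j i :=
  (isFlowChart hJ hF hK p y₀).ip_covD_normal_symm hz _ _

/-- The coordinate formula `∂_i∂_j F^a + Γ^a_bc ∂_i F^b ∂_j F^c` is the covariant derivative of `∂_j
F` along the map, read in the charts centred at the point and at its image. -/
theorem ambientHessian_eq (p : M) {t : ℝ} (ht : t ∈ J) (i j : Fin n) :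
    ambientHessian g F p t i j = chartInv (F p t) (extChartAt (𝓡 (n + 1)) (F p t) (F p t))
      (covD (connAlong (chartConn g (F p t)) (flowMap F p (F p t))) (stdFrame n i, 0)
        (along (flowMap F p (F p t)) (stdFrame n j, 0)) (extChartAt (𝓡 n) p p, t)) := by
  have S := isFlowChart hJ hF hK p (F p t)
  have hz := base_mem_flowDomain (n := n) (F := F) p ht
  have e0 : flowMap F p (F p t) (extChartAt (𝓡 n) p p, t) =
      extChartAt (𝓡 (n + 1)) (F p t) (F p t) := by
    simp only [flowMap, extChartAt_to_inv]
  have first : ∀ z ∈ flowDomain (n := n) F J p (F p t), ∀ k a,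
      pderiv k (fun x' => flowMap F p (F p t) (x', z.2) a) z.1 =
        along (flowMap F p (F p t)) (stdFrame n k, 0) z a := by
    intro z hz k a
    have hd := differentiableAt_of_contDiffOn S.isOpen S.smooth hz
    have h1 := (EuclideanSpace.proj (𝕜 := ℝ) a).hasFDerivAt.comp z.1
      (hasFDerivAt_slice (x := z.1) (t := z.2) hd)
    exact congrArg (fun L => L (EuclideanSpace.single k 1)) h1.fderiv
  have second : ∀ a, pderiv i (pderiv j fun x' => flowMap F p (F p t) (x', t) a)
      (extChartAt (𝓡 n) p p) = fderiv ℝ (along (flowMap F p (F p t)) (stdFrame n j, 0))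
        (extChartAt (𝓡 n) p p, t) (stdFrame n i, 0) a := by
    intro a
    have hd := differentiableAt_of_contDiffOn S.isOpen (S.smooth_along (stdFrame n j, 0)) hz
    have hc : ContinuousAt (fun x : EuclideanSpace ℝ (Fin n) => (x, t)) (extChartAt (𝓡 n) p p) := by
      fun_prop
    have he : (pderiv j fun x' => flowMap F p (F p t) (x', t) a) =ᶠ[𝓝 (extChartAt (𝓡 n) p p)]
        fun x' => along (flowMap F p (F p t)) (stdFrame n j, 0) (x', t) a := by
      filter_upwards [hc.preimage_mem_nhds (S.isOpen.mem_nhds hz)] with x' hx'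
      exact first _ hx' j a
    have h1 := (EuclideanSpace.proj (𝕜 := ℝ) a).hasFDerivAt.comp _
      (hasFDerivAt_slice (x := extChartAt (𝓡 n) p p) (t := t) hd)
    rw [pderiv, he.fderiv_eq]
    exact congrArg (fun L => L (EuclideanSpace.single i 1)) h1.fderiv
  rw [chartInv_eq_sum]
  refine Finset.sum_congr rfl fun a _ => ?_
  congr 1
  rw [covD, PiLp.add_apply, ← second, connAlong, ContinuousLinearMap.comp_apply, chartConn,
    connCLM_apply, e0]
  congr 1
  refine Finset.sum_congr rfl fun b _ => Finset.sum_congr rfl fun c _ => ?_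
  exact congrArg₂ (· * ·) (congrArg₂ (· * ·) rfl (first _ hz i b)) (first _ hz j c)

/-- Differentiating `⟨ν, ∂_j F⟩ = 0` gives `⟨∇_i∂_j F, -ν⟩ = ⟨∇_iν, ∂_j F⟩`. -/
theorem secondFF_eq_flowSff (p : M) {t : ℝ} (ht : t ∈ J) :
    secondFF g F ν p t = flowSff g F p (F p t) (extChartAt (𝓡 n) p p, t) := by
  have S := isFlowChart hJ hF hK p (F p t)
  have hz := base_mem_flowDomain (n := n) (F := F) p ht
  have e0 : flowMap F p (F p t) (extChartAt (𝓡 n) p p, t) =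
      extChartAt (𝓡 (n + 1)) (F p t) (F p t) := by
    simp only [flowMap, extChartAt_to_inv]
  have eν : ∀ q, q = p → (ν q t : EuclideanSpace ℝ (Fin (n + 1))) = ν p t := by
    rintro q rfl; rfl
  have hν := chartInv_flowNormal hJ hF hz
  rw [e0] at hν
  ext i j
  have h1 : secondFF g F ν p t i j = - flowForm g F p (F p t) (extChartAt (𝓡 n) p p, t)
      (covD (connAlong (chartConn g (F p t)) (flowMap F p (F p t))) (stdFrame n i, 0)
        (along (flowMap F p (F p t)) (stdFrame n j, 0)) (extChartAt (𝓡 n) p p, t))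
      (flowNormal g F p (F p t) (extChartAt (𝓡 n) p p, t)) := by
    rw [flowForm, chartForm_apply, e0, hν, ← ambientHessian_eq hJ hF hK p ht]
    have h2 : secondFF g F ν p t i j = - form g (F p t) (ambientHessian g F p t i j) (ν p t) :=
      (form_isLinearMap_right g (F p t) _).map_neg _
    rw [h2, neg_inj]
    refine (form_congr g (extChartAt_to_inv (I := 𝓡 (n + 1)) (F p t)) _ _).symm.trans ?_
    exact congrArg (fun v : EuclideanSpace ℝ (Fin (n + 1)) => form g
      ((extChartAt (𝓡 (n + 1)) (F p t)).symm (extChartAt (𝓡 (n + 1)) (F p t) (F p t)))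
      (ambientHessian g F p t i j) v) (eν _ (extChartAt_to_inv (I := 𝓡 n) p)).symm
  rw [h1, S.symm _ hz, ← S.ip_covD_normal hz]
  rfl

/-- This recovers `h` from the metric in any chart, since the speed is positive; hence `h` changes
between charts as the metric does. -/
theorem hasDerivAt_coeff_inducedMetric {p : M} {y₀ : N} {z : EuclideanSpace ℝ (Fin n) × ℝ}
    (hz : z ∈ flowDomain (n := n) F J p y₀) (i j : Fin n) :
    HasDerivAt (fun s => coeff (inducedMetric g F s) p z.1 i j)
      (2 * flowSpeed g F p y₀ z * flowSff g F p y₀ z i j) z.2 := by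
  have S := isFlowChart hJ hF hK p y₀
  have hd := differentiableAt_of_contDiffOn S.isOpen
    (S.smooth_ip (S.smooth_along (stdFrame n i, 0)) (S.smooth_along (stdFrame n j, 0))) hz
  have h1 : HasDerivAt (fun s : ℝ => (z.1, s)) ((0 : EuclideanSpace ℝ (Fin n)), (1 : ℝ)) z.2 :=
    (hasDerivAt_const z.2 z.1).prodMk (hasDerivAt_id z.2)
  have h2 := hd.hasFDerivAt.comp_hasDerivAt z.2 h1
  rw [S.fderiv_time_metric hz] at h2
  have hc : Continuous fun s : ℝ => (z.1, s) := by fun_prop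
  refine h2.congr_of_eventuallyEq ?_
  filter_upwards [hc.continuousAt.preimage_mem_nhds (S.isOpen.mem_nhds hz)] with s hs
  exact congrFun (congrFun (coeff_inducedMetric hJ hF (z := (z.1, s)) hs) i) j

/-- The change of frame between two charts. -/
theorem exists_transition {p : M} {y₀ : N} {z : EuclideanSpace ℝ (Fin n) × ℝ}
    (hz : z ∈ flowDomain (n := n) F J p y₀) {q : M} (hq : (extChartAt (𝓡 n) p).symm z.1 = q) :
    ∃ P : Matrix (Fin n) (Fin n) ℝ, IsUnit P.det ∧
      coeff (inducedMetric g F z.2) q (extChartAt (𝓡 n) q q) =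
        P.transpose * flowGram g F p y₀ z * P ∧
      secondFF g F ν q z.2 = P.transpose * flowSff g F p y₀ z * P := by
  obtain ⟨P, hP⟩ : ∃ P : Matrix (Fin n) (Fin n) ℝ, ∀ i, chartInv p z.1 (colFrame P i) =
      chartInv q (extChartAt (𝓡 n) q q) (stdFrame n i) := by
    choose c hc using fun i => (chartInv_isInvertible hz.1.1).surjective
      (chartInv q (extChartAt (𝓡 n) q q) (stdFrame n i))
    exact ⟨Matrix.of fun j i => c i j, hc⟩
  -- `P` depends only on the two charts at the point, so this holds with the same `P` for every time
  -- `s` and can be differentiated in time.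
  have hP' : ∀ s, coeff (inducedMetric g F s) q (extChartAt (𝓡 n) q q) =
      P.transpose * coeff (inducedMetric g F s) p z.1 * P := by
    intro s
    ext i j
    rw [conj_apply_eq_formCLM, formCLM_coeff (inducedMetric_isLinearMap_left g F s)
      (inducedMetric_isLinearMap_right g F s), hP, hP]
    exact inducedMetric_congr g F s ((extChartAt_to_inv (I := 𝓡 n) q).trans hq.symm) _ _
  have hz' := base_mem_flowDomain (n := n) (F := F) q hz.1.2
  refine ⟨P, ?_, ?_, ?_⟩
  · refine isUnit_iff_ne_zero.2 fun h0 => (posDef_gram hJ hF hz').det_pos.ne' ?_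
    have := hP' z.2
    rw [coeff_inducedMetric hJ hF hz'] at this
    rw [this, Matrix.det_mul, h0, mul_zero]
  · rw [hP', coeff_inducedMetric hJ hF hz]; rfl
  -- Both charts give the speed `1/H` at the same point, so the factor `2w` cancels from the
  -- differentiated identity.
  · have hs : flowSpeed g F q (F q z.2) (extChartAt (𝓡 n) q q, z.2) = flowSpeed g F p y₀ z := by
      rw [flowSpeed_eq hJ hF hz, flowSpeed_eq hJ hF hz']
      simp only [extChartAt_to_inv, hq]
    have hpos := flowSpeed_pos hJ hF hz
    rw [secondFF_eq_flowSff hJ hF hK q hz.1.2]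
    ext i j
    have h1 := hasDerivAt_coeff_inducedMetric hJ hF hK hz' i j
    have h2 : HasDerivAt (fun s => (P.transpose * coeff (inducedMetric g F s) p z.1 * P) i j)
        (∑ b, (∑ a, P.transpose i a * (2 * flowSpeed g F p y₀ z * flowSff g F p y₀ z a b)) *
          P b j) z.2 := by
      simp only [Matrix.mul_apply]
      exact HasDerivAt.fun_sum fun b _ => (HasDerivAt.fun_sum fun a _ =>
        (hasDerivAt_coeff_inducedMetric hJ hF hK hz a b).const_mul _).mul_const _
    simp only [hP'] at h1
    have h3 := h1.unique h2
    rw [hs] at h3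
    refine mul_left_cancel₀ (mul_pos two_pos hpos).ne' (h3.trans ?_)
    simp only [Matrix.mul_apply, Finset.mul_sum, Finset.sum_mul]
    exact Finset.sum_congr rfl fun b _ => Finset.sum_congr rfl fun a _ => by ring

end SecondFundamentalForm

theorem dotProduct_conj_mulVec {n : ℕ} (A P : Matrix (Fin n) (Fin n) ℝ) (v w : Fin n → ℝ) :
    v ⬝ᵥ (P.transpose * A * P).mulVec w = (P.mulVec v) ⬝ᵥ A.mulVec (P.mulVec w) := by
  rw [← Matrix.mulVec_mulVec, ← Matrix.mulVec_mulVec, Matrix.dotProduct_mulVec,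
    Matrix.vecMul_transpose]

/-! ### Mean and lowest curvature in a fixed chart. -/

section Curvatures

variable {n : ℕ}
  {M : Type*} [TopologicalSpace M] [ChartedSpace (EuclideanSpace ℝ (Fin n)) M]
  {N : Type*} [TopologicalSpace N] [ChartedSpace (EuclideanSpace ℝ (Fin (n + 1))) N]
  [IsManifold (𝓡 (n + 1)) ∞ N] [IsManifold (𝓡 n) ∞ M]
  {g : SmoothMetric (n + 1) N} {J : Set ℝ} {F : M → ℝ → N}
  {ν : ∀ (p : M) (t : ℝ), TangentSpace (𝓡 (n + 1)) (F p t)}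
  (hJ : IsOpen J) (hF : IsSmoothIMCF g J F ν) {K : ℝ}
  (hK : HasConstantSectionalCurvature (form g) K)
  {p : M} {y₀ : N} {z : EuclideanSpace ℝ (Fin n) × ℝ}
  (hz : z ∈ flowDomain (n := n) F J p y₀)
include hJ hF hK hz

theorem meanCurvature_eq_trace :
    meanCurvature g F ν ((extChartAt (𝓡 n) p).symm z.1) z.2 =
      ((flowGram g F p y₀ z)⁻¹ * flowSff g F p y₀ z).trace := by
  obtain ⟨P, hP, h1, h2⟩ := exists_transition hJ hF hK hz rfl
  rw [meanCurvature, shape, h1, h2, trace_inv_mul_conj hP]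

/-- The Rayleigh characterisation in a fixed chart, so that nearby points can be compared, although
`lowestCurvature` is defined in a different chart at each point. The minimiser is transported by
`P`. -/
theorem lowestCurvature_isLeast [NeZero n] :
    (∀ ζ : EuclideanSpace ℝ (Fin n),
      lowestCurvature g F ν ((extChartAt (𝓡 n) p).symm z.1) z.2 *
        formCLM (flowGram g F p y₀ z) ζ ζ ≤ formCLM (flowSff g F p y₀ z) ζ ζ) ∧
    ∃ ζ : EuclideanSpace ℝ (Fin n), ζ ≠ 0 ∧
      lowestCurvature g F ν ((extChartAt (𝓡 n) p).symm z.1) z.2 *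
        formCLM (flowGram g F p y₀ z) ζ ζ = formCLM (flowSff g F p y₀ z) ζ ζ := by
  obtain ⟨P, hP, h1, h2⟩ := exists_transition hJ hF hK hz rfl
  have hz' := base_mem_flowDomain (n := n) (F := F) ((extChartAt (𝓡 n) p).symm z.1) hz.1.2
  have hpd := posDef_gram hJ hF hz'
  rw [← coeff_inducedMetric hJ hF hz'] at hpd
  have hsym : (secondFF g F ν ((extChartAt (𝓡 n) p).symm z.1) z.2).IsSymm := by
    rw [secondFF_eq_flowSff hJ hF hK _ hz.1.2]
    exact Matrix.IsSymm.ext fun i j => flowSff_symm hJ hF hK hz' j i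
  obtain ⟨k1, v, hv, k2⟩ := lowest_eigenvalue_isLeast hpd hsym
  simp only [h1, h2, dotProduct_conj_mulVec] at k1 k2
  have hl : lowestCurvature g F ν ((extChartAt (𝓡 n) p).symm z.1) z.2 =
      sInf {l | Module.End.HasEigenvalue (Matrix.toLin' ((P.transpose * flowGram g F p y₀ z * P)⁻¹ *
        (P.transpose * flowSff g F p y₀ z * P))) l} := by
    rw [lowestCurvature, shape, h1, h2]
  rw [hl]
  simp only [formCLM_eq_dotProduct]
  have hP' := Matrix.isUnit_iff_isUnit_det P |>.2 hP
  refine ⟨fun ζ => ?_, WithLp.toLp 2 (P.mulVec v), fun h0 => hv ?_, k2.symm⟩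
  · have := k1 (P⁻¹.mulVec ζ)
    rwa [Matrix.mulVec_mulVec, Matrix.mul_nonsing_inv P hP, Matrix.one_mulVec] at this
  · have h3 : P.mulVec v = 0 := by simpa using h0
    have := congrArg (P⁻¹.mulVec) h3
    rwa [Matrix.mulVec_mulVec, Matrix.nonsing_inv_mul P hP, Matrix.one_mulVec,
      Matrix.mulVec_zero] at this

end Curvatures

theorem christoffel_congr {m : ℕ} {G G' : EuclideanSpace ℝ (Fin m) → Matrix (Fin m) (Fin m) ℝ}
    {z : EuclideanSpace ℝ (Fin m)} (h : G =ᶠ[𝓝 z] G') (k i j : Fin m) :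
    christoffel G z k i j = christoffel G' z k i j := by
  have e : ∀ a b c, pderiv a (fun y => G y b c) z = pderiv a (fun y => G' y b c) z := by
    intro a b c
    have : (fun y => G y b c) =ᶠ[𝓝 z] fun y => G' y b c := h.mono fun y hy => by
      show G y b c = G' y b c
      rw [hy]
    rw [pderiv, pderiv, this.fderiv_eq]
  simp only [christoffel, e, h.eq_of_nhds]

theorem isOpen_timeInterval (T : EReal) : IsOpen (timeInterval T) :=
  isOpen_Ioi.inter (isOpen_Iio.preimage continuous_coe_real_ereal)

/-! ### Gradients and the induced metric in an orthonormal frame. -/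

section Frames

variable {n : ℕ} {M : Type*} [TopologicalSpace M] [ChartedSpace (EuclideanSpace ℝ (Fin n)) M]

/-- The tangent vector at `p` with components `a` in the frame given by the columns of `Q`. -/
def frameVec (p : M) (Q : Matrix (Fin n) (Fin n) ℝ) (a : Fin n → ℝ) : TangentSpace (𝓡 n) p :=
  (chartInv p (extChartAt (𝓡 n) p p) (WithLp.toLp 2 (Q.mulVec a)) : EuclideanSpace ℝ (Fin n))

/-- The partial derivatives at `p` in the chart around `p`. -/
def chartGrad (φ : M → ℝ) (p : M) (j : Fin n) : ℝ :=
  pderiv j (fun y => φ ((extChartAt (𝓡 n) p).symm y)) (extChartAt (𝓡 n) p p)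

theorem frameVec_smul (p : M) (Q : Matrix (Fin n) (Fin n) ℝ) (c : ℝ) (a : Fin n → ℝ) :
    frameVec p Q (c • a) = c • frameVec p Q a := by
  simp only [frameVec, Matrix.mulVec_smul, WithLp.toLp_smul]
  exact map_smul _ _ _

theorem gradient_eq_frameVec {b : ∀ x : M, TangentSpace (𝓡 n) x → TangentSpace (𝓡 n) x → ℝ} {p : M}
    {Q : Matrix (Fin n) (Fin n) ℝ}
    (hQ : Q.transpose * coeff b p (extChartAt (𝓡 n) p p) * Q = 1) (φ : M → ℝ) :
    gradient b φ p = frameVec p Q (Q.transpose.mulVec (chartGrad φ p)) := by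
  have hinv : (coeff b p (extChartAt (𝓡 n) p p))⁻¹ = Q * Q.transpose := by
    refine Matrix.inv_eq_left_inv ?_
    rw [Matrix.mul_assoc]; exact mul_eq_one_comm.1 hQ
  rw [frameVec, chartInv_eq_sum, Matrix.mulVec_mulVec, ← hinv]
  rfl

theorem metric_frameVec {N : Type*} [TopologicalSpace N]
    [ChartedSpace (EuclideanSpace ℝ (Fin (n + 1))) N] [IsManifold (𝓡 (n + 1)) ∞ N]
    {g : SmoothMetric (n + 1) N} {F : M → ℝ → N} {t : ℝ} {p : M} {Q : Matrix (Fin n) (Fin n) ℝ}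
    (hQ : Q.transpose * coeff (inducedMetric g F t) p (extChartAt (𝓡 n) p p) * Q = 1)
    (a a' : Fin n → ℝ) :
    inducedMetric g F t p (frameVec p Q a) (frameVec p Q a') = a ⬝ᵥ a' := by
  have h := formCLM_coeff (inducedMetric_isLinearMap_left g F t)
    (inducedMetric_isLinearMap_right g F t) p (extChartAt (𝓡 n) p p)
    (WithLp.toLp 2 (Q.mulVec a)) (WithLp.toLp 2 (Q.mulVec a'))
  refine (inducedMetric_congr g F t (extChartAt_to_inv (I := 𝓡 n) p) _ _).symm.trans
      (h.symm.trans ?_)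
  rw [formCLM_eq_dotProduct]
  show Q.mulVec a ⬝ᵥ (coeff (inducedMetric g F t) p (extChartAt (𝓡 n) p p)).mulVec (Q.mulVec a') = _
  rw [← dotProduct_conj_mulVec, hQ, Matrix.one_mulVec]

end Frames

/-! ### Lower semicontinuity of `λ₁/H`. -/

section Semicontinuity

variable {n : ℕ}
  {M : Type*} [TopologicalSpace M] [ChartedSpace (EuclideanSpace ℝ (Fin n)) M]
  {N : Type*} [TopologicalSpace N] [ChartedSpace (EuclideanSpace ℝ (Fin (n + 1))) N]
  [IsManifold (𝓡 (n + 1)) ∞ N] [IsManifold (𝓡 n) ∞ M]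
  {g : SmoothMetric (n + 1) N} {J : Set ℝ} {F : M → ℝ → N}
  {ν : ∀ (p : M) (t : ℝ), TangentSpace (𝓡 (n + 1)) (F p t)}
  (hJ : IsOpen J) (hF : IsSmoothIMCF g J F ν) {K : ℝ}
  (hK : HasConstantSectionalCurvature (form g) K)
include hJ hF hK

omit hK in
theorem formCLM_flowGram_pos {p : M} {y₀ : N} {z : EuclideanSpace ℝ (Fin n) × ℝ}
    (hz : z ∈ flowDomain (n := n) F J p y₀) {ζ : EuclideanSpace ℝ (Fin n)} (hζ : ζ ≠ 0) :
    0 < formCLM (flowGram g F p y₀ z) ζ ζ := by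
  rw [flowGram, formCLM_eq_dotProduct]
  have := (posDef_gram hJ hF hz).dotProduct_mulVec_pos (x := fun i => ζ i)
    (fun h => hζ (by ext i; exact congrFun h i))
  simpa using this

omit hK in
theorem meanCurvature_eq_inv_flowSpeed {p : M} {y₀ : N} {z : EuclideanSpace ℝ (Fin n) × ℝ}
    (hz : z ∈ flowDomain (n := n) F J p y₀) :
    meanCurvature g F ν ((extChartAt (𝓡 n) p).symm z.1) z.2 = (flowSpeed g F p y₀ z)⁻¹ := by
  rw [flowSpeed_eq hJ hF hz, inv_inv]

/-- `λ₁/H > y` exactly when the form `h - yHg` is positive on the unit sphere. The form depends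
continuously on the point and the sphere is compact, so this condition is open. -/
theorem lowerSemicontinuousOn_lowestCurvature_div [NeZero n] :
    LowerSemicontinuousOn (fun z : M × ℝ => lowestCurvature g F ν z.1 z.2 /
      meanCurvature g F ν z.1 z.2) (Set.univ ×ˢ J) := by
  rintro ⟨p, t⟩ ⟨-, ht⟩ y hy
  refine Filter.Eventually.filter_mono nhdsWithin_le_nhds ?_
  have S := isFlowChart hJ hF hK p (F p t)
  have hz := base_mem_flowDomain (n := n) (F := F) p ht
  have key : ∀ z ∈ flowDomain (n := n) F J p (F p t),
      (y < lowestCurvature g F ν ((extChartAt (𝓡 n) p).symm z.1) z.2 /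
        meanCurvature g F ν ((extChartAt (𝓡 n) p).symm z.1) z.2 ↔
      ∀ ζ ∈ Metric.sphere (0 : EuclideanSpace ℝ (Fin n)) 1,
        0 < formCLM (flowSff g F p (F p t) z) ζ ζ -
          y * (flowSpeed g F p (F p t) z)⁻¹ * formCLM (flowGram g F p (F p t) z) ζ ζ) := by
    intro z hz
    obtain ⟨h1, η, hη, h2⟩ := lowestCurvature_isLeast hJ hF hK hz (n := n)
    rw [lt_div_iff₀ (hF.meanConvex _ _ hz.1.2), meanCurvature_eq_inv_flowSpeed hJ hF hz]
    constructor
    · intro hlt ζ hζ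
      have hpos := formCLM_flowGram_pos hJ hF hz (Metric.ne_of_mem_sphere hζ one_ne_zero)
      have := mul_lt_mul_of_pos_right hlt hpos
      linarith [h1 ζ]
    · intro hall
      have hn : 0 < ‖η‖ := norm_pos_iff.2 hη
      have h3 := hall (‖η‖⁻¹ • η) (by
        rw [mem_sphere_zero_iff_norm, norm_smul, norm_inv, norm_norm, inv_mul_cancel₀ hn.ne'])
      simp only [map_smul, smul_apply, smul_eq_mul, ← h2] at h3
      have hpos := formCLM_flowGram_pos hJ hF hz hη
      have hc : 0 < ‖η‖⁻¹ * ‖η‖⁻¹ := by positivity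
      by_contra! hle
      have h4 := mul_nonneg (sub_nonneg.2 (mul_le_mul_of_nonneg_right hle hpos.le)) hc.le
      linarith [h4]
  have c1 : ContDiffOn ℝ ∞ (fun z => formCLM (flowSff g F p (F p t) z))
      (flowDomain (n := n) F J p (F p t)) := contDiffOn_formCLM fun a b =>
    S.smooth_ip (S.smooth_covD S.smooth_normal _) (S.smooth_along _)
  have c2 : ContDiffOn ℝ ∞ (fun z => formCLM (flowGram g F p (F p t) z))
      (flowDomain (n := n) F J p (F p t)) := contDiffOn_formCLM fun a b =>
    S.smooth_ip (S.smooth_along _) (S.smooth_along _)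
  have hnhds := S.isOpen.mem_nhds hz
  have d1 := (c1.contDiffAt hnhds).continuousAt
  have d2 := (c2.contDiffAt hnhds).continuousAt
  have d3 := ((S.smooth_speed.contDiffAt hnhds).continuousAt).inv₀ (S.speed_pos _ hz).ne'
  have hev : ∀ᶠ z in 𝓝 (extChartAt (𝓡 n) p p, t),
      ∀ ζ ∈ Metric.sphere (0 : EuclideanSpace ℝ (Fin n)) 1,
        0 < formCLM (flowSff g F p (F p t) z) ζ ζ -
          y * (flowSpeed g F p (F p t) z)⁻¹ * formCLM (flowGram g F p (F p t) z) ζ ζ := by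
    refine (isCompact_sphere _ _).eventually_forall_of_forall_eventually fun ζ hζ => ?_
    have hpos := (key _ hz).1 (by simpa using hy) ζ hζ
    have hfst : ContinuousAt (Prod.fst : (EuclideanSpace ℝ (Fin n) × ℝ) ×
      EuclideanSpace ℝ (Fin n) → _) ((extChartAt (𝓡 n) p p, t), ζ) := continuousAt_fst
    have hsnd : ContinuousAt (Prod.snd : (EuclideanSpace ℝ (Fin n) × ℝ) ×
      EuclideanSpace ℝ (Fin n) → _) ((extChartAt (𝓡 n) p p, t), ζ) := continuousAt_snd
    have e1 := ((ContinuousAt.comp (x := ((extChartAt (𝓡 n) p p, t), ζ)) d1 hfst).clm_apply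
      hsnd).clm_apply hsnd
    have e2 := ((ContinuousAt.comp (x := ((extChartAt (𝓡 n) p p, t), ζ)) d2 hfst).clm_apply
      hsnd).clm_apply hsnd
    have e3 := ContinuousAt.comp (x := ((extChartAt (𝓡 n) p p, t), ζ)) d3 hfst
    exact (e1.sub ((continuousAt_const.mul e3).mul e2)).eventually (lt_mem_nhds hpos)
  have hc : ContinuousAt (fun z : M × ℝ => (extChartAt (𝓡 n) p z.1, z.2)) (p, t) :=
    (ContinuousAt.comp (x := (p, t)) (f := Prod.fst) (g := extChartAt (𝓡 n) p)
      (continuousAt_extChartAt p) continuousAt_fst).prodMk continuousAt_snd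
  filter_upwards [hc.eventually (hev.and hnhds),
    continuousAt_fst.preimage_mem_nhds (extChartAt_source_mem_nhds (I := 𝓡 n) p)] with z h1 h2
  have h3 := (key _ h1.2).2 h1.1
  simpa only [(extChartAt (𝓡 n) p).left_inv h2] using h3

end Semicontinuity

/-! ### Test functions on the manifold and the choice of `V` and `W`. -/

section Main

variable {n : ℕ}
  {M : Type*} [TopologicalSpace M] [ChartedSpace (EuclideanSpace ℝ (Fin n)) M]
  {N : Type*} [TopologicalSpace N] [ChartedSpace (EuclideanSpace ℝ (Fin (n + 1))) N]
  [IsManifold (𝓡 (n + 1)) ∞ N] [IsManifold (𝓡 n) ∞ M]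
  {g : SmoothMetric (n + 1) N} {J : Set ℝ} {F : M → ℝ → N}
  {ν : ∀ (p : M) (t : ℝ), TangentSpace (𝓡 (n + 1)) (F p t)}
  (hJ : IsOpen J) (hF : IsSmoothIMCF g J F ν) {K : ℝ}
  (hK : HasConstantSectionalCurvature (form g) K)
include hJ hF hK

/-- A frame of principal directions. -/
theorem exists_principal_frame [NeZero n] (p : M) {t : ℝ} (ht : t ∈ J) :
    ∃ (Q : Matrix (Fin n) (Fin n) ℝ) (d : Fin n → ℝ) (i : Fin n),
      Q.transpose * coeff (inducedMetric g F t) p (extChartAt (𝓡 n) p p) * Q = 1 ∧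
      Q.transpose * secondFF g F ν p t * Q = Matrix.diagonal d ∧
      (∀ k, d i ≤ d k) ∧ lowestCurvature g F ν p t = d i := by
  have hz := base_mem_flowDomain (n := n) (F := F) p ht
  have hpd := posDef_gram hJ hF hz
  rw [← coeff_inducedMetric hJ hF hz] at hpd
  have hsym : (secondFF g F ν p t).IsSymm := by
    rw [secondFF_eq_flowSff hJ hF hK p ht]
    exact Matrix.IsSymm.ext fun i j => flowSff_symm hJ hF hK hz j i
  obtain ⟨Q, d, hQg, hQh⟩ := exists_simultaneous_diagonal hpd hsym
  obtain ⟨i, hi, hl⟩ := lowest_eigenvalue hQg hQh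
  exact ⟨Q, d, i, hQg, hQh, hi, hl⟩

/-- Transfers `supersolution_coord` to the manifold. The vectors `a` and `f` are the components of
`∇H` and `∇φ` in the principal frame. -/
theorem touching_inequality [NeZero n] (hconv : IsConvexFlow g J F ν) {p : M} {t : ℝ} (ht : t ∈ J)
    {Q : Matrix (Fin n) (Fin n) ℝ} {d : Fin n → ℝ} {i : Fin n}
    (hQg : Q.transpose * coeff (inducedMetric g F t) p (extChartAt (𝓡 n) p p) * Q = 1)
    (hQh : Q.transpose * secondFF g F ν p t * Q = Matrix.diagonal d)
    (hlow : ∀ k, d i ≤ d k) (hl : lowestCurvature g F ν p t = d i)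
    {φ : M → ℝ → ℝ}
    (hφ : ContMDiffAt ((𝓡 n).prod 𝓘(ℝ, ℝ)) 𝓘(ℝ, ℝ) 2 (fun z : M × ℝ => φ z.1 z.2) (p, t))
    (hφp : φ p t = lowestCurvature g F ν p t / meanCurvature g F ν p t)
    (htouch : ∀ᶠ z in 𝓝[Set.univ ×ˢ Set.Iic t] ((p, t) : M × ℝ), φ z.1 z.2 ≤
      lowestCurvature g F ν z.1 z.2 / meanCurvature g F ν z.1 z.2)
    {a f : Fin n → ℝ}
    (ha : a = Q.transpose.mulVec (chartGrad (fun q => meanCurvature g F ν q t) p))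
    (hf : f = Q.transpose.mulVec (chartGrad (fun q => φ q t) p)) :
    0 ≤ deriv (fun s => φ p s) t
      - (meanCurvature g F ν p t ^ 2)⁻¹ * laplacian (inducedMetric g F t) (fun q => φ q t) p
      + (meanCurvature g F ν p t ^ 3)⁻¹ * (-2 * a ⬝ᵥ f + 4 * a i * f i)
      + (4 * a i ^ 2 - 2 * a ⬝ᵥ a) / meanCurvature g F ν p t ^ 4 * φ p t := by
  have S := isFlowChart hJ hF hK p (F p t)
  have hz := base_mem_flowDomain (n := n) (F := F) p ht
  have hnhds := S.isOpen.mem_nhds hz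
  have hinv := extChartAt_to_inv (I := 𝓡 n) p
  have hH : (flowSpeed g F p (F p t) (extChartAt (𝓡 n) p p, t))⁻¹ = meanCurvature g F ν p t := by
    rw [← meanCurvature_eq_inv_flowSpeed hJ hF hz]
    simp only [hinv]
  have hsymm : ContMDiffAt ((𝓡 n).prod 𝓘(ℝ, ℝ)) ((𝓡 n).prod 𝓘(ℝ, ℝ)) 2
      (fun y : EuclideanSpace ℝ (Fin n) × ℝ => ((extChartAt (𝓡 n) p).symm y.1, y.2))
      (extChartAt (𝓡 n) p p, t) := by
    have h1 : ContMDiffAt (𝓡 n) (𝓡 n) 2 (extChartAt (𝓡 n) p).symm (extChartAt (𝓡 n) p p) :=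
      ((contMDiffOn_extChartAt_symm (n := ∞) p).contMDiffAt
        ((isOpen_extChartAt_target p).mem_nhds (mem_extChartAt_target p))).of_le ENat.LEInfty.out
    exact (ContMDiffAt.comp (g := (extChartAt (𝓡 n) p).symm) (extChartAt (𝓡 n) p p, t) (by exact h1)
      contMDiffAt_fst).prodMk contMDiffAt_snd
  have hφ' : ContDiffAt ℝ 2 (fun y : EuclideanSpace ℝ (Fin n) × ℝ =>
      φ ((extChartAt (𝓡 n) p).symm y.1) y.2) (extChartAt (𝓡 n) p p, t) := by
    refine contDiffAt_of_contMDiffAt_prod (ContMDiffAt.comp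
      (g := fun z : M × ℝ => φ z.1 z.2) (extChartAt (𝓡 n) p p, t) ?_ hsymm)
    simpa only [hinv] using hφ
  -- The use of convexity.
  have hd0 : 0 ≤ d i := by
    have h1 := hconv p t ht (Q.mulVec (Pi.single i 1))
    rw [← dotProduct_conj_mulVec, hQh] at h1
    simpa using h1
  have hle : ∀ᶠ y in 𝓝 (extChartAt (𝓡 n) p p, t), y.2 ≤ t → ∀ ζ : EuclideanSpace ℝ (Fin n),
      φ ((extChartAt (𝓡 n) p).symm y.1) y.2 * (flowSpeed g F p (F p t) y)⁻¹ *
        formCLM (flowGram g F p (F p t) y) ζ ζ ≤ formCLM (flowSff g F p (F p t) y) ζ ζ := by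
    rw [eventually_nhdsWithin_iff] at htouch
    have hc := hsymm.continuousAt
    have htouch' : ∀ᶠ z in 𝓝 (((extChartAt (𝓡 n) p).symm (extChartAt (𝓡 n) p p), t) : M × ℝ),
        z ∈ (Set.univ : Set M) ×ˢ Set.Iic t → φ z.1 z.2 ≤
          lowestCurvature g F ν z.1 z.2 / meanCurvature g F ν z.1 z.2 := by rwa [hinv]
    filter_upwards [hc.eventually htouch', hnhds] with y hy hyU hyt ζ
    -- Touching becomes an inequality of forms: `φ H g(ζ,ζ) ≤ λ₁ g(ζ,ζ) ≤ h(ζ,ζ)` for every `ζ`.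
    have h1 := hy ⟨trivial, hyt⟩
    rw [le_div_iff₀ (hF.meanConvex _ _ hyU.1.2), meanCurvature_eq_inv_flowSpeed hJ hF hyU] at h1
    refine le_trans ?_ ((lowestCurvature_isLeast hJ hF hK hyU).1 ζ)
    refine mul_le_mul_of_nonneg_right h1 ?_
    rcases eq_or_ne ζ 0 with rfl | hζ
    · simp
    · exact (formCLM_flowGram_pos hJ hF hyU hζ).le
  rw [coeff_inducedMetric hJ hF (z := (extChartAt (𝓡 n) p p, t)) hz] at hQg
  rw [secondFF_eq_flowSff hJ hF hK p ht] at hQh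
  have main := supersolution_coord (by simp) (isSpaceForm_chart g hK (F p t))
    (fun z hz => (extChartAt (𝓡 (n + 1)) (F p t)).map_source hz.2) S
    (fun y hy => posDef_gram hJ hF hy)
    (fun y hy => by
      rw [← meanCurvature_eq_inv_flowSpeed hJ hF hy]
      exact meanCurvature_eq_trace hJ hF hK hy) hz hQg hQh hlow hd0 hφ'
    (by
      simp only [hinv]
      rw [hH, hφp, hl, div_mul_cancel₀ _ (hF.meanConvex p t ht).ne']) hle
  have hgram : coeff (inducedMetric g F t) p =ᶠ[𝓝 (extChartAt (𝓡 n) p p)]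
      fun z => gram (flowMap F p (F p t)) (flowForm g F p (F p t)) (stdFrame n) (z, t) := by
    have hc : ContinuousAt (fun x : EuclideanSpace ℝ (Fin n) => (x, t)) (extChartAt (𝓡 n) p p) := by
      fun_prop
    filter_upwards [hc.preimage_mem_nhds hnhds] with x hx
    exact coeff_inducedMetric hJ hF (z := (x, t)) hx
  have hHder : ∀ j, pderiv j (fun z => (flowSpeed g F p (F p t) (z, t))⁻¹) (extChartAt (𝓡 n) p p) =
      chartGrad (fun q => meanCurvature g F ν q t) p j := by
    intro j
    have hc : ContinuousAt (fun x : EuclideanSpace ℝ (Fin n) => (x, t)) (extChartAt (𝓡 n) p p) := by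
      fun_prop
    have he : (fun z => (flowSpeed g F p (F p t) (z, t))⁻¹) =ᶠ[𝓝 (extChartAt (𝓡 n) p p)]
        fun y => meanCurvature g F ν ((extChartAt (𝓡 n) p).symm y) t := by
      filter_upwards [hc.preimage_mem_nhds hnhds] with x hx
      exact (meanCurvature_eq_inv_flowSpeed hJ hF (z := (x, t)) hx).symm
    rw [pderiv, he.fderiv_eq]; rfl
  have hlap : laplacian (inducedMetric g F t) (fun q => φ q t) p =
      ∑ a, ∑ b, (gram (flowMap F p (F p t)) (flowForm g F p (F p t)) (stdFrame n)
          (extChartAt (𝓡 n) p p, t))⁻¹ a b *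
          (pderiv a (pderiv b fun z => φ ((extChartAt (𝓡 n) p).symm z) t) (extChartAt (𝓡 n) p p)
            - ∑ c, christoffel (fun z => gram (flowMap F p (F p t)) (flowForm g F p (F p t))
              (stdFrame n) (z, t)) (extChartAt (𝓡 n) p p) c a b *
              pderiv c (fun z => φ ((extChartAt (𝓡 n) p).symm z) t) (extChartAt (𝓡 n) p p)) := by
    rw [laplacian]
    simp only [christoffel_congr hgram, hgram.eq_of_nhds]
  have ha' : ∀ k, a k = ∑ j, Q j k * chartGrad (fun q => meanCurvature g F ν q t) p j := fun k => by
    rw [ha]; rfl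
  have hf' : ∀ k, f k = ∑ j, Q j k *
      pderiv j (fun z => φ ((extChartAt (𝓡 n) p).symm z) t) (extChartAt (𝓡 n) p p) := fun k => by
    rw [hf]; rfl
  have e1 : -2 * a ⬝ᵥ f = -2 * ∑ k, f k * a k := by
    rw [dotProduct]; simp only [mul_comm]
  have e2 : a ⬝ᵥ a = ∑ k, a k ^ 2 := by
    rw [dotProduct]; simp only [pow_two]
  rw [hlap, e1, e2]
  simp only [hH, hHder] at main
  change 0 ≤ deriv (fun s => φ ((extChartAt (𝓡 n) p).symm (extChartAt (𝓡 n) p p)) s) t - _ + _ +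
    _ * φ ((extChartAt (𝓡 n) p).symm (extChartAt (𝓡 n) p p)) t at main
  simp only [← ha', ← hf'] at main
  rw [hinv] at main
  exact main

/-- The coefficients depend on a choice of principal frame at `(p, t)` but not on the test function,
so they can be fixed before `φ`. The direction of `λ₁` may jump where eigenvalues cross, so no
continuity in `(p, t)` is to be expected. -/
theorem exists_touching_coefficients [NeZero n] (hconv : IsConvexFlow g J F ν) (p : M) {t : ℝ}
    (ht : t ∈ J) : ∃ (v : TangentSpace (𝓡 n) p) (c s : ℝ),
      s = tnorm (inducedMetric g F t) p
        (gradient (inducedMetric g F t) (fun q => meanCurvature g F ν q t) p) ∧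
      tnorm (inducedMetric g F t) p v = 2 * s ∧ |c| ≤ 2 * s ^ 2 ∧
      ∀ φ : M → ℝ → ℝ,
        ContMDiffAt ((𝓡 n).prod 𝓘(ℝ, ℝ)) 𝓘(ℝ, ℝ) 2 (fun z : M × ℝ => φ z.1 z.2) (p, t) →
        φ p t = lowestCurvature g F ν p t / meanCurvature g F ν p t →
        (∀ᶠ z in 𝓝[Set.univ ×ˢ Set.Iic t] ((p, t) : M × ℝ), φ z.1 z.2 ≤
          lowestCurvature g F ν z.1 z.2 / meanCurvature g F ν z.1 z.2) →
        0 ≤ deriv (fun s => φ p s) t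
          - (meanCurvature g F ν p t ^ 2)⁻¹ * laplacian (inducedMetric g F t) (fun q => φ q t) p
          + inducedMetric g F t p ((meanCurvature g F ν p t ^ 3)⁻¹ • v)
            (gradient (inducedMetric g F t) (fun q => φ q t) p)
          + c / meanCurvature g F ν p t ^ 4 * φ p t := by
  obtain ⟨Q, d, i, hQg, hQh, hlow, hl⟩ := exists_principal_frame hJ hF hK p ht
  obtain ⟨a, ha⟩ : ∃ a, a = Q.transpose.mulVec (chartGrad (fun q => meanCurvature g F ν q t) p) :=
    ⟨_, rfl⟩
  have haa : 0 ≤ a ⬝ᵥ a := Finset.sum_nonneg fun k _ => mul_self_nonneg _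
  have hai : a i ^ 2 ≤ a ⬝ᵥ a := by
    rw [pow_two]
    exact Finset.single_le_sum (f := fun k => a k * a k) (fun k _ => mul_self_nonneg _)
      (Finset.mem_univ i)
  -- The vector `-2a + 4a_i e_i` is `-2` times the reflection of `a` in the hyperplane orthogonal to
  -- `e_i`, so its length is exactly `2|a|`. The bound on `c` uses `0 ≤ a_i² ≤ |a|²`.
  refine ⟨frameVec p Q ((-2 : ℝ) • a + Pi.single i (4 * a i)), 4 * a i ^ 2 - 2 * a ⬝ᵥ a,
    Real.sqrt (a ⬝ᵥ a), ?_, ?_, ?_, fun φ hφ hφp htouch => ?_⟩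
  · rw [gradient_eq_frameVec hQg, ← ha, tnorm, metric_frameVec hQg]
  · rw [tnorm, metric_frameVec hQg]
    have : ((-2 : ℝ) • a + Pi.single i (4 * a i)) ⬝ᵥ ((-2 : ℝ) • a + Pi.single i (4 * a i)) =
        2 ^ 2 * a ⬝ᵥ a := by
      simp only [add_dotProduct, dotProduct_add, smul_dotProduct, dotProduct_smul,
        single_dotProduct, dotProduct_single, Pi.add_apply, Pi.smul_apply, Pi.single_eq_same,
        smul_eq_mul]
      ring
    rw [this, Real.sqrt_mul (by norm_num), Real.sqrt_sq (by norm_num)]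
  · rw [Real.sq_sqrt haa, abs_le]
    constructor <;> nlinarith [sq_nonneg (a i)]
  · have h := touching_inequality hJ hF hK hconv ht hQg hQh hlow hl hφ hφp htouch ha rfl
    rw [gradient_eq_frameVec hQg, ← frameVec_smul, metric_frameVec hQg, smul_dotProduct,
      add_dotProduct, smul_dotProduct, single_dotProduct]
    simpa only [smul_eq_mul] using h

end Main

end IMCF
end

theorem mainTheorem6 (n : ℕ) (hn : 1 ≤ n) :
    ∃ C : ℝ → ℝ, Monotone C ∧
      ∀ (M : Type*) [TopologicalSpace M] [ChartedSpace (EuclideanSpace ℝ (Fin n)) M]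
        [IsManifold (𝓡 n) ∞ M]
        (N : Type*) [TopologicalSpace N] [ChartedSpace (EuclideanSpace ℝ (Fin (n + 1))) N]
        [IsManifold (𝓡 (n + 1)) ∞ N]
        (g : IMCF.SmoothMetric (n + 1) N) (K : ℝ)
        (_ : IMCF.HasConstantSectionalCurvature (IMCF.form g) K)
        (T : EReal) (F : M → ℝ → N)
        (ν : ∀ (p : M) (t : ℝ), TangentSpace (𝓡 (n + 1)) (F p t))
        (_ : IMCF.IsSmoothIMCF g (IMCF.timeInterval T) F ν)
        (_ : IMCF.IsConvexFlow g (IMCF.timeInterval T) F ν),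
        ∃ (V : ∀ p : M, ℝ → TangentSpace (𝓡 n) p) (W : M → ℝ → ℝ),
          (∀ p : M, ∀ t ∈ IMCF.timeInterval T,
            let gradH : ℝ := IMCF.tnorm (IMCF.inducedMetric g F t) p
              (IMCF.gradient (IMCF.inducedMetric g F t)
                (fun q => IMCF.meanCurvature g F ν q t) p)
            IMCF.tnorm (IMCF.inducedMetric g F t) p (V p t) ≤ C gradH ∧
            |W p t| ≤ C gradH) ∧
          IMCF.IsViscositySupersolution (IMCF.timeInterval T) (IMCF.inducedMetric g F)
            (fun p t => (IMCF.meanCurvature g F ν p t ^ 2)⁻¹)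
            (fun p t => (IMCF.meanCurvature g F ν p t ^ 3)⁻¹ • V p t)
            (fun p t => W p t / IMCF.meanCurvature g F ν p t ^ 4)
            (fun p t => IMCF.lowestCurvature g F ν p t / IMCF.meanCurvature g F ν p t) := by
  have : NeZero n := ⟨by omega⟩
  -- The sum of the bounds `2s` for `V` and `2s²` for `W`; the truncation at `0` makes the function
  -- monotone on the whole line.
  refine ⟨fun s => 2 * max s 0 + 2 * max s 0 ^ 2, fun a b hab => ?_, ?_⟩
  · have h1 : max a 0 ≤ max b 0 := max_le_max_right 0 hab
    have h2 : 0 ≤ max a 0 := le_max_right _ _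
    exact add_le_add (mul_le_mul_of_nonneg_left h1 two_pos.le)
      (mul_le_mul_of_nonneg_left (pow_le_pow_left₀ h2 h1 2) two_pos.le)
  intro M _ _ _ N _ _ _ g K hK T F ν hF hconv
  have hJ := IMCF.isOpen_timeInterval T
  choose v c s hs hv hω hsuper using fun (p : M) (t : ℝ) (ht : t ∈ IMCF.timeInterval T) =>
    IMCF.exists_touching_coefficients hJ hF hK hconv p ht
  classical
  -- The value `0` outside the time interval is a mere default.
  refine ⟨fun p t => if ht : t ∈ IMCF.timeInterval T then v p t ht else 0,
    fun p t => if ht : t ∈ IMCF.timeInterval T then c p t ht else 0, fun p t ht => ?_,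
    IMCF.lowerSemicontinuousOn_lowestCurvature_div hJ hF hK, fun p t ht φ h1 h2 h3 => ?_⟩
  · simp only [dif_pos ht, ← hs p t ht]
    have h0 : 0 ≤ s p t ht := by rw [hs]; exact Real.sqrt_nonneg _
    rw [max_eq_left h0, hv]
    refine ⟨by nlinarith, (hω p t ht).trans (by linarith)⟩
  · simp only [dif_pos ht]
    exact hsuper p t ht φ h1 h2 h3
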